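/- Let $k$ be a field, $S=k[x_1,\dots,x_n]$, $\mathfrak a\subseteq S$ a monomial ideal with minimal monomial generating system $\{m_1,\dots,m_l\}$ and $A=S/\mathfrak a$. For $I\subseteq\{1,\dots,l\}$ put $m_I=\operatorname{lcm}(m_i : i\in I)$, and let $cl(I)$ be the number of classes of the equivalence relation on $I$ generated by $i\sim j\Leftrightarrow\gcd(m_i,m_j)\ne1$. The Taylor resolution $T_\bullet$ of $A$ has the $S$-basis $\{I\}$, $I$ in degree $|I|$, with $\partial I=\sum_{i\in I}(-1)^{\#\{a\in I:\,a<i\}}\frac{m_I}{m_{I\setminus i}}\,(I\setminus i)$. For an acyclic matching $\mathcal N$ (in the sense of algebraic discrete Morse theory: a matching of pairs of basis elements joined by a unit coefficient of the differential, such that reversing the matched edges creates no directed cycle) on a based complex $C$, let $C^{\mathcal N}$ be its Morse complex: its basis consists of the unmatched basis elements, and its differential coefficients are the sums of the weights of all paths in the graph with reversed edges (a reversed edge has weight $-1/[c:c']$). A *standard matching* $\mathcal M$ is a finite sequence of stages $\mathcal N_0,\dots,\mathcal N_{r-1}$ with levels $1\le i_0\le i_1\le\dots\le i_{r-1}$ ($\mathcal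 M_i$ being the union of the stages of level $i$) such that, with $T^{(0)}=T_\bullet$ and $T^{(s+1)}=(T^{(s)})^{\mathcal N_s}$: 1. all edges $I\to J$ in $\mathcal N_s$ satisfy $m_I=m_J$; 2. in $T^{\mathcal M}_\bullet:=T^{(r)}$ every edge $I\to J$ (nonzero coefficient of the differential) has $m_I\neq m_J$; 3. $\mathcal N_s$ is an acyclic matching on $T^{(s)}$; 4. $cl(J)-cl(I)=i_s-1$ and $|J|+1=|I|$ for all $I\to J$ in $\mathcal N_s$; 5. there is $\mathcal B_s\subseteq\mathcal N_s$ such that $cl(I)=1$, $cl(J)=i_s$ for all $I\to J$ in $\mathcal B_s$, and $\mathcal N_s=\mathcal B_s\cup\{I\cup K\to J\cup K : I\to J\in\mathcal B_s,\ K \text{ a basis element of } T^{(s)},\ \gcd(m_I,m_K)=1\}$. Write $I\notin\mathcal M$ if $I$ is unmatched, i.e. a basis element of $T^{\mathcal M}_\bullet$. Let $K^A_\bullet$ be the Koszul complex of $A$ with respect to $x_1,\dots,x_n$ with its exterior algebra structure, $Z(K)$ its algebra of cycles, $B(K)$ the ideal of boundaries in it, and $H(K^A)=Z(K)/B(K)$.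 For sets $I,J$ let $\varepsilon(I,J)=(-1)^{\#\{(a,b)\in I\times J:\,b<a\}}$. Theorem. Let $\mathcal M$ be a standard matching on the Taylor resolution of $\mathfrak a$. (a) There is a map $I\mapsto\phi(I)\in Z(K)$, $I\notin\mathcal M$, such that $\phi(I)$ is homogeneous of homological degree $|I|$ and multidegree $m_I$, the classes $[\phi(I)]$ form a $k$-basis of $H(K^A)$ (that is, $\phi$ induces $T^{\mathcal M}_\bullet\otimes_Sk\cong H(K^A)$), and $\phi(I)\phi(J)=\varepsilon(I,J)\,\phi(I\cup J)$ whenever $I,J,I\cup J\notin\mathcal M$ and $\gcd(m_I,m_J)=1$. (b) For every such $\phi$, let $R'$ be the quotient of the graded commutative polynomial ring $k(Y_I : I\notin\mathcal M,\ cl(I)=1)$ (so $Y_IY_J=(-1)^{|I||J|}Y_JY_I$) by the ideal $\mathfrak r'$ generated by the relations - $Y_IY_J=0$ if $\gcd(m_I,m_J)\ne1$; - $Y_{I_1}\cdots Y_{I_r}=\sum_{L\notin\mathcal M}a_LY_L$ if $a_L\in k$ and $\phi(I_1)\cdots\phi(I_r)-\sum_{L\notin\mathcal M} a_L\phi(L)\in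 B(K)$; - $Y_{I_1}\cdots Y_{I_r}=0$ if $\phi(I_1)\cdots\phi(I_r)\in B(K)$. Here, for $L\notin\mathcal M$ with equivalence classes $L_1,\dots,L_s$ (each of which is unmatched), $Y_L=\pm Y_{L_1}\cdots Y_{L_s}$, where $\pm$ is the sign of the permutation sorting the concatenation of $L_1,\dots,L_s$ (each in increasing order). Then $Y_I\mapsto[\phi(I)]$ defines an isomorphism of $k$-algebras $R'\cong H(K^A)$. It is multigraded: the part of $R'$ of total degree $p$ and multidegree $\alpha$ (where $Y_I$ has total degree $|I|$ and multidegree $m_I$) is mapped onto the part of $H(K^A)$ of homological degree $p$ and multidegree $\alpha$. -/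

import Mathlib

noncomputable section

open scoped BigOperators

namespace MonomialKoszul

/-! ### The Koszul algebra of a sequence and its homology algebra -/

section Koszul

variable {A : Type*} [CommRing A] {n : ℕ}

/-- The Koszul complex of `x_1, …, x_n` over `A` as an algebra:
the exterior algebra of `A^n`, free with basis the `e_J = e_{j_1} ∧ ⋯ ∧ e_{j_p}`. -/
abbrev Koszul (A : Type*) [CommRing A] (n : ℕ) : Type _ := ExteriorAlgebra A (Fin n → A)

/-- The Koszul differential: contraction with the functional `e_j ↦ x_j`, that is,
`∂ (e_{j_1} ∧ ⋯ ∧ e_{j_p}) = ∑_q (-1)^(q+1) x_{j_q} e_{j_1} ∧ ⋯ (omit e_{j_q}) ⋯ ∧ e_{j_p}`. -/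
def koszulD (x : Fin n → A) : Koszul A n →ₗ[A] Koszul A n :=
  CliffordAlgebra.contractLeft (Fintype.linearCombination A x)

theorem koszulD_mul (x : Fin n → A) (a b : Koszul A n) :
    koszulD x (a * b) = koszulD x a * b + CliffordAlgebra.involute a * koszulD x b := by
  unfold koszulD
  induction a using CliffordAlgebra.induction generalizing b with
  | algebraMap r => simp [CliffordAlgebra.contractLeft_algebraMap_mul,
      CliffordAlgebra.contractLeft_algebraMap]
  | ι v => rw [CliffordAlgebra.contractLeft_ι_mul, CliffordAlgebra.contractLeft_ι,
      CliffordAlgebra.involute_ι, ← Algebra.smul_def, neg_mul, sub_eq_add_neg]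
  | mul a₁ a₂ h₁ h₂ => rw [mul_assoc, h₁, h₂, h₁, map_mul]; noncomm_ring
  | add a₁ a₂ h₁ h₂ => rw [add_mul, map_add, h₁, h₂, map_add, map_add]; noncomm_ring

theorem koszulD_involute (x : Fin n → A) (a : Koszul A n) :
    koszulD x (CliffordAlgebra.involute a) = -CliffordAlgebra.involute (koszulD x a) := by
  induction a using CliffordAlgebra.induction with
  | algebraMap r => simp [koszulD, CliffordAlgebra.contractLeft_algebraMap]
  | ι v => simp [koszulD, CliffordAlgebra.contractLeft_ι]
  | mul a₁ a₂ h₁ h₂ =>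
    rw [map_mul, koszulD_mul, koszulD_mul, h₁, h₂, map_add, map_mul, map_mul]; noncomm_ring
  | add a₁ a₂ h₁ h₂ => rw [map_add, map_add, h₁, h₂, map_add, map_add]; abel

/-- The algebra `Z(K)` of cycles. -/
def cycles (x : Fin n → A) : Subalgebra A (Koszul A n) where
  carrier := {z | koszulD x z = 0}
  mul_mem' := by
    intro a b ha hb
    change koszulD x _ = 0 at *
    rw [koszulD_mul, ha, hb]; simp
  add_mem' := by
    intro a b ha hb
    change koszulD x _ = 0 at *
    rw [map_add, ha, hb, add_zero]
  algebraMap_mem' := by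
    intro r
    simp [koszulD, CliffordAlgebra.contractLeft_algebraMap]

theorem mem_cycles {x : Fin n → A} {z : Koszul A n} : z ∈ cycles x ↔ koszulD x z = 0 := Iff.rfl

/-- The two-sided ideal `B(K)` of boundaries in the algebra of cycles. -/
def boundaries (x : Fin n → A) : TwoSidedIdeal (cycles x) :=
  TwoSidedIdeal.mk' {z | ∃ c : Koszul A n, koszulD x c = z}
    ⟨0, by simp⟩
    (by rintro a b ⟨c, hc⟩ ⟨d, hd⟩; exact ⟨c + d, by simp [hc, hd]⟩)
    (by rintro a ⟨c, hc⟩; exact ⟨-c, by simp [hc]⟩)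
    (by
      rintro z b ⟨c, hc⟩
      refine ⟨CliffordAlgebra.involute (z : Koszul A n) * c, ?_⟩
      rw [koszulD_mul, koszulD_involute, mem_cycles.1 z.2, hc]
      simp)
    (by
      rintro b z ⟨c, hc⟩
      refine ⟨c * z, ?_⟩
      rw [koszulD_mul, mem_cycles.1 z.2, hc]
      simp)

theorem mem_boundaries {x : Fin n → A} {z : cycles x} :
    z ∈ boundaries x ↔ ∃ c : Koszul A n, koszulD x c = z := by
  simp [boundaries]

/-- The Koszul homology algebra `H(K) = Z(K) / B(K)`. -/
abbrev KoszulHomology (x : Fin n → A) : Type _ := (boundaries x).ringCon.Quotient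

/-- The homology class of a cycle. -/
def homologyClass {x : Fin n → A} (z : cycles x) : KoszulHomology x :=
  (boundaries x).ringCon.mk' z

end Koszul

/-! ### Monomial ideals and the combinatorics of their generators -/

section Combinatorics

variable {n l : ℕ}

/-- The monomials with exponent vectors `m_1, …, m_l` form, without repetition, the minimal
monomial generating system of the ideal `𝔞`. -/
structure IsMinGen {k : Type*} [Field k] (𝔞 : Ideal (MvPolynomial (Fin n) k))
    (m : Fin l → Fin n →₀ ℕ) : Prop where
  span_eq : 𝔞 = Ideal.span (Set.range fun i => MvPolynomial.monomial (m i) (1 : k))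
  minimal : ∀ i j, m i ≤ m j → i = j

/-- Exponent vector of `m_I = lcm (m_i : i ∈ I)`; subsets of the generating system are
given by their index sets. -/
def lcmExp (m : Fin l → Fin n →₀ ℕ) (I : Finset (Fin l)) : Fin n →₀ ℕ := I.sup m

/-- Two monomials, given by exponent vectors, have greatest common divisor `1`. -/
def GcdOne (a b : Fin n →₀ ℕ) : Prop := a ⊓ b = 0

/-- `gcd (m_I, m_J) = 1`. -/
def Coprime (m : Fin l → Fin n →₀ ℕ) (I J : Finset (Fin l)) : Prop :=
  GcdOne (lcmExp m I) (lcmExp m J)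

open Classical in
/-- The equivalence class in `I` of an element `i ∈ I`, for the equivalence relation on `I`
generated by `a ∼ b ↔ gcd (m_a, m_b) ≠ 1`. -/
def eqvClass (m : Fin l → Fin n →₀ ℕ) (I : Finset (Fin l)) (i : Fin l) : Finset (Fin l) :=
  I.filter fun j => Relation.EqvGen (fun a b => a ∈ I ∧ b ∈ I ∧ ¬ GcdOne (m a) (m b)) i j

/-- `cl(I)`, the number of equivalence classes of `I`. -/
def cl (m : Fin l → Fin n →₀ ℕ) (I : Finset (Fin l)) : ℕ := (I.image (eqvClass m I)).card

/-- The sign `(-1)^#{(a, b) ∈ I × J : b < a}` of the shuffle that sorts `I` followed by `J`. -/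
def shuffleSign (k : Type*) [Field k] (I J : Finset (Fin l)) : k :=
  (-1) ^ ((I ×ˢ J).filter fun p => p.2 < p.1).card

/-- The union of a list of sets. -/
def unionOf : List (Finset (Fin l)) → Finset (Fin l)
  | [] => ∅
  | I :: t => I ∪ unionOf t

/-- The sign of the permutation that sorts the concatenation of a list of sets. -/
def listSign (k : Type*) [Field k] : List (Finset (Fin l)) → k
  | [] => 1
  | I :: t => shuffleSign k I (unionOf t) * listSign k t

end Combinatorics

/-! ### Algebraic discrete Morse theory -/

section Morse

/-- A graded set of basis elements (`cells`, with homological degree `deg`) together with the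
matrix `d c c' = [c : c']` of an endomorphism of the free module on it. -/
structure BasedComplex (R X : Type*) where
  cells : Finset X
  deg : X → ℕ
  d : X → X → R

variable {R X : Type*} [CommRing R] [Fintype X] [DecidableEq X]

/-- `c → c'` is an edge of the graph of the complex. -/
def BasedComplex.Edge (C : BasedComplex R X) (c c' : X) : Prop :=
  c ∈ C.cells ∧ c' ∈ C.cells ∧ C.deg c = C.deg c' + 1 ∧ C.d c c' ≠ 0

/-- `c` lies in an edge of the matching `M`. -/
def Matched (M : Finset (X × X)) (c : X) : Prop := ∃ e ∈ M, c = e.1 ∨ c = e.2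

/-- Acyclic matchings on the graph of a based complex. -/
structure IsAcyclicMatching (C : BasedComplex R X) (M : Finset (X × X)) : Prop where
  edge : ∀ e ∈ M, C.Edge e.1 e.2
  matching : ∀ e ∈ M, ∀ e' ∈ M,
    (e.1 = e'.1 ∨ e.1 = e'.2 ∨ e.2 = e'.1 ∨ e.2 = e'.2) → e = e'
  isUnit : ∀ e ∈ M, IsUnit (C.d e.1 e.2)
  acyclic : ∀ c, ¬ Relation.TransGen
    (fun a b => (C.Edge a b ∧ (a, b) ∉ M) ∨ (b, a) ∈ M) c c

open Classical in
/-- Weighted adjacency matrix of the graph in which the edges of `M` are reversed: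
weight `[c : c']` on an edge `c → c'` outside `M`, and `-1 / [c' : c]` on `c → c'` if
`c' → c` is in `M`. -/
def morseWeight (C : BasedComplex R X) (M : Finset (X × X)) : Matrix X X R := fun c c' =>
  if (c', c) ∈ M then -Ring.inverse (C.d c' c)
  else if (c, c') ∉ M ∧ C.Edge c c' then C.d c c' else 0

/-- `Γ(c, c')`, the sum of the weights of all paths from `c` to `c'`. The `r`-th power of the
weighted adjacency matrix sums the weights of the paths with `r` edges; in an acyclic graph
on `X` every path has fewer than `#X` edges. -/
def pathSum (C : BasedComplex R X) (M : Finset (X × X)) : Matrix X X R :=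
  ∑ r ∈ Finset.range (Fintype.card X), morseWeight C M ^ r

open Classical in
/-- The Morse complex: its basis consists of the critical cells, its differential is `Γ`. -/
def morseComplex (C : BasedComplex R X) (M : Finset (X × X)) : BasedComplex R X where
  cells := C.cells.filter fun c => ¬ Matched M c
  deg := C.deg
  d := fun c c' =>
    if (c ∈ C.cells ∧ ¬ Matched M c) ∧ (c' ∈ C.cells ∧ ¬ Matched M c') ∧ C.deg c = C.deg c' + 1
    then pathSum C M c c' else 0

end Morse

/-! ### Standard matchings on the Taylor resolution -/

section Standard

variable {n l : ℕ}

/-- The Taylor resolution: basis the sets `I` of generators, with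
`∂ I = ∑_{i ∈ I} (-1)^#{a ∈ I : a < i} (m_I / m_{I ∖ i}) (I ∖ i)`. -/
def taylor (k : Type*) [Field k] (m : Fin l → Fin n →₀ ℕ) :
    BasedComplex (MvPolynomial (Fin n) k) (Finset (Fin l)) where
  cells := Finset.univ
  deg := Finset.card
  d := fun I J => ∑ i ∈ I, if J = I.erase i then
    MvPolynomial.monomial (lcmExp m I - lcmExp m J) ((-1 : k) ^ (I.filter (· < i)).card) else 0

/-- The Morse complex obtained from the Taylor resolution after the first `s` stages of a
sequence of matchings. -/
def stageComplex (k : Type*) [Field k] (m : Fin l → Fin n →₀ ℕ)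
    (N : ℕ → Finset (Finset (Fin l) × Finset (Fin l))) :
    ℕ → BasedComplex (MvPolynomial (Fin n) k) (Finset (Fin l))
  | 0 => taylor k m
  | s + 1 => morseComplex (stageComplex k m N s) (N s)

/-- A standard matching on the Taylor resolution, as a finite sequence of stages. Stage `s` is
an acyclic matching on the Morse complex left by the earlier stages and belongs to level
`level s ≥ 1`; the union of the stages of level `i` is the matching `𝓜_i`. -/
structure StandardMatching (k : Type*) [Field k] (m : Fin l → Fin n →₀ ℕ) where
  /-- number of stages -/
  len : ℕ
  /-- the level of a stage -/
  level : ℕ → ℕ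
  /-- the edges `I → J` matched at a stage -/
  stage : ℕ → Finset (Finset (Fin l) × Finset (Fin l))
  one_le_level : ∀ s < len, 1 ≤ level s
  level_mono : ∀ s t, s ≤ t → t < len → level s ≤ level t
  graded : ∀ s < len, ∀ e ∈ stage s, lcmExp m e.1 = lcmExp m e.2
  minimal : ∀ I J, (stageComplex k m stage len).Edge I J → lcmExp m I ≠ lcmExp m J
  acyclic : ∀ s < len, IsAcyclicMatching (stageComplex k m stage s) (stage s)
  cl_eq : ∀ s < len, ∀ e ∈ stage s, (cl m e.2 : ℤ) - cl m e.1 = level s - 1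
  card_eq : ∀ s < len, ∀ e ∈ stage s, e.2.card + 1 = e.1.card
  /-- every stage consists of a set `B` of edges `I → J` with `cl(I) = 1`, `cl(J) = level`, and
  of all `I ∪ K → J ∪ K` with `I → J` in `B`, `gcd(m_I, m_K) = 1`, and `K` a basis element of
  the complex on which the stage lives -/
  base : ∀ s < len, ∃ B ⊆ stage s,
    (∀ e, e ∈ stage s ↔ e ∈ B ∨ ∃ b ∈ B, ∃ K ∈ (stageComplex k m stage s).cells,
      Coprime m b.1 K ∧ e = (b.1 ∪ K, b.2 ∪ K)) ∧
    ∀ b ∈ B, cl m b.1 = 1 ∧ cl m b.2 = level s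

variable {k : Type*} [Field k] {m : Fin l → Fin n →₀ ℕ}

/-- The unmatched (critical) sets `I ∉ 𝓜`. -/
def StandardMatching.critical (M : StandardMatching k m) : Finset (Finset (Fin l)) :=
  (stageComplex k m M.stage M.len).cells

/-- The unmatched sets as a type: the basis of the minimal resolution. -/
abbrev StandardMatching.Crit (M : StandardMatching k m) : Type :=
  {I : Finset (Fin l) // I ∈ M.critical}

/-- The unmatched sets `I` with `cl(I) = 1`. -/
abbrev StandardMatching.Gen (M : StandardMatching k m) : Type :=
  {I : Finset (Fin l) // I ∈ M.critical ∧ cl m I = 1}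

/-- An index of a variable as an unmatched set. -/
def StandardMatching.Gen.toCrit {M : StandardMatching k m} (I : M.Gen) : M.Crit := ⟨I.1, I.2.1⟩

end Standard

/-! ### The map `φ` and the algebra `R'` -/

section Main

variable {k : Type*} [Field k] {n l : ℕ}

/-- The sequence `x_1, …, x_n` in `A = S/𝔞`. -/
def vars (𝔞 : Ideal (MvPolynomial (Fin n) k)) : Fin n → MvPolynomial (Fin n) k ⧸ 𝔞 :=
  fun j => Ideal.Quotient.mk 𝔞 (MvPolynomial.X j)

/-- The basis element `e_{j_1} ∧ ⋯ ∧ e_{j_p}`, `J = {j_1 < ⋯ < j_p}`, of the Koszul complex. -/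
def koszulBasis (A : Type*) [CommRing A] (J : Finset (Fin n)) : Koszul A n :=
  ((J.sort (· ≤ ·)).map fun j => ExteriorAlgebra.ι A (Pi.single j (1 : A))).prod

/-- The part of the Koszul complex of `A = S/𝔞` of homological degree `p` and multidegree `α`:
it is spanned over `k` by the `x^β e_J` with `#J = p` and `x^β ∏_{j ∈ J} x_j = x^α`. -/
def koszulPiece (𝔞 : Ideal (MvPolynomial (Fin n) k)) (p : ℕ) (α : Fin n →₀ ℕ) :
    Submodule k (Koszul (MvPolynomial (Fin n) k ⧸ 𝔞) n) :=
  Submodule.span k {z | ∃ (J : Finset (Fin n)) (β : Fin n →₀ ℕ),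
    J.card = p ∧ β + ∑ j ∈ J, Finsupp.single j 1 = α ∧
    z = Ideal.Quotient.mk 𝔞 (MvPolynomial.monomial β 1) •
      koszulBasis (MvPolynomial (Fin n) k ⧸ 𝔞) J}

/-- The part of the Koszul homology of homological degree `p` and multidegree `α`. -/
def homologyPiece (𝔞 : Ideal (MvPolynomial (Fin n) k)) (p : ℕ) (α : Fin n →₀ ℕ) :
    Submodule k (KoszulHomology (vars 𝔞)) :=
  Submodule.span k {h | ∃ z : cycles (vars 𝔞),
    (z : Koszul (MvPolynomial (Fin n) k ⧸ 𝔞) n) ∈ koszulPiece 𝔞 p α ∧ homologyClass z = h}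

variable {m : Fin l → Fin n →₀ ℕ}

/-- The homogeneous maps `φ : T^𝓜 ⊗ k → Z(K) ⊆ K`, given on the basis of unmatched sets, which
induce an isomorphism `T^𝓜 ⊗ k ≅ H(K)` of vector spaces and satisfy
`φ(I) φ(J) = ± φ(I ∪ J)` whenever `I`, `J`, `I ∪ J` are unmatched and `gcd(m_I, m_J) = 1`. -/
structure IsRepresentation (𝔞 : Ideal (MvPolynomial (Fin n) k)) (M : StandardMatching k m)
    (φ : M.Crit → cycles (vars 𝔞)) : Prop where
  homogeneous : ∀ I, (φ I : Koszul (MvPolynomial (Fin n) k ⧸ 𝔞) n) ∈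
    koszulPiece 𝔞 I.1.card (lcmExp m I.1)
  linearIndependent : LinearIndependent k fun I => homologyClass (φ I)
  span_eq_top : Submodule.span k (Set.range fun I => homologyClass (φ I)) = ⊤
  mul_eq : ∀ I J L : M.Crit, Coprime m I.1 J.1 → L.1 = I.1 ∪ J.1 →
    φ I * φ J = shuffleSign k I.1 J.1 • φ L

/-- The relations `Y_I Y_J = (-1)^(|I||J|) Y_J Y_I`. -/
inductive GradedCommRel (M : StandardMatching k m) :
    FreeAlgebra k M.Gen → FreeAlgebra k M.Gen → Prop
  | comm (I J : M.Gen) : GradedCommRel M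
      (FreeAlgebra.ι k I * FreeAlgebra.ι k J)
      ((-1 : k) ^ (I.1.card * J.1.card) • (FreeAlgebra.ι k J * FreeAlgebra.ι k I))

/-- The graded commutative polynomial ring `k(Y_I : I ∉ 𝓜, cl(I) = 1)`. -/
abbrev GradedCommPoly (M : StandardMatching k m) : Type _ := RingQuot (GradedCommRel M)

/-- The monomial `Y_{I_1} ⋯ Y_{I_r}`. -/
def monomialY (M : StandardMatching k m) (Is : List M.Gen) : GradedCommPoly M :=
  (Is.map fun I => RingQuot.mkAlgHom k (GradedCommRel M) (FreeAlgebra.ι k I)).prod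

/-- `L` is the disjoint union of the pairwise coprime sets of the list `Ls`, all of which are
unmatched with `cl = 1`; that is, `Ls` lists the equivalence classes of `L`. -/
def IsFactorization (M : StandardMatching k m) (L : Finset (Fin l)) (Ls : List M.Gen) : Prop :=
  unionOf (Ls.map Subtype.val) = L ∧ Ls.Pairwise fun I J => Coprime m I.1 J.1

/-- The relations of the ideal `𝔯'`. In `sum`, the monomial `Y_L` of an unmatched set `L` with
equivalence classes `L_1, …, L_r` is `± Y_{L_1} ⋯ Y_{L_r}`, with the sign that gives
`φ(L) = ± φ(L_1) ⋯ φ(L_r)`. -/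
inductive HomologyRel (𝔞 : Ideal (MvPolynomial (Fin n) k)) (M : StandardMatching k m)
    (φ : M.Crit → cycles (vars 𝔞)) : GradedCommPoly M → GradedCommPoly M → Prop
  | not_coprime (I J : M.Gen) (h : ¬ Coprime m I.1 J.1) :
      HomologyRel 𝔞 M φ (monomialY M [I, J]) 0
  | sum (Is : List M.Gen) (a : M.Crit → k) (fac : M.Crit → List M.Gen)
      (hfac : ∀ L, IsFactorization M L.1 (fac L))
      (h : (Is.map fun I => φ I.toCrit).prod - ∑ L, a L • φ L ∈ boundaries (vars 𝔞)) :
      HomologyRel 𝔞 M φ (monomialY M Is)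
        (∑ L, (a L * listSign k ((fac L).map Subtype.val)) • monomialY M (fac L))
  | boundary (Is : List M.Gen)
      (h : (Is.map fun I => φ I.toCrit).prod ∈ boundaries (vars 𝔞)) :
      HomologyRel 𝔞 M φ (monomialY M Is) 0

/-- The algebra `R' = k(Y_I : I ∉ 𝓜, cl(I) = 1) / 𝔯'`. -/
abbrev RPrime (𝔞 : Ideal (MvPolynomial (Fin n) k)) (M : StandardMatching k m)
    (φ : M.Crit → cycles (vars 𝔞)) : Type _ := RingQuot (HomologyRel 𝔞 M φ)

/-- The class in `R'` of the monomial `Y_{I_1} ⋯ Y_{I_r}`. -/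
def RPrime.mon (𝔞 : Ideal (MvPolynomial (Fin n) k)) (M : StandardMatching k m)
    (φ : M.Crit → cycles (vars 𝔞)) (Is : List M.Gen) : RPrime 𝔞 M φ :=
  RingQuot.mkAlgHom k (HomologyRel 𝔞 M φ) (monomialY M Is)

/-- The part of `R'` of total degree `p` and multidegree `α`, where `Y_I` has total degree `|I|`
and multidegree `m_I`. -/
def RPrime.piece (𝔞 : Ideal (MvPolynomial (Fin n) k)) (M : StandardMatching k m)
    (φ : M.Crit → cycles (vars 𝔞)) (p : ℕ) (α : Fin n →₀ ℕ) : Submodule k (RPrime 𝔞 M φ) :=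
  Submodule.span k {y | ∃ Is : List M.Gen, (Is.map fun I => I.1.card).sum = p ∧
    (Is.map fun I => lcmExp m I.1).sum = α ∧ y = RPrime.mon 𝔞 M φ Is}

end Main

end MonomialKoszul

end

/-! Let T be the Taylor resolution and K the Koszul complex over S. Both are differential graded
algebras, and T ⊗ K maps onto the two complexes to be compared, K^A and T ⊗ k. Each kernel is an
ideal of T ⊗ K and is acyclic, because T resolves A and K resolves k. So cycles of T ⊗ K relate
cycles of K^A to elements of T ⊗ k multiplicatively.

To make this computable, T ⊗ K is embedded in `Cone`, the exterior algebra over S on l + n letters,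
all of which the differential sends to 1. The element x^β (I ⊗ e_J) becomes x^α e_P, where P
consists of the letters of I and J and α is its full multidegree. Differential and product then no
longer involve lcm's, and T ⊗ K is the span of the x^α e_P with `totExp m P ≤ α`. Both kernels are
spans of such monomials as well, and one homotopy argument, `exists_coneD_eq`, proves both acyclic
(`taylorCond_acyclic`, `koszulCond_acyclic`).

The stages of the matching are then applied to T ⊗ k. The projection of a complex onto its Morse
complex is the sum over paths to critical cells. It is a chain map
(`IsAcyclicMatching.mul_morseProj`), and its kernel is spanned by the upper cells u of the matching
and their boundaries du; this kernel is acyclic. Condition 5 on standard matchings makes the kernel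
an ideal (`IsModel.modelStep_mul`): the product of an upper cell with a coprime cell is again upper,
the product with a non-coprime cell is zero in T ⊗ k, and products with du follow from the Leibniz
rule. `IsModel` collects what survives each stage, and `IsModel.step` is the induction. After the
last stage condition 2 makes the differential zero, so that H(K^A) has a basis indexed by the
unmatched sets. In it, coprime sets multiply to their union up to the shuffle sign if that union is
unmatched, and non-coprime sets multiply to zero.

For (a), homogeneous cycles are chosen for the unmatched sets with one class; an unmatched set is a
coprime union of such sets (`StandardMatching.exists_factorization`), and φ is the signed product.
Graded commutativity makes this independent of the order. For (b), the relations hold in homology,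
the relations of the second kind reduce every monomial to the Y_L, and the classes [φ(L)] are
linearly independent, so the Y_L are a basis of R'. -/

noncomputable section

open scoped BigOperators

namespace MonomialKoszul

/-! ### Products and differentials of the basis e_J of the exterior algebra. -/

section ExteriorBasis

variable {A : Type*} [CommRing A] {n : ℕ}

/-- The number of inversions of the concatenation of `I` and `J`. -/
def inversions {l : ℕ} (I J : Finset (Fin l)) : ℕ :=
  ((I ×ˢ J).filter fun p => p.2 < p.1).card

theorem inversions_insert {l : ℕ} {i : Fin l} {I : Finset (Fin l)} (hi : i ∉ I)
    (J : Finset (Fin l)) :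
    inversions (insert i I) J = inversions I J + (J.filter (· < i)).card := by
  unfold inversions
  rw [show insert i I ×ˢ J = J.image (Prod.mk i) ∪ I ×ˢ J by
    ext ⟨a, b⟩; simp only [Finset.mem_product, Finset.mem_insert, Finset.mem_union,
      Finset.mem_image, Prod.mk.injEq]; grind,
    Finset.filter_union, Finset.card_union_of_disjoint, add_comm]
  · congr 1
    rw [Finset.filter_image, Finset.card_image_of_injective _ (Prod.mk_right_injective i)]
  · rw [Finset.disjoint_left]
    simp only [Finset.mem_filter, Finset.mem_image, Finset.mem_product]
    rintro x ⟨⟨y, -, rfl⟩, -⟩ ⟨⟨h, -⟩, -⟩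
    exact hi h

theorem inversions_empty_left {l : ℕ} (J : Finset (Fin l)) : inversions ∅ J = 0 := by
  simp [inversions]

theorem koszulBasis_empty : koszulBasis A (∅ : Finset (Fin n)) = 1 := by
  simp [koszulBasis]

theorem koszulBasis_insert_of_lt {a : Fin n} {s : Finset (Fin n)} (h : ∀ x ∈ s, a < x) :
    koszulBasis A (insert a s) =
      ExteriorAlgebra.ι A (Pi.single a (1 : A)) * koszulBasis A s := by
  unfold koszulBasis
  rw [Finset.sort_insert (· ≤ ·) (fun b hb => (h b hb).le) (fun ha => lt_irrefl _ (h a ha))]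
  simp

theorem filter_lt_insert_card {a i : Fin n} {s : Finset (Fin n)} (ha : a ∉ s) (hai : a < i) :
    ((insert a s).filter (· < i)).card = (s.filter (· < i)).card + 1 := by
  rw [Finset.filter_insert, if_pos hai, Finset.card_insert_of_notMem]
  simp [ha]

/-- Induction peels off the smallest letter: moving e_i past it costs one sign, which is that
letter's contribution to the count of letters below i. -/
theorem ι_mul_koszulBasis (i : Fin n) (J : Finset (Fin n)) :
    ExteriorAlgebra.ι A (Pi.single i (1 : A)) * koszulBasis A J =
      if i ∈ J then 0 else (-1 : A) ^ (J.filter (· < i)).card • koszulBasis A (insert i J) := by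
  induction J using Finset.induction_on_min with
  | empty =>
    have h := koszulBasis_insert_of_lt (A := A) (a := i) (s := ∅) (by simp)
    simpa using h.symm
  | insert a s has ih =>
    have ha : a ∉ s := fun h => lt_irrefl _ (has a h)
    rcases lt_trichotomy i a with h | rfl | h
    · have hlt : ∀ x ∈ insert a s, i < x := by
        intro x hx
        rcases Finset.mem_insert.1 hx with rfl | hx
        · exact h
        · exact h.trans (has x hx)
      have hi : i ∉ insert a s := fun hi => lt_irrefl _ (hlt i hi)
      rw [if_neg hi, Finset.filter_false_of_mem, ← koszulBasis_insert_of_lt hlt]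
      · simp
      · intro x hx; exact (hlt x hx).le.not_gt
    · rw [koszulBasis_insert_of_lt has, ← mul_assoc, ExteriorAlgebra.ι_sq_zero]
      simp
    · rw [koszulBasis_insert_of_lt has, ← mul_assoc,
        eq_neg_of_add_eq_zero_left (ExteriorAlgebra.ι_add_mul_swap _ _), neg_mul, mul_assoc, ih]
      by_cases his : i ∈ s
      · simp [his]
      · have hi : i ∉ insert a s := by simp [his, h.ne']
        have hlt : ∀ x ∈ insert i s, a < x := by
          intro x hx
          rcases Finset.mem_insert.1 hx with rfl | hx
          · exact h
          · exact has x hx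
        rw [if_neg his, if_neg hi, filter_lt_insert_card ha h, mul_smul_comm,
          ← koszulBasis_insert_of_lt hlt, Finset.insert_comm, pow_succ]
        simp

theorem koszulBasis_mul_of_disjoint {I J : Finset (Fin n)} (h : Disjoint I J) :
    koszulBasis A I * koszulBasis A J = (-1 : A) ^ inversions I J • koszulBasis A (I ∪ J) := by
  induction I using Finset.induction_on_min with
  | empty => simp [koszulBasis_empty, inversions_empty_left]
  | insert a s has ih =>
    have ha : a ∉ s := fun h => lt_irrefl _ (has a h)
    rw [Finset.disjoint_insert_left] at h
    rw [koszulBasis_insert_of_lt has, mul_assoc, ih h.2, mul_smul_comm, ι_mul_koszulBasis,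
      if_neg (by simp [ha, h.1]), inversions_insert ha, smul_smul, ← pow_add,
      Finset.insert_union, Finset.filter_union, Finset.filter_false_of_mem (s := s),
      Finset.empty_union]
    intro x hx
    exact (has x hx).le.not_gt

theorem koszulBasis_mul_of_not_disjoint {I J : Finset (Fin n)} (h : ¬ Disjoint I J) :
    koszulBasis A I * koszulBasis A J = 0 := by
  induction I using Finset.induction_on_min with
  | empty => simp at h
  | insert a s has ih =>
    rw [koszulBasis_insert_of_lt has, mul_assoc]
    by_cases hs : Disjoint s J
    · rw [koszulBasis_mul_of_disjoint hs, mul_smul_comm, ι_mul_koszulBasis, if_pos, smul_zero]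
      rw [Finset.disjoint_insert_left] at h
      simp only [hs, and_true, not_not] at h
      simp [h]
    · rw [ih hs, mul_zero]

theorem involute_ι (v : Fin n → A) :
    CliffordAlgebra.involute (ExteriorAlgebra.ι A v) = -ExteriorAlgebra.ι A v :=
  CliffordAlgebra.involute_ι (Q := (0 : QuadraticForm A (Fin n → A))) v

theorem koszulD_koszulBasis (x : Fin n → A) (J : Finset (Fin n)) :
    koszulD x (koszulBasis A J) =
      ∑ j ∈ J, ((-1 : A) ^ (J.filter (· < j)).card * x j) • koszulBasis A (J.erase j) := by
  induction J using Finset.induction_on_min with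
  | empty => simp [koszulBasis_empty, koszulD]
  | insert a s has ih =>
    have ha : a ∉ s := fun h => lt_irrefl _ (has a h)
    have h1 : koszulD x (ExteriorAlgebra.ι A (Pi.single a (1 : A))) =
        algebraMap A (Koszul A n) (x a) := by
      rw [koszulD]
      erw [CliffordAlgebra.contractLeft_ι]
      simp [Fintype.linearCombination_apply_single]
    have h2 := involute_ι (Pi.single a (1 : A))
    rw [Finset.sum_insert ha, koszulBasis_insert_of_lt has, koszulD_mul, h1, h2, ih,
      Finset.mul_sum, ← Algebra.smul_def, Finset.erase_insert ha]
    congr 1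
    · rw [Finset.filter_false_of_mem]
      · simp
      · intro y hy
        rcases Finset.mem_insert.1 hy with rfl | hy
        · exact lt_irrefl _
        · exact (has y hy).le.not_gt
    · refine Finset.sum_congr rfl fun j hj => ?_
      have hja : a ≠ j := fun h => ha (h ▸ hj)
      rw [filter_lt_insert_card ha (has j hj), Finset.erase_insert_of_ne hja,
        koszulBasis_insert_of_lt (fun y hy => has y (Finset.mem_of_mem_erase hy)), mul_smul_comm,
        pow_succ]
      simp

/-- The elements `e_J` form a basis of the exterior algebra. -/
def koszulBasisOf (A : Type*) [CommRing A] (n : ℕ) :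
    Module.Basis (Finset (Fin n)) A (Koszul A n) :=
  (Pi.basisFun A (Fin n)).ExteriorAlgebra

theorem koszulBasisOf_apply (J : Finset (Fin n)) : koszulBasisOf A n J = koszulBasis A J := by
  rw [koszulBasisOf, ExteriorAlgebra.basis_apply]
  change ExteriorAlgebra.ιMulti A _ _ = _
  rw [ExteriorAlgebra.ιMulti_apply, koszulBasis]
  congr 1
  apply List.ext_getElem
  · simp
  · intro i h1 h2
    simp [Set.powersetCard.ofFinEmbEquiv_symm_apply, Finset.orderEmbOfFin_apply]

theorem involute_koszulBasis (J : Finset (Fin n)) :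
    CliffordAlgebra.involute (koszulBasis A J) = (-1 : A) ^ J.card • koszulBasis A J := by
  induction J using Finset.induction_on_min with
  | empty => simp [koszulBasis_empty]
  | insert a s has ih =>
    have ha : a ∉ s := fun h => lt_irrefl _ (has a h)
    have h2 := involute_ι (Pi.single a (1 : A))
    rw [koszulBasis_insert_of_lt has, map_mul, ih, Finset.card_insert_of_notMem ha, h2, pow_succ]
    simp

theorem koszulD_koszulD (x : Fin n → A) (a : Koszul A n) : koszulD x (koszulD x a) = 0 :=
  CliffordAlgebra.contractLeft_contractLeft (Fintype.linearCombination A x) a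

/-- The element `a e_J` of the Koszul complex. -/
def koszulTerm (a : A) (J : Finset (Fin n)) : Koszul A n := a • koszulBasis A J

theorem koszulTerm_zero (J : Finset (Fin n)) : koszulTerm (0 : A) J = 0 := zero_smul _ _

theorem koszulTerm_one_empty : koszulTerm (1 : A) (∅ : Finset (Fin n)) = 1 := by
  rw [koszulTerm, one_smul, koszulBasis_empty]

theorem koszulTerm_add (a b : A) (J : Finset (Fin n)) :
    koszulTerm (a + b) J = koszulTerm a J + koszulTerm b J := add_smul _ _ _

theorem koszulTerm_mul_of_disjoint (a b : A) {I J : Finset (Fin n)} (h : Disjoint I J) :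
    koszulTerm a I * koszulTerm b J =
      koszulTerm ((-1) ^ inversions I J * (a * b)) (I ∪ J) := by
  unfold koszulTerm
  rw [smul_mul_smul_comm, koszulBasis_mul_of_disjoint h, smul_smul, mul_comm]

theorem koszulTerm_mul_of_not_disjoint (a b : A) {I J : Finset (Fin n)} (h : ¬ Disjoint I J) :
    koszulTerm a I * koszulTerm b J = 0 := by
  unfold koszulTerm
  rw [smul_mul_smul_comm, koszulBasis_mul_of_not_disjoint h, smul_zero]

theorem koszulD_koszulTerm (x : Fin n → A) (a : A) (J : Finset (Fin n)) :
    koszulD x (koszulTerm a J) =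
      ∑ j ∈ J, koszulTerm ((-1) ^ (J.filter (· < j)).card * (a * x j)) (J.erase j) := by
  unfold koszulTerm
  rw [map_smul, koszulD_koszulBasis, Finset.smul_sum]
  refine Finset.sum_congr rfl fun j _ => ?_
  rw [smul_smul, mul_left_comm]

theorem smul_koszulTerm {k : Type*} [CommSemiring k] [Algebra k A] (c : k) (a : A)
    (J : Finset (Fin n)) : c • koszulTerm a J = koszulTerm (algebraMap k A c * a) J := by
  unfold koszulTerm
  rw [mul_smul, algebraMap_smul]

theorem repr_koszulTerm (a : A) (J J' : Finset (Fin n)) :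
    (koszulBasisOf A n).repr (koszulTerm a J) J' = if J = J' then a else 0 := by
  rw [koszulTerm, map_smul, ← koszulBasisOf_apply, Module.Basis.repr_self, Finsupp.smul_apply,
    Finsupp.single_apply]
  split_ifs <;> simp

theorem sum_koszulTerm_repr (z : Koszul A n) :
    ∑ J, koszulTerm ((koszulBasisOf A n).repr z J) J = z := by
  conv_rhs => rw [← (koszulBasisOf A n).sum_repr z]
  simp only [koszulBasisOf_apply, koszulTerm]

end ExteriorBasis

end MonomialKoszul

end
noncomputable section

open scoped BigOperators

namespace MonomialKoszul

/-! ### The exterior algebra with all letters sent to 1, and an acyclicity criterion for spans of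
monomials. -/

section Cone

variable {k : Type*} [Field k] {n N : ℕ}

/-- The exterior algebra on `N` letters over the polynomial ring in `n` variables. -/
abbrev Cone (k : Type*) [Field k] (n N : ℕ) : Type _ := Koszul (MvPolynomial (Fin n) k) N

/-- The differential on `Cone k n N` that sends every letter to `1`. -/
def coneD : Cone k n N →ₗ[k] Cone k n N :=
  (koszulD fun _ => (1 : MvPolynomial (Fin n) k)).restrictScalars k

/-- The `k`-basis of `Cone k n N` consisting of the elements `x^α e_P`. -/
def monBasis (k : Type*) [Field k] (n N : ℕ) :
    Module.Basis ((Fin n →₀ ℕ) × Finset (Fin N)) k (Cone k n N) :=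
  (MvPolynomial.basisMonomials (Fin n) k).smulTower (koszulBasisOf _ N)

/-- The basis element `x^α e_P`. -/
def mon (k : Type*) [Field k] {n N : ℕ} (α : Fin n →₀ ℕ) (P : Finset (Fin N)) : Cone k n N :=
  MvPolynomial.monomial α (1 : k) • koszulBasis _ P

theorem monBasis_apply (α : Fin n →₀ ℕ) (P : Finset (Fin N)) :
    monBasis k n N (α, P) = mon k α P := by
  rw [monBasis, Module.Basis.smulTower_apply, koszulBasisOf_apply]
  simp [mon]

theorem neg_one_pow_smul_cone (r : ℕ) (x : Cone k n N) :
    ((-1 : MvPolynomial (Fin n) k) ^ r) • x = ((-1 : k) ^ r) • x := by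
  rcases neg_one_pow_eq_or (MvPolynomial (Fin n) k) r with h | h <;>
    rcases Nat.even_or_odd r with h' | h' <;> simp [h'.neg_one_pow]

theorem mon_mul (α β : Fin n →₀ ℕ) (P Q : Finset (Fin N)) :
    mon k α P * mon k β Q =
      if Disjoint P Q then (-1 : k) ^ inversions P Q • mon k (α + β) (P ∪ Q) else 0 := by
  unfold mon
  rw [smul_mul_smul_comm, MvPolynomial.monomial_mul, one_mul]
  split_ifs with h
  · rw [koszulBasis_mul_of_disjoint h, smul_comm, neg_one_pow_smul_cone]
  · rw [koszulBasis_mul_of_not_disjoint h, smul_zero]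

theorem mon_zero_empty : mon k (0 : Fin n →₀ ℕ) (∅ : Finset (Fin N)) = 1 := by
  simp [mon, koszulBasis_empty]

theorem coneD_mon (α : Fin n →₀ ℕ) (P : Finset (Fin N)) :
    coneD (mon k α P) = ∑ j ∈ P, (-1 : k) ^ (P.filter (· < j)).card • mon k α (P.erase j) := by
  change koszulD _ _ = _
  unfold mon
  rw [map_smul, koszulD_koszulBasis, Finset.smul_sum]
  refine Finset.sum_congr rfl fun j _ => ?_
  rw [mul_one, smul_comm, neg_one_pow_smul_cone]

theorem involute_mon (α : Fin n →₀ ℕ) (P : Finset (Fin N)) :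
    CliffordAlgebra.involute (mon k α P) = (-1 : k) ^ P.card • mon k α P := by
  unfold mon
  rw [map_smul, involute_koszulBasis, smul_comm, neg_one_pow_smul_cone]

theorem coneD_mul (a b : Cone k n N) :
    coneD (a * b) = coneD a * b + CliffordAlgebra.involute a * coneD b :=
  koszulD_mul _ a b

theorem coneD_coneD (a : Cone k n N) : coneD (coneD a) = 0 := koszulD_koszulD _ a

/-- The span of the basis elements `x^α e_P` with a property. -/
def monSpan (k : Type*) [Field k] {n N : ℕ} (S : (Fin n →₀ ℕ) → Finset (Fin N) → Prop) :
    Submodule k (Cone k n N) :=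
  Submodule.span k {x | ∃ α P, S α P ∧ x = mon k α P}

variable {S T U : (Fin n →₀ ℕ) → Finset (Fin N) → Prop}

theorem mon_mem_monSpan {α : Fin n →₀ ℕ} {P : Finset (Fin N)} (h : S α P) :
    mon k α P ∈ monSpan k S :=
  Submodule.subset_span ⟨α, P, h, rfl⟩

theorem monSpan_mono (h : ∀ α P, S α P → T α P) : monSpan k S ≤ monSpan k T :=
  Submodule.span_mono fun _ ⟨α, P, hS, hx⟩ => ⟨α, P, h α P hS, hx⟩

theorem map_mem_of_mem_monSpan {V : Type*} [AddCommGroup V] [Module k V]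
    {f : Cone k n N →ₗ[k] V} {Y : Submodule k V} (h : ∀ α P, S α P → f (mon k α P) ∈ Y)
    {x : Cone k n N} (hx : x ∈ monSpan k S) : f x ∈ Y := by
  have : monSpan k S ≤ Y.comap f := Submodule.span_le.2 fun _ ⟨α, P, hS, hy⟩ => hy ▸ h α P hS
  exact this hx

theorem map_eq_of_mem_monSpan {V : Type*} [AddCommGroup V] [Module k V]
    {f g : Cone k n N →ₗ[k] V} (h : ∀ α P, S α P → f (mon k α P) = g (mon k α P))
    {x : Cone k n N} (hx : x ∈ monSpan k S) : f x = g x := by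
  have := map_mem_of_mem_monSpan (f := f - g) (Y := ⊥) (S := S)
    (fun α P hS => by simp [h α P hS]) hx
  simpa [sub_eq_zero] using this

theorem monSpan_true : monSpan k (fun (_ : Fin n →₀ ℕ) (_ : Finset (Fin N)) => True) = ⊤ := by
  rw [eq_top_iff, ← (monBasis k n N).span_eq]
  refine Submodule.span_mono ?_
  rintro _ ⟨⟨α, P⟩, rfl⟩
  exact ⟨α, P, trivial, monBasis_apply α P⟩

theorem cone_ext {V : Type*} [AddCommGroup V] [Module k V] {f g : Cone k n N →ₗ[k] V}
    (h : ∀ α P, f (mon k α P) = g (mon k α P)) : f = g :=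
  LinearMap.ext fun _ => map_eq_of_mem_monSpan (S := fun _ _ => True) (fun α P _ => h α P)
    (monSpan_true (k := k) (n := n) (N := N) ▸ Submodule.mem_top)

theorem mul_mem_monSpan
    (h : ∀ α P β Q, S α P → T β Q → Disjoint P Q → U (α + β) (P ∪ Q))
    {x y : Cone k n N} (hx : x ∈ monSpan k S) (hy : y ∈ monSpan k T) : x * y ∈ monSpan k U := by
  refine map_mem_of_mem_monSpan (f := LinearMap.mulRight k y) (S := S) ?_ hx
  intro α P hS
  refine map_mem_of_mem_monSpan (f := LinearMap.mulLeft k (mon k α P)) (S := T) ?_ hy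
  intro β Q hT
  rw [LinearMap.mulLeft_apply, mon_mul]
  split_ifs with hd
  · exact Submodule.smul_mem _ _ (mon_mem_monSpan (h α P β Q hS hT hd))
  · exact Submodule.zero_mem _

theorem coneD_mem_monSpan (h : ∀ α P, ∀ j ∈ P, S α P → T α (P.erase j)) {x : Cone k n N}
    (hx : x ∈ monSpan k S) : coneD x ∈ monSpan k T := by
  refine map_mem_of_mem_monSpan (f := coneD) (S := S) ?_ hx
  intro α P hS
  rw [coneD_mon]
  exact Submodule.sum_mem _ fun j hj =>
    Submodule.smul_mem _ _ (mon_mem_monSpan (h α P j hj hS))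

theorem involute_mem_monSpan {x : Cone k n N} (hx : x ∈ monSpan k S) :
    CliffordAlgebra.involute x ∈ monSpan k S := by
  refine map_mem_of_mem_monSpan
    (f := (CliffordAlgebra.involute : Cone k n N →ₐ[_] _).toLinearMap.restrictScalars k)
    (S := S) ?_ hx
  intro α P hS
  change CliffordAlgebra.involute (mon k α P) ∈ _
  rw [involute_mon]
  exact Submodule.smul_mem _ _ (mon_mem_monSpan hS)

/-- If a function `v` of `α` and `P ∩ G` chooses letters outside `G` that may be joined to the
index sets of a family of monomials, the span of the family is acyclic. -/
theorem exists_coneD_eq (G : Finset (Fin N)) (v : (Fin n →₀ ℕ) → Finset (Fin N) → Fin N)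
    (hdel : ∀ α P j, S α P → S α (P.erase j))
    (hv : ∀ α P, S α P → v α (P ∩ G) ∉ G ∧ S α (insert (v α (P ∩ G)) P))
    {z : Cone k n N} (hz : z ∈ monSpan k S) (hDz : coneD z = 0) :
    ∃ y ∈ monSpan k S, coneD y = z := by
  let letter : Fin N → Cone k n N := fun i => mon k 0 {i}
  -- Left multiplication by a fixed letter would be a contracting homotopy, as every letter has
  -- boundary 1. Here the letter depends on α and on P ∩ G.
  let h : Cone k n N →ₗ[k] Cone k n N :=
    (monBasis k n N).constr k fun p => letter (v p.1 (p.2 ∩ G)) * mon k p.1 p.2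
  have h_mon : ∀ α P, h (mon k α P) = letter (v α (P ∩ G)) * mon k α P := fun α P => by
    simp only [h, ← monBasis_apply, Module.Basis.constr_basis]
  have letter_mul : ∀ (R : (Fin n →₀ ℕ) → Finset (Fin N) → Prop) i α P, R α (insert i P) →
      letter i * mon k α P ∈ monSpan k R := fun R i α P hR => by
    rw [mon_mul, zero_add]
    split_ifs with hd
    · exact Submodule.smul_mem _ _ (mon_mem_monSpan (by simpa using hR))
    · exact Submodule.zero_mem _
  have h_mem : ∀ x ∈ monSpan k S, h x ∈ monSpan k S := fun x hx =>
    map_mem_of_mem_monSpan (fun α P hS => h_mon α P ▸ letter_mul S _ _ _ (hv α P hS).2) hx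
  have hD_letter : ∀ i, coneD (letter i) = 1 := fun i => by
    rw [coneD_mon]
    simp [Finset.filter_singleton, mon_zero_empty]
  have h_inv : ∀ i, CliffordAlgebra.involute (letter i) = -letter i := fun i => by
    rw [involute_mon]; simp [letter]
  let S' : ℕ → (Fin n →₀ ℕ) → Finset (Fin N) → Prop := fun q α P => S α P ∧ (P ∩ G).card < q
  -- The defect of the homotopy identity is a sum over j in P of differences of two choices of
  -- letter. It lowers the size of P ∩ G, so iterating the correction terminates.
  have key : ∀ q, ∀ x ∈ monSpan k (S' (q + 1)),
      x - coneD (h x) - h (coneD x) ∈ monSpan k (S' q) := by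
    intro q x hx
    refine map_mem_of_mem_monSpan
      (f := LinearMap.id - coneD ∘ₗ h - h ∘ₗ coneD) (S := S' (q + 1)) ?_ hx
    rintro α P ⟨hS, hq⟩
    have e : (LinearMap.id - coneD ∘ₗ h - h ∘ₗ coneD : Cone k n N →ₗ[k] Cone k n N) (mon k α P) =
        ∑ j ∈ P, (-1 : k) ^ (P.filter (· < j)).card •
          (letter (v α (P ∩ G)) * mon k α (P.erase j) -
            letter (v α (P.erase j ∩ G)) * mon k α (P.erase j)) := by
      simp only [LinearMap.sub_apply, LinearMap.comp_apply, LinearMap.id_apply]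
      rw [h_mon, coneD_mul, hD_letter, h_inv, coneD_mon, map_sum]
      simp only [map_smul, h_mon, smul_sub, Finset.sum_sub_distrib, Finset.mul_sum,
        mul_smul_comm, one_mul, neg_mul]
      simp
    rw [e]
    refine Submodule.sum_mem _ fun j hj => Submodule.smul_mem _ _ ?_
    by_cases hjG : j ∈ G
    · have hlt : (P.erase j ∩ G).card < q := by
        rw [Finset.erase_inter]
        have := Finset.card_erase_lt_of_mem (Finset.mem_inter.2 ⟨hj, hjG⟩)
        omega
      have hcard : ∀ i, i ∉ G → (insert i (P.erase j) ∩ G).card < q := fun i hi => by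
        rwa [Finset.insert_inter_of_notMem hi]
      refine Submodule.sub_mem _ (letter_mul _ _ _ _ ⟨?_, ?_⟩) (letter_mul _ _ _ _ ⟨?_, ?_⟩)
      · have hne : v α (P ∩ G) ≠ j := fun e => (hv α P hS).1 (e ▸ hjG)
        rw [← Finset.erase_insert_of_ne hne]
        exact hdel _ _ _ (hv α P hS).2
      · exact hcard _ (hv α P hS).1
      · exact (hv α _ (hdel α P j hS)).2
      · exact hcard _ (hv α _ (hdel α P j hS)).1
    -- Deleting a letter outside G does not change the choice, so the two terms cancel.
    · have : P.erase j ∩ G = P ∩ G := by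
        ext i; simp only [Finset.mem_inter, Finset.mem_erase]; grind
      simp [this]
  have main : ∀ q, ∀ x ∈ monSpan k (S' q), coneD x = 0 → ∃ y ∈ monSpan k S, coneD y = x := by
    intro q
    induction q with
    | zero =>
      intro x hx _
      have : x ∈ (⊥ : Submodule k (Cone k n N)) :=
        map_mem_of_mem_monSpan (f := LinearMap.id) (fun α P hS => absurd hS.2 (by simp)) hx
      exact ⟨0, Submodule.zero_mem _, by simpa using this.symm⟩
    | succ q ih =>
      intro x hx hDx
      have hk := key q x hx
      rw [hDx, map_zero, sub_zero] at hk
      obtain ⟨y, hy, hyx⟩ := ih _ hk (by rw [map_sub, hDx, coneD_coneD, sub_zero])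
      refine ⟨y + h x, Submodule.add_mem _ hy (h_mem x (monSpan_mono (fun _ _ h => h.1) hx)), ?_⟩
      rw [map_add, hyx, sub_add_cancel]
  -- There are only N letters, so the bound N + 1 on the size of P ∩ G is no restriction.
  refine main (N + 1) z (monSpan_mono (fun α P hS => ⟨hS, ?_⟩) hz) hDz
  calc (P ∩ G).card ≤ (Finset.univ : Finset (Fin N)).card := Finset.card_le_card (by simp)
    _ < N + 1 := by simp

/-- If letters outside `G`, depending only on `α` and `P ∩ G`, may be joined to the index sets of
a family of monomials, the span of the family is acyclic. -/
theorem exists_coneD_eq_of_exists (G : Finset (Fin N))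
    (hdel : ∀ α P j, S α P → S α (P.erase j))
    (hv : ∀ α P, S α P → ∃ i ∉ G, ∀ P', S α P' → P' ∩ G = P ∩ G → S α (insert i P'))
    {z : Cone k n N} (hz : z ∈ monSpan k S) (hDz : coneD z = 0) :
    ∃ y ∈ monSpan k S, coneD y = z := by
  classical
  by_cases hS : ∃ α P, S α P
  · obtain ⟨α₀, P₀, h₀⟩ := hS
    obtain ⟨i₀, -⟩ := hv α₀ P₀ h₀
    let A : (Fin n →₀ ℕ) → Finset (Fin N) → Fin N → Prop := fun α Q i =>
      i ∉ G ∧ ∀ P', S α P' → P' ∩ G = Q → S α (insert i P')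
    refine exists_coneD_eq G (fun α Q => if h : ∃ i, A α Q i then h.choose else i₀) hdel ?_ hz hDz
    intro α P h
    have hA : ∃ i, A α (P ∩ G) i := hv α P h
    rw [dif_pos hA]
    exact ⟨hA.choose_spec.1, hA.choose_spec.2 P h rfl⟩
  · refine ⟨0, Submodule.zero_mem _, ?_⟩
    have : z ∈ (⊥ : Submodule k (Cone k n N)) :=
      map_mem_of_mem_monSpan (f := LinearMap.id) (fun α P h => absurd ⟨α, P, h⟩ hS) hz
    simpa using this.symm

/-- The projection onto the part of degree `p` and multidegree `a`. -/
def coneProj (p : ℕ) (a : Fin n →₀ ℕ) : Cone k n N →ₗ[k] Cone k n N :=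
  (monBasis k n N).constr k fun q => if q.2.card = p ∧ q.1 = a then mon k q.1 q.2 else 0

theorem coneProj_mon (p : ℕ) (a α : Fin n →₀ ℕ) (P : Finset (Fin N)) :
    coneProj p a (mon k α P) = if P.card = p ∧ α = a then mon k α P else 0 := by
  simp only [← monBasis_apply, coneProj, Module.Basis.constr_basis]

theorem coneProj_coneD (p : ℕ) (a : Fin n →₀ ℕ) (x : Cone k n N) :
    coneProj p a (coneD x) = coneD (coneProj (p + 1) a x) := by
  revert x
  rw [← funext_iff]
  change ⇑(coneProj p a ∘ₗ coneD) = ⇑(coneD ∘ₗ coneProj (p + 1) a)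
  congr 1
  refine cone_ext fun α P => ?_
  rw [LinearMap.comp_apply, LinearMap.comp_apply, coneProj_mon, apply_ite coneD, map_zero,
    coneD_mon, map_sum]
  split_ifs with h
  · refine Finset.sum_congr rfl fun j hj => ?_
    rw [map_smul, coneProj_mon, if_pos]
    rw [Finset.card_erase_of_mem hj]
    exact ⟨by omega, h.2⟩
  · refine Finset.sum_eq_zero fun j hj => ?_
    rw [map_smul, coneProj_mon, if_neg, smul_zero]
    rw [Finset.card_erase_of_mem hj]
    have := Finset.card_pos.2 ⟨j, hj⟩
    rintro ⟨h1, h2⟩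
    exact h ⟨by omega, h2⟩

theorem coneProj_mem_monSpan (p : ℕ) (a : Fin n →₀ ℕ) {x : Cone k n N}
    (hx : x ∈ monSpan k S) :
    coneProj p a x ∈ monSpan k fun α P => S α P ∧ P.card = p ∧ α = a := by
  refine map_mem_of_mem_monSpan (S := S) ?_ hx
  intro α P hS
  rw [coneProj_mon]
  split_ifs with h
  · exact mon_mem_monSpan ⟨hS, h⟩
  · exact Submodule.zero_mem _

theorem coneProj_of_mem_monSpan {p : ℕ} {a : Fin n →₀ ℕ} {x : Cone k n N}
    (hx : x ∈ monSpan k fun α P => S α P ∧ P.card = p ∧ α = a) : coneProj p a x = x :=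
  map_eq_of_mem_monSpan (f := coneProj p a) (g := LinearMap.id)
    (fun α P h => by rw [coneProj_mon, if_pos h.2]; rfl) hx

end Cone

end MonomialKoszul

end
noncomputable section

open scoped BigOperators

namespace MonomialKoszul

/-! ### The tensor product of the Taylor resolution and the Koszul complex, and its two acyclic
ideals. -/

section Bicomplex

variable {k : Type*} [Field k] {n l : ℕ}

/-- The letters of a subset of `Fin l ⊔ Fin n` in `Fin l`. -/
def leftPart (P : Finset (Fin (l + n))) : Finset (Fin l) :=
  Finset.univ.filter fun i => Fin.castAdd n i ∈ P

/-- The letters of a subset of `Fin l ⊔ Fin n` in `Fin n`. -/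
def rightPart (P : Finset (Fin (l + n))) : Finset (Fin n) :=
  Finset.univ.filter fun j => Fin.natAdd l j ∈ P

/-- A subset of `Fin l` as a subset of `Fin l ⊔ Fin n`. -/
def leftMap (n : ℕ) (I : Finset (Fin l)) : Finset (Fin (l + n)) := I.map (Fin.castAddEmb n)

/-- A subset of `Fin n` as a subset of `Fin l ⊔ Fin n`. -/
def rightMap (l : ℕ) (J : Finset (Fin n)) : Finset (Fin (l + n)) := J.map (Fin.natAddEmb l)

@[simp] theorem mem_leftPart {P : Finset (Fin (l + n))} {i : Fin l} :
    i ∈ leftPart P ↔ Fin.castAdd n i ∈ P := by simp [leftPart]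

@[simp] theorem mem_rightPart {P : Finset (Fin (l + n))} {j : Fin n} :
    j ∈ rightPart P ↔ Fin.natAdd l j ∈ P := by simp [rightPart]

theorem castAdd_ne_natAdd (i : Fin l) (j : Fin n) : Fin.castAdd n i ≠ Fin.natAdd l j := by
  intro h
  have := congrArg Fin.val h
  simp only [Fin.val_castAdd, Fin.val_natAdd] at this
  omega

@[simp] theorem castAdd_mem_leftMap {I : Finset (Fin l)} {i : Fin l} :
    Fin.castAdd n i ∈ leftMap n I ↔ i ∈ I := by
  simp [leftMap]

@[simp] theorem natAdd_mem_rightMap {J : Finset (Fin n)} {j : Fin n} :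
    Fin.natAdd l j ∈ rightMap l J ↔ j ∈ J := by
  simp [rightMap]

@[simp] theorem natAdd_notMem_leftMap {I : Finset (Fin l)} {j : Fin n} :
    Fin.natAdd l j ∉ leftMap n I := by
  simp [leftMap, castAdd_ne_natAdd]

@[simp] theorem castAdd_notMem_rightMap {J : Finset (Fin n)} {i : Fin l} :
    Fin.castAdd n i ∉ rightMap l J := by
  simp [rightMap, (castAdd_ne_natAdd _ _).symm]

theorem ext_parts {P Q : Finset (Fin (l + n))} (h₁ : leftPart P = leftPart Q)
    (h₂ : rightPart P = rightPart Q) : P = Q := by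
  ext x
  refine Fin.addCases (fun i => ?_) (fun j => ?_) x
  · simpa using Finset.ext_iff.1 h₁ i
  · simpa using Finset.ext_iff.1 h₂ j

@[simp] theorem leftPart_leftMap (I : Finset (Fin l)) : leftPart (leftMap n I) = I := by
  ext; simp

@[simp] theorem rightPart_leftMap (I : Finset (Fin l)) : rightPart (leftMap n I) = ∅ := by
  ext; simp

@[simp] theorem leftPart_rightMap (J : Finset (Fin n)) : leftPart (rightMap l J) = ∅ := by
  ext; simp

@[simp] theorem rightPart_rightMap (J : Finset (Fin n)) : rightPart (rightMap l J) = J := by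
  ext; simp

theorem eq_leftMap {P : Finset (Fin (l + n))} (h : rightPart P = ∅) :
    P = leftMap n (leftPart P) := ext_parts (by simp) (by simp [h])

theorem eq_rightMap {P : Finset (Fin (l + n))} (h : leftPart P = ∅) :
    P = rightMap l (rightPart P) := ext_parts (by simp [h]) (by simp)

theorem leftPart_union (P Q : Finset (Fin (l + n))) :
    leftPart (P ∪ Q) = leftPart P ∪ leftPart Q := by ext; simp

theorem rightPart_union (P Q : Finset (Fin (l + n))) :
    rightPart (P ∪ Q) = rightPart P ∪ rightPart Q := by ext; simp

theorem leftPart_mono {P Q : Finset (Fin (l + n))} (h : P ⊆ Q) : leftPart P ⊆ leftPart Q :=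
  fun i hi => by simp only [mem_leftPart] at *; exact h hi

theorem rightPart_mono {P Q : Finset (Fin (l + n))} (h : P ⊆ Q) : rightPart P ⊆ rightPart Q :=
  fun i hi => by simp only [mem_rightPart] at *; exact h hi

theorem disjoint_rightPart {P Q : Finset (Fin (l + n))} (h : Disjoint P Q) :
    Disjoint (rightPart P) (rightPart Q) := by
  rw [Finset.disjoint_left] at *
  simp only [mem_rightPart]
  exact fun j hj => h hj

theorem inversions_map {a b : ℕ} (f : Fin a ↪ Fin b) (hf : StrictMono f) (I J : Finset (Fin a)) :
    inversions (I.map f) (J.map f) = inversions I J := by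
  unfold inversions
  rw [show I.map f ×ˢ J.map f = (I ×ˢ J).map (f.prodMap f) by ext ⟨a, b⟩; simp; grind,
    Finset.filter_map, Finset.card_map]
  refine congrArg Finset.card (Finset.filter_congr fun p _ => ?_)
  exact hf.lt_iff_lt

theorem filter_lt_map_card {a b : ℕ} (f : Fin a ↪ Fin b) (hf : StrictMono f) (I : Finset (Fin a))
    (i : Fin a) : ((I.map f).filter (· < f i)).card = (I.filter (· < i)).card := by
  rw [Finset.filter_map, Finset.card_map]
  congr 1
  ext p
  simp [hf.lt_iff_lt]

theorem strictMono_castAddEmb : StrictMono (Fin.castAddEmb n : Fin l ↪ Fin (l + n)) :=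
  Fin.strictMono_castAdd n

theorem strictMono_natAddEmb : StrictMono (Fin.natAddEmb l : Fin n ↪ Fin (l + n)) :=
  Fin.strictMono_natAdd l

theorem coneD_mon_leftMap (α : Fin n →₀ ℕ) (I : Finset (Fin l)) :
    coneD (mon k α (leftMap n I)) =
      ∑ i ∈ I, (-1 : k) ^ (I.filter (· < i)).card • mon k α (leftMap n (I.erase i)) := by
  rw [coneD_mon, leftMap, Finset.sum_map]
  refine Finset.sum_congr rfl fun i _ => ?_
  rw [filter_lt_map_card _ strictMono_castAddEmb, leftMap, Finset.map_erase]

theorem coneD_mon_rightMap (α : Fin n →₀ ℕ) (J : Finset (Fin n)) :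
    coneD (mon k α (rightMap l J)) =
      ∑ j ∈ J, (-1 : k) ^ (J.filter (· < j)).card • mon k α (rightMap l (J.erase j)) := by
  rw [coneD_mon, rightMap, Finset.sum_map]
  refine Finset.sum_congr rfl fun i _ => ?_
  rw [filter_lt_map_card _ strictMono_natAddEmb, rightMap, Finset.map_erase]

/-- The exponent vector of `∏_{j ∈ J} x_j`. -/
def xExp (J : Finset (Fin n)) : Fin n →₀ ℕ := ∑ j ∈ J, Finsupp.single j 1

theorem xExp_apply (J : Finset (Fin n)) (t : Fin n) : xExp J t = if t ∈ J then 1 else 0 := by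
  simp [xExp, Finsupp.finsetSum_apply, Finsupp.single_apply]

theorem xExp_mono {J J' : Finset (Fin n)} (h : J ⊆ J') : xExp J ≤ xExp J' := by
  intro t
  rw [xExp_apply, xExp_apply]
  split_ifs with h₁ h₂
  · exact le_rfl
  · exact absurd (h h₁) h₂
  · exact Nat.zero_le _
  · exact le_rfl

theorem xExp_union {J J' : Finset (Fin n)} (h : Disjoint J J') :
    xExp (J ∪ J') = xExp J + xExp J' := Finset.sum_union h

theorem xExp_erase {J : Finset (Fin n)} {j : Fin n} (h : j ∈ J) :
    xExp (J.erase j) + Finsupp.single j 1 = xExp J := Finset.sum_erase_add _ _ h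

variable (m : Fin l → Fin n →₀ ℕ)

theorem lcmExp_mono {I J : Finset (Fin l)} (h : I ⊆ J) : lcmExp m I ≤ lcmExp m J :=
  Finset.sup_mono h

theorem le_lcmExp {I : Finset (Fin l)} {i : Fin l} (h : i ∈ I) : m i ≤ lcmExp m I :=
  Finset.le_sup (f := m) h

theorem lcmExp_union (I J : Finset (Fin l)) : lcmExp m (I ∪ J) = lcmExp m I ⊔ lcmExp m J :=
  Finset.sup_union

theorem sup_le_add (a b : Fin n →₀ ℕ) : a ⊔ b ≤ a + b :=
  sup_le le_self_add le_add_self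

theorem lcmExp_union_le (I J : Finset (Fin l)) : lcmExp m (I ∪ J) ≤ lcmExp m I + lcmExp m J :=
  lcmExp_union m I J ▸ sup_le_add _ _

variable {m} in
-- In each coordinate max(a, b) = a + b exactly when min(a, b) = 0.
theorem lcmExp_union_eq_add_iff {I J : Finset (Fin l)} :
    lcmExp m (I ∪ J) = lcmExp m I + lcmExp m J ↔ Coprime m I J := by
  rw [lcmExp_union, Coprime, GcdOne, Finsupp.ext_iff, Finsupp.ext_iff]
  refine forall_congr' fun t => ?_
  simp only [Finsupp.sup_apply, Finsupp.inf_apply, Finsupp.add_apply, Finsupp.zero_apply]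
  omega

/-- The multidegree of the product of the basis elements indexed by the letters of `P`
in the tensor product of the Taylor resolution and the Koszul complex. -/
def totExp (P : Finset (Fin (l + n))) : Fin n →₀ ℕ :=
  lcmExp m (leftPart P) + xExp (rightPart P)

theorem totExp_mono {P Q : Finset (Fin (l + n))} (h : P ⊆ Q) : totExp m P ≤ totExp m Q :=
  add_le_add (lcmExp_mono m (leftPart_mono h)) (xExp_mono (rightPart_mono h))

theorem totExp_union_le {P Q : Finset (Fin (l + n))} (h : Disjoint P Q) :
    totExp m (P ∪ Q) ≤ totExp m P + totExp m Q := by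
  unfold totExp
  rw [leftPart_union, rightPart_union, xExp_union (disjoint_rightPart h), add_add_add_comm]
  exact add_le_add (lcmExp_union_le m _ _) le_rfl

/-- The tensor product of the Taylor resolution and the Koszul complex over the polynomial ring
is spanned by the `x^α e_P` with this property. -/
def TotCond (α : Fin n →₀ ℕ) (P : Finset (Fin (l + n))) : Prop := totExp m P ≤ α

/-- The monomials in the tensor product of the Taylor resolution and the Koszul complex that
vanish in the quotient of the Taylor resolution by `x_1, …, x_n`. -/
def TaylorCond (α : Fin n →₀ ℕ) (P : Finset (Fin (l + n))) : Prop :=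
  totExp m P ≤ α ∧ α ≠ lcmExp m (leftPart P)

/-- The monomials in the tensor product of the Taylor resolution and the Koszul complex that
vanish in the Koszul complex of the quotient. -/
def KoszulCond (α : Fin n →₀ ℕ) (P : Finset (Fin (l + n))) : Prop :=
  totExp m P ≤ α ∧ ∃ i, m i + xExp (rightPart P) ≤ α

variable {m}

theorem TotCond.erase {α : Fin n →₀ ℕ} {P : Finset (Fin (l + n))} (h : TotCond m α P) (j) :
    TotCond m α (P.erase j) := (totExp_mono m (Finset.erase_subset _ _)).trans h

theorem TotCond.lcmExp_le {α : Fin n →₀ ℕ} {P : Finset (Fin (l + n))} (h : TotCond m α P) :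
    lcmExp m (leftPart P) ≤ α := le_self_add.trans h

theorem TotCond.mul {α β : Fin n →₀ ℕ} {P Q : Finset (Fin (l + n))} (h : TotCond m α P)
    (h' : TotCond m β Q) (hd : Disjoint P Q) : TotCond m (α + β) (P ∪ Q) :=
  (totExp_union_le m hd).trans (add_le_add h h')

theorem TaylorCond.erase {α : Fin n →₀ ℕ} {P : Finset (Fin (l + n))} (h : TaylorCond m α P) (j) :
    TaylorCond m α (P.erase j) := by
  refine ⟨TotCond.erase h.1 j, fun he => h.2 ?_⟩
  refine le_antisymm ?_ (TotCond.lcmExp_le h.1)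
  exact he.le.trans (lcmExp_mono m (leftPart_mono (Finset.erase_subset _ _)))

/-- The inequality m_I < α stays strict after adding the inequality of the other factor, and the lcm
of a union is at most the sum of the exponents. -/
theorem TaylorCond.mul_right {α β : Fin n →₀ ℕ} {P Q : Finset (Fin (l + n))}
    (h : TaylorCond m α P) (h' : TotCond m β Q) (hd : Disjoint P Q) :
    TaylorCond m (α + β) (P ∪ Q) := by
  refine ⟨TotCond.mul h.1 h' hd, fun he => ?_⟩
  have h₁ : lcmExp m (leftPart P) < α := lt_of_le_of_ne (TotCond.lcmExp_le h.1) (Ne.symm h.2)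
  have h₂ := add_lt_add_of_lt_of_le h₁ h'.lcmExp_le
  rw [he, leftPart_union] at h₂
  exact h₂.not_ge (lcmExp_union_le m _ _)

theorem TaylorCond.mul_left {α β : Fin n →₀ ℕ} {P Q : Finset (Fin (l + n))}
    (h' : TotCond m β Q) (h : TaylorCond m α P) (hd : Disjoint Q P) :
    TaylorCond m (β + α) (Q ∪ P) := by
  rw [add_comm, Finset.union_comm]
  exact h.mul_right h' hd.symm

theorem KoszulCond.erase {α : Fin n →₀ ℕ} {P : Finset (Fin (l + n))} (h : KoszulCond m α P) (j) :
    KoszulCond m α (P.erase j) := by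
  obtain ⟨h, i, hi⟩ := h
  exact ⟨TotCond.erase h j, i,
    (add_le_add le_rfl (xExp_mono (rightPart_mono (Finset.erase_subset _ _)))).trans hi⟩

theorem KoszulCond.mul_right {α β : Fin n →₀ ℕ} {P Q : Finset (Fin (l + n))}
    (h : KoszulCond m α P) (h' : TotCond m β Q) (hd : Disjoint P Q) :
    KoszulCond m (α + β) (P ∪ Q) := by
  obtain ⟨h, i, hi⟩ := h
  refine ⟨TotCond.mul h h' hd, i, ?_⟩
  rw [rightPart_union, xExp_union (disjoint_rightPart hd), ← add_assoc]
  exact add_le_add hi (le_add_self.trans h')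

theorem KoszulCond.mul_left {α β : Fin n →₀ ℕ} {P Q : Finset (Fin (l + n))}
    (h' : TotCond m β Q) (h : KoszulCond m α P) (hd : Disjoint Q P) :
    KoszulCond m (β + α) (Q ∪ P) := by
  rw [add_comm, Finset.union_comm]
  exact h.mul_right h' hd.symm

/-- Any Taylor letter of P is a witness: its generator divides the lcm of all of them. -/
theorem TotCond.koszulCond {α : Fin n →₀ ℕ} {P : Finset (Fin (l + n))} (h : TotCond m α P)
    (hP : leftPart P ≠ ∅) : KoszulCond m α P := by
  obtain ⟨i, hi⟩ := Finset.nonempty_iff_ne_empty.2 hP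
  exact ⟨h, i, (add_le_add (le_lcmExp m hi) le_rfl).trans h⟩

/-- This expresses that the Koszul complex over S resolves k. Since α differs from m_I, some
variable x_j still divides x^α / m_I, and the Koszul letter j may be joined. The choice depends only
on α and the Taylor letters, so G is the set of Taylor letters. -/
theorem taylorCond_acyclic {z : Cone k n (l + n)} (hz : z ∈ monSpan k (TaylorCond m))
    (hDz : coneD z = 0) : ∃ y ∈ monSpan k (TaylorCond m), coneD y = z := by
  refine exists_coneD_eq_of_exists (leftMap n Finset.univ) (fun α P j h => h.erase j) ?_ hz hDz
  intro α P h
  obtain ⟨j, hj⟩ : ∃ j, lcmExp m (leftPart P) j < α j := by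
    by_contra! hc
    exact h.2 (le_antisymm hc (TotCond.lcmExp_le h.1))
  refine ⟨Fin.natAdd l j, by simp, fun P' h' he => ?_⟩
  have hl : leftPart P' = leftPart P := by
    ext i
    have := Finset.ext_iff.1 he (Fin.castAdd n i)
    simpa using this
  have hl' : leftPart (insert (Fin.natAdd l j) P') = leftPart P' := by
    ext i
    simp [castAdd_ne_natAdd]
  refine ⟨fun t => ?_, hl' ▸ h'.2⟩
  rw [totExp, hl', Finsupp.add_apply, xExp_apply]
  have ht : lcmExp m (leftPart P') t + xExp (rightPart P') t ≤ α t := h'.1 t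
  rw [xExp_apply] at ht
  by_cases htj : t = j
  · subst htj
    rw [hl]
    split_ifs <;> omega
  · simpa [htj] using ht

/-- This expresses that the Taylor complex resolves A. A generator dividing x^α / ∏ x_j supplies a
Taylor letter that may be joined; the choice depends only on α and the Koszul letters, so G is now
the set of Koszul letters. -/
theorem koszulCond_acyclic {z : Cone k n (l + n)} (hz : z ∈ monSpan k (KoszulCond m))
    (hDz : coneD z = 0) : ∃ y ∈ monSpan k (KoszulCond m), coneD y = z := by
  refine exists_coneD_eq_of_exists (rightMap l Finset.univ) (fun α P j h => h.erase j) ?_ hz hDz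
  rintro α P ⟨-, i, hi⟩
  refine ⟨Fin.castAdd n i, by simp, fun P' h' he => ?_⟩
  have hr : rightPart P' = rightPart P := by
    ext i
    have := Finset.ext_iff.1 he (Fin.natAdd l i)
    simpa using this
  have hr' : rightPart (insert (Fin.castAdd n i) P') = rightPart P' := by
    ext i
    simp [(castAdd_ne_natAdd _ _).symm]
  have hl' : leftPart (insert (Fin.castAdd n i) P') = insert i (leftPart P') := by
    ext i
    simp
  refine ⟨fun t => ?_, i, by rwa [hr', hr]⟩
  rw [totExp, hl', hr', lcmExp, Finset.sup_insert, Finsupp.add_apply, Finsupp.sup_apply]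
  have ht : lcmExp m (leftPart P') t + xExp (rightPart P') t ≤ α t := h'.1 t
  have ht' : m i t + xExp (rightPart P') t ≤ α t := hr ▸ hi t
  rw [lcmExp] at ht
  rcases le_total (m i t) ((leftPart P').sup m t) with h | h <;> simp [h] <;> assumption

end Bicomplex

end MonomialKoszul

end
noncomputable section

open scoped BigOperators

namespace MonomialKoszul

/-! ### The quotient T ⊗ k of the tensor product. -/

section TaylorProjection

variable {k : Type*} [Field k] {n l : ℕ} (m : Fin l → Fin n →₀ ℕ)

/-- The basis element `I` of the Taylor resolution. -/
def taylorCell (k : Type*) [Field k] (I : Finset (Fin l)) : Cone k n (l + n) :=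
  mon k (lcmExp m I) (leftMap n I)

/-- The projection onto the quotient of the Taylor resolution by `x_1, …, x_n`. -/
def taylorProj : Cone k n (l + n) →ₗ[k] (Finset (Fin l) → k) :=
  (monBasis k n (l + n)).constr k fun q =>
    if rightPart q.2 = ∅ ∧ q.1 = lcmExp m (leftPart q.2) then Pi.single (leftPart q.2) 1 else 0

theorem taylorProj_mon (α : Fin n →₀ ℕ) (P : Finset (Fin (l + n))) :
    taylorProj m (mon k α P) =
      if rightPart P = ∅ ∧ α = lcmExp m (leftPart P) then Pi.single (leftPart P) 1 else 0 := by
  simp only [← monBasis_apply, taylorProj, Module.Basis.constr_basis]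

variable {m}

/-- If α = m_I, the bound `totExp m P ≤ α` leaves no room for a Koszul letter. So T ⊗ K is the span
of the Taylor cells plus the kernel of the projection. -/
theorem TotCond.eq_taylorCell {α : Fin n →₀ ℕ} {P : Finset (Fin (l + n))} (h : TotCond m α P)
    (h' : ¬ TaylorCond m α P) : mon k α P = taylorCell m k (leftPart P) ∧ rightPart P = ∅ ∧
      α = lcmExp m (leftPart P) := by
  have hα : α = lcmExp m (leftPart P) := by
    by_contra hc
    exact h' ⟨h, hc⟩
  have hr : rightPart P = ∅ := by
    rw [Finset.eq_empty_iff_forall_notMem]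
    intro j hj
    have := h j
    rw [hα, totExp, Finsupp.add_apply, xExp_apply, if_pos hj] at this
    omega
  refine ⟨?_, hr, hα⟩
  rw [taylorCell, ← eq_leftMap hr, ← hα]

theorem taylorProj_taylorCell (I : Finset (Fin l)) :
    taylorProj m (taylorCell m k I) = Pi.single I 1 := by
  simp [taylorCell, taylorProj_mon]

theorem taylorCell_mem (I : Finset (Fin l)) : taylorCell m k I ∈ monSpan k (TotCond m) :=
  mon_mem_monSpan (by simp [TotCond, totExp, xExp])

theorem taylorProj_eq_zero {x : Cone k n (l + n)} (hx : x ∈ monSpan k (TaylorCond m)) :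
    taylorProj m x = 0 :=
  map_eq_of_mem_monSpan (f := taylorProj m) (g := 0)
    (fun α P h => by rw [taylorProj_mon, if_neg fun h' => h.2 h'.2, LinearMap.zero_apply]) hx

theorem sub_sum_taylorCell_mem {x : Cone k n (l + n)} (hx : x ∈ monSpan k (TotCond m)) :
    x - ∑ I, taylorProj m x I • taylorCell m k I ∈ monSpan k (TaylorCond m) := by
  let s : (Finset (Fin l) → k) →ₗ[k] Cone k n (l + n) :=
    Fintype.linearCombination k (taylorCell m k)
  refine map_mem_of_mem_monSpan (f := LinearMap.id - s ∘ₗ taylorProj m) (S := TotCond m) ?_ hx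
  intro α P h
  change mon k α P - s (taylorProj m (mon k α P)) ∈ _
  by_cases hT : TaylorCond m α P
  · rw [taylorProj_eq_zero (mon_mem_monSpan hT), map_zero, sub_zero]
    exact mon_mem_monSpan hT
  · obtain ⟨h1, h2, h3⟩ := h.eq_taylorCell (k := k) hT
    rw [h1, taylorProj_taylorCell, Fintype.linearCombination_apply_single, one_smul, sub_self]
    exact Submodule.zero_mem _

theorem mem_taylorCond_of_taylorProj_eq_zero {x : Cone k n (l + n)}
    (hx : x ∈ monSpan k (TotCond m)) (h : taylorProj m x = 0) :
    x ∈ monSpan k (TaylorCond m) := by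
  simpa [h] using sub_sum_taylorCell_mem hx

theorem taylorProj_mul_eq_zero {x y : Cone k n (l + n)} (hx : x ∈ monSpan k (TotCond m))
    (hy : y ∈ monSpan k (TotCond m)) (h : taylorProj m x = 0) :
    taylorProj m (x * y) = 0 ∧ taylorProj m (y * x) = 0 := by
  have hx' := mem_taylorCond_of_taylorProj_eq_zero hx h
  exact ⟨taylorProj_eq_zero (mul_mem_monSpan (fun _ _ _ _ h₁ h₂ hd => h₁.mul_right h₂ hd) hx' hy),
    taylorProj_eq_zero (mul_mem_monSpan (fun _ _ _ _ h₁ h₂ hd => .mul_left h₁ h₂ hd) hy hx')⟩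

theorem taylorProj_acyclic {z : Cone k n (l + n)} (hz : z ∈ monSpan k (TotCond m))
    (hDz : coneD z = 0) (h : taylorProj m z = 0) :
    ∃ y ∈ monSpan k (TotCond m), coneD y = z ∧ taylorProj m y = 0 := by
  obtain ⟨y, hy, hyz⟩ := taylorCond_acyclic (mem_taylorCond_of_taylorProj_eq_zero hz h) hDz
  exact ⟨y, monSpan_mono (fun _ _ h => h.1) hy, hyz, taylorProj_eq_zero hy⟩

/-- The matrix of the differential of the quotient of the Taylor resolution by
`x_1, …, x_n`. -/
def taylorMatrix (k : Type*) [Field k] (m : Fin l → Fin n →₀ ℕ) :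
    Matrix (Finset (Fin l)) (Finset (Fin l)) k :=
  fun I J => MvPolynomial.constantCoeff ((taylor k m).d I J)

theorem taylorMatrix_eq (I : Finset (Fin l)) :
    taylorMatrix k m I = ∑ i ∈ I, if lcmExp m I = lcmExp m (I.erase i) then
      (-1 : k) ^ (I.filter (· < i)).card • Pi.single (I.erase i) (1 : k) else 0 := by
  ext J
  rw [taylorMatrix, taylor, map_sum, Finset.sum_apply]
  refine Finset.sum_congr rfl fun i _ => ?_
  have hle := lcmExp_mono m (Finset.erase_subset i I)
  rw [apply_ite MvPolynomial.constantCoeff, map_zero]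
  by_cases hJ : J = I.erase i
  · subst hJ
    rw [if_pos rfl, MvPolynomial.constantCoeff_monomial]
    have : lcmExp m I - lcmExp m (I.erase i) = 0 ↔ lcmExp m I = lcmExp m (I.erase i) := by
      rw [tsub_eq_zero_iff_le]
      exact ⟨fun h => le_antisymm h hle, fun h => h.le⟩
    simp only [this]
    split_ifs <;> simp
  · rw [if_neg hJ]
    split_ifs <;> simp [hJ]

/-- The kernel is stable under the differential, so only Taylor cells need checking. There the
coefficient m_I / m_{I∖i} survives modulo the variables exactly when the two lcm's agree. -/
theorem taylorProj_coneD {x : Cone k n (l + n)} (hx : x ∈ monSpan k (TotCond m)) :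
    taylorProj m (coneD x) = Matrix.vecMul (taylorProj m x) (taylorMatrix k m) := by
  refine map_eq_of_mem_monSpan (f := taylorProj m ∘ₗ coneD)
    (g := (taylorMatrix k m).vecMulLinear ∘ₗ taylorProj m) (S := TotCond m) ?_ hx
  intro α P h
  change taylorProj m (coneD (mon k α P)) = Matrix.vecMul (taylorProj m (mon k α P)) _
  by_cases hT : TaylorCond m α P
  · rw [taylorProj_eq_zero (mon_mem_monSpan hT), Matrix.zero_vecMul]
    exact taylorProj_eq_zero (coneD_mem_monSpan (fun _ _ j _ h => h.erase j) (mon_mem_monSpan hT))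
  · obtain ⟨h1, h2, h3⟩ := h.eq_taylorCell (k := k) hT
    rw [h1, taylorProj_taylorCell, Matrix.single_one_vecMul, Matrix.row, taylorMatrix_eq,
      taylorCell, coneD_mon_leftMap, map_sum]
    refine Finset.sum_congr rfl fun i _ => ?_
    rw [map_smul, taylorProj_mon]
    simp

theorem taylorCell_mul_of_coprime {I J : Finset (Fin l)} (hd : Disjoint I J)
    (h : Coprime m I J) :
    taylorCell m k I * taylorCell m k J = shuffleSign k I J • taylorCell m k (I ∪ J) := by
  have hd' : Disjoint (leftMap n I) (leftMap n J) := (Finset.disjoint_map _).2 hd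
  rw [taylorCell, taylorCell, mon_mul, if_pos hd', leftMap, leftMap,
    inversions_map _ strictMono_castAddEmb, ← lcmExp_union_eq_add_iff.2 h, ← Finset.map_union]
  rfl

/-- The product has exponent m_I + m_J, which for non-coprime sets is not the lcm of the union, so
it dies modulo the variables; if I and J meet, the product is zero already in the exterior algebra.
-/
theorem taylorProj_taylorCell_mul {I J : Finset (Fin l)} (h : ¬ Coprime m I J) :
    taylorProj m (taylorCell m k I * taylorCell m k J) = 0 := by
  rw [taylorCell, taylorCell, mon_mul]
  split_ifs
  · rw [map_smul, taylorProj_mon, if_neg, smul_zero]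
    rintro ⟨-, h'⟩
    rw [leftPart_union, leftPart_leftMap, leftPart_leftMap] at h'
    exact h (lcmExp_union_eq_add_iff.1 h'.symm)
  · exact map_zero _

theorem taylorProj_coneProj (x : Cone k n (l + n)) (p : ℕ) (a : Fin n →₀ ℕ)
    (I : Finset (Fin l)) : taylorProj m (coneProj p a x) I =
      if I.card = p ∧ lcmExp m I = a then taylorProj m x I else 0 := by
  let f : Cone k n (l + n) →ₗ[k] k := LinearMap.proj I ∘ₗ taylorProj m
  let c : k := if I.card = p ∧ lcmExp m I = a then 1 else 0
  have : f ∘ₗ coneProj p a = c • f := by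
    refine cone_ext fun α P => ?_
    simp only [f, LinearMap.comp_apply, LinearMap.smul_apply, LinearMap.proj_apply]
    rw [coneProj_mon, apply_ite (taylorProj m), map_zero, taylorProj_mon]
    by_cases hP : rightPart P = ∅ ∧ α = lcmExp m (leftPart P)
    · have hc : P.card = (leftPart P).card := by
        conv_lhs => rw [eq_leftMap hP.1, leftMap, Finset.card_map]
      rw [if_pos hP, hc, hP.2]
      by_cases hI : leftPart P = I
      · subst hI
        simp only [c]
        split_ifs <;> simp
      · split_ifs <;> simp [Ne.symm hI]
    · simp [hP]
  have h := LinearMap.congr_fun this x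
  simp only [f, LinearMap.comp_apply, LinearMap.smul_apply, LinearMap.proj_apply] at h
  rw [h]
  simp only [c]
  split_ifs <;> simp

end TaylorProjection

end MonomialKoszul

end
noncomputable section

open scoped BigOperators

namespace MonomialKoszul

/-! ### The quotient K^A of the tensor product. -/

section KoszulProjection

variable {k : Type*} [Field k] {n l : ℕ} {m : Fin l → Fin n →₀ ℕ}
  (𝔞 : Ideal (MvPolynomial (Fin n) k))

/-- The projection onto the Koszul complex of the quotient by `𝔞`. -/
def koszulProj (l : ℕ) : Cone k n (l + n) →ₗ[k] Koszul (MvPolynomial (Fin n) k ⧸ 𝔞) n :=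
  (monBasis k n (l + n)).constr k fun q =>
    if leftPart q.2 = ∅ then
      koszulTerm (Ideal.Quotient.mk 𝔞 (MvPolynomial.monomial (q.1 - xExp (rightPart q.2)) 1))
        (rightPart q.2)
    else 0

theorem koszulProj_mon (α : Fin n →₀ ℕ) (P : Finset (Fin (l + n))) :
    koszulProj 𝔞 l (mon k α P) =
      if leftPart P = ∅ then
        koszulTerm (Ideal.Quotient.mk 𝔞 (MvPolynomial.monomial (α - xExp (rightPart P)) 1))
          (rightPart P)
      else 0 := by
  simp only [← monBasis_apply, koszulProj, Module.Basis.constr_basis]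

theorem koszulProj_mon_rightMap (α : Fin n →₀ ℕ) (J : Finset (Fin n)) :
    koszulProj 𝔞 l (mon k α (rightMap l J)) =
      koszulTerm (Ideal.Quotient.mk 𝔞 (MvPolynomial.monomial (α - xExp J) 1)) J := by
  simp [koszulProj_mon]

variable {𝔞}

theorem IsMinGen.mem_iff (hm : IsMinGen 𝔞 m) (f : MvPolynomial (Fin n) k) :
    f ∈ 𝔞 ↔ ∀ γ ∈ f.support, ∃ i, m i ≤ γ := by
  have h : (Set.range fun i => MvPolynomial.monomial (m i) (1 : k)) =
      (fun s => MvPolynomial.monomial s (1 : k)) '' Set.range m := by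
    rw [← Set.range_comp]; rfl
  rw [hm.span_eq, h, MvPolynomial.mem_ideal_span_monomial_image]
  simp

theorem IsMinGen.mk_monomial_eq_zero (hm : IsMinGen 𝔞 m) {γ : Fin n →₀ ℕ} {i : Fin l}
    (h : m i ≤ γ) : Ideal.Quotient.mk 𝔞 (MvPolynomial.monomial γ 1) = 0 := by
  rw [Ideal.Quotient.eq_zero_iff_mem, hm.mem_iff]
  intro δ hδ
  rw [MvPolynomial.mem_support_iff, MvPolynomial.coeff_monomial] at hδ
  rw [ne_eq, ite_eq_right_iff, Classical.not_imp] at hδ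
  exact ⟨i, hδ.1 ▸ h⟩

theorem IsMinGen.koszulProj_eq_zero (hm : IsMinGen 𝔞 m) {x : Cone k n (l + n)}
    (hx : x ∈ monSpan k (KoszulCond m)) : koszulProj 𝔞 l x = 0 := by
  refine map_eq_of_mem_monSpan (f := koszulProj 𝔞 l) (g := 0) ?_ hx
  rintro α P ⟨-, i, hi⟩
  rw [koszulProj_mon, hm.mk_monomial_eq_zero (le_tsub_of_add_le_right hi), koszulTerm_zero, ite_self,
    LinearMap.zero_apply]

/-- If a factor contains a Taylor letter, both sides vanish because the monomials of `KoszulCond`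
span an ideal. Otherwise both factors involve only Koszul letters and this is the product of the
exterior algebra. -/
theorem IsMinGen.koszulProj_mul (hm : IsMinGen 𝔞 m) {x y : Cone k n (l + n)}
    (hx : x ∈ monSpan k (TotCond m)) (hy : y ∈ monSpan k (TotCond m)) :
    koszulProj 𝔞 l (x * y) = koszulProj 𝔞 l x * koszulProj 𝔞 l y := by
  refine map_eq_of_mem_monSpan (f := koszulProj 𝔞 l ∘ₗ LinearMap.mulRight k y)
    (g := LinearMap.mulRight k (koszulProj 𝔞 l y) ∘ₗ koszulProj 𝔞 l) ?_ hx
  intro α P hP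
  refine map_eq_of_mem_monSpan (f := koszulProj 𝔞 l ∘ₗ LinearMap.mulLeft k (mon k α P))
    (g := LinearMap.mulLeft k (koszulProj 𝔞 l (mon k α P)) ∘ₗ koszulProj 𝔞 l) ?_ hy
  intro β Q hQ
  change koszulProj 𝔞 l (mon k α P * mon k β Q) =
    koszulProj 𝔞 l (mon k α P) * koszulProj 𝔞 l (mon k β Q)
  by_cases hPl : leftPart P = ∅
  · by_cases hQl : leftPart Q = ∅
    · obtain ⟨J, rfl⟩ : ∃ J, P = rightMap l J := ⟨_, eq_rightMap hPl⟩
      obtain ⟨J', rfl⟩ : ∃ J, Q = rightMap l J := ⟨_, eq_rightMap hQl⟩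
      rw [koszulProj_mon_rightMap, koszulProj_mon_rightMap, mon_mul]
      have hJ : xExp J ≤ α := by simpa using le_add_self.trans hP
      have hJ' : xExp J' ≤ β := by simpa using le_add_self.trans hQ
      by_cases hd : Disjoint J J'
      · have hd' : Disjoint (rightMap l J) (rightMap l J') := (Finset.disjoint_map _).2 hd
        rw [if_pos hd', koszulTerm_mul_of_disjoint _ _ hd, map_smul,
          rightMap, rightMap, inversions_map _ strictMono_natAddEmb, ← Finset.map_union]
        change _ • koszulProj 𝔞 l (mon k (α + β) (rightMap l (J ∪ J'))) = _
        rw [koszulProj_mon_rightMap, xExp_union hd, ← tsub_add_tsub_comm hJ hJ', ← map_mul,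
          MvPolynomial.monomial_mul, one_mul, smul_koszulTerm]
        simp
      · rw [if_neg fun h : Disjoint (rightMap l J) (rightMap l J') => hd ((Finset.disjoint_map _).1 h),
          map_zero,
          koszulTerm_mul_of_not_disjoint _ _ hd]
    · rw [hm.koszulProj_eq_zero (mon_mem_monSpan (hQ.koszulCond hQl)), mul_zero]
      exact hm.koszulProj_eq_zero (mul_mem_monSpan (fun _ _ _ _ h₁ h₂ hd => .mul_left h₁ h₂ hd)
        (mon_mem_monSpan hP) (mon_mem_monSpan (hQ.koszulCond hQl)))
  · rw [hm.koszulProj_eq_zero (mon_mem_monSpan (hP.koszulCond hPl)), zero_mul]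
    exact hm.koszulProj_eq_zero (mul_mem_monSpan (fun _ _ _ _ h₁ h₂ hd => h₁.mul_right h₂ hd)
      (mon_mem_monSpan (hP.koszulCond hPl)) (mon_mem_monSpan hQ))

theorem IsMinGen.koszulProj_coneD (hm : IsMinGen 𝔞 m) {x : Cone k n (l + n)}
    (hx : x ∈ monSpan k (TotCond m)) :
    koszulProj 𝔞 l (coneD x) = koszulD (vars 𝔞) (koszulProj 𝔞 l x) := by
  refine map_eq_of_mem_monSpan (f := koszulProj 𝔞 l ∘ₗ coneD)
    (g := (koszulD (vars 𝔞)).restrictScalars k ∘ₗ koszulProj 𝔞 l) ?_ hx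
  intro α P hP
  change koszulProj 𝔞 l (coneD (mon k α P)) = koszulD (vars 𝔞) (koszulProj 𝔞 l (mon k α P))
  by_cases hPl : leftPart P = ∅
  · obtain ⟨J, rfl⟩ : ∃ J, P = rightMap l J := ⟨_, eq_rightMap hPl⟩
    have hJ : xExp J ≤ α := by simpa using le_add_self.trans hP
    rw [koszulProj_mon_rightMap, coneD_mon_rightMap, koszulD_koszulTerm, map_sum]
    refine Finset.sum_congr rfl fun j hj => ?_
    -- The exponent α is kept by the differential, so deleting the letter j returns the factor x_j
    -- to the coefficient.
    have e : α - xExp (J.erase j) = (α - xExp J) + Finsupp.single j 1 := by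
      rw [← xExp_erase hj] at hJ ⊢
      ext t
      have := hJ t
      simp only [Finsupp.coe_add, Finsupp.coe_tsub, Pi.add_apply, Pi.sub_apply] at this ⊢
      omega
    rw [map_smul, koszulProj_mon_rightMap, e, vars, ← one_mul (1 : k),
      ← MvPolynomial.monomial_mul, map_mul, one_mul, smul_koszulTerm]
    simp [MvPolynomial.X]
  · rw [hm.koszulProj_eq_zero (mon_mem_monSpan (hP.koszulCond hPl)), map_zero]
    exact hm.koszulProj_eq_zero (coneD_mem_monSpan (fun _ _ j _ h => h.erase j)
      (mon_mem_monSpan (hP.koszulCond hPl)))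

theorem exists_koszulProj_eq_of_mem_piece {p : ℕ} {a : Fin n →₀ ℕ}
    {z : Koszul (MvPolynomial (Fin n) k ⧸ 𝔞) n} (hz : z ∈ koszulPiece 𝔞 p a) :
    ∃ w ∈ monSpan k (fun α P => TotCond m α P ∧ P.card = p ∧ α = a), koszulProj 𝔞 l w = z := by
  have : koszulPiece 𝔞 p a ≤
      (monSpan k (fun α P => TotCond m α P ∧ P.card = p ∧ α = a)).map (koszulProj 𝔞 l) := by
    refine Submodule.span_le.2 ?_
    rintro _ ⟨J, β, rfl, rfl, rfl⟩
    refine ⟨mon k (β + xExp J) (rightMap l J), mon_mem_monSpan ⟨?_, by simp [rightMap], rfl⟩, ?_⟩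
    · simp [TotCond, totExp, lcmExp]
    · rw [koszulProj_mon_rightMap, add_tsub_cancel_right]
      rfl
  exact this hz

theorem koszulProj_mem_piece {p : ℕ} {a : Fin n →₀ ℕ} {w : Cone k n (l + n)}
    (hw : w ∈ monSpan k (fun α P => TotCond m α P ∧ P.card = p ∧ α = a)) :
    koszulProj 𝔞 l w ∈ koszulPiece 𝔞 p a := by
  refine map_mem_of_mem_monSpan (f := koszulProj 𝔞 l) ?_ hw
  rintro α P ⟨hP, rfl, rfl⟩
  rw [koszulProj_mon]
  split_ifs with hl
  · obtain ⟨J, rfl⟩ : ∃ J, P = rightMap l J := ⟨_, eq_rightMap hl⟩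
    refine Submodule.subset_span ⟨J, α - xExp J, by simp [rightMap], ?_, by
      rw [rightPart_rightMap]; rfl⟩
    exact tsub_add_cancel_of_le (by simpa using le_add_self.trans hP)
  · exact Submodule.zero_mem _

variable (m) in
theorem exists_koszulProj_eq (z : Koszul (MvPolynomial (Fin n) k ⧸ 𝔞) n) :
    ∃ w ∈ monSpan k (TotCond m), koszulProj 𝔞 l w = z := by
  let R : Submodule k (Koszul (MvPolynomial (Fin n) k ⧸ 𝔞) n) :=
    (monSpan k (TotCond m)).map (koszulProj 𝔞 l)
  have hmon : ∀ (f : MvPolynomial (Fin n) k) (J : Finset (Fin n)),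
      koszulTerm (Ideal.Quotient.mk 𝔞 f) J ∈ R := by
    intro f J
    induction f using MvPolynomial.induction_on' with
    | monomial β c =>
      have : koszulTerm (Ideal.Quotient.mk 𝔞 (MvPolynomial.monomial β c)) J =
          koszulProj 𝔞 l (c • mon k (β + xExp J) (rightMap l J)) := by
        rw [map_smul, koszulProj_mon_rightMap, add_tsub_cancel_right, smul_koszulTerm,
          IsScalarTower.algebraMap_apply k (MvPolynomial (Fin n) k) (_ ⧸ 𝔞)]
        rw [Ideal.Quotient.algebraMap_eq, ← map_mul, MvPolynomial.algebraMap_eq,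
          MvPolynomial.C_mul_monomial, mul_one]
      rw [this]
      refine Submodule.mem_map_of_mem (Submodule.smul_mem _ _ (mon_mem_monSpan ?_))
      simp [TotCond, totExp, lcmExp]
    | add f g hf hg => rw [map_add, koszulTerm_add]; exact R.add_mem hf hg
  have : z ∈ R := by
    rw [← sum_koszulTerm_repr z]
    refine R.sum_mem fun J _ => ?_
    obtain ⟨f, hf⟩ := Ideal.Quotient.mk_surjective ((koszulBasisOf _ n).repr z J)
    rw [← hf]
    exact hmon f J
  exact this

/-- The monomials left over have no Taylor letters and coefficients that are monomials outside 𝔞;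
such monomials stay linearly independent in A. -/
theorem IsMinGen.eq_zero_of_koszulProj_eq_zero (hm : IsMinGen 𝔞 m) {x : Cone k n (l + n)}
    (hx : x ∈ monSpan k fun α P => TotCond m α P ∧ ¬ KoszulCond m α P)
    (h : koszulProj 𝔞 l x = 0) : x = 0 := by
  let S : (Fin n →₀ ℕ) → Finset (Fin (l + n)) → Prop :=
    fun α P => TotCond m α P ∧ ¬ KoszulCond m α P
  have hS : ∀ α P, S α P → leftPart P = ∅ := fun α P hP => by
    by_contra hl
    exact hP.2 (hP.1.koszulCond hl)
  have hrepr : ∀ α P, ¬ S α P → (monBasis k n (l + n)).repr x (α, P) = 0 := by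
    intro α P hP
    refine map_eq_of_mem_monSpan (f := (monBasis k n (l + n)).coord (α, P)) (g := 0) ?_ hx
    intro β Q hQ
    rw [← monBasis_apply, Module.Basis.coord_apply, Module.Basis.repr_self,
      Finsupp.single_eq_of_ne, LinearMap.zero_apply]
    rintro h
    rw [Prod.mk.injEq] at h
    obtain ⟨rfl, rfl⟩ := h
    exact hP hQ
  -- The polynomial coefficient of e_J before reduction modulo 𝔞.
  let part : Finset (Fin n) → Cone k n (l + n) →ₗ[k] MvPolynomial (Fin n) k := fun J =>
    (monBasis k n (l + n)).constr k fun q =>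
      if q.2 = rightMap l J then MvPolynomial.monomial (q.1 - xExp J) 1 else 0
  have part_mon : ∀ J α P, part J (mon k α P) =
      if P = rightMap l J then MvPolynomial.monomial (α - xExp J) 1 else 0 := fun J α P => by
    simp only [part, ← monBasis_apply, Module.Basis.constr_basis]
  have hpart : ∀ J, Ideal.Quotient.mk 𝔞 (part J x) = 0 := by
    intro J
    have e : ((koszulBasisOf (MvPolynomial (Fin n) k ⧸ 𝔞) n).coord J).restrictScalars k ∘ₗ
        koszulProj 𝔞 l = (Ideal.Quotient.mkₐ k 𝔞).toLinearMap ∘ₗ part J := by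
      refine cone_ext fun α P => ?_
      change (koszulBasisOf _ n).repr (koszulProj 𝔞 l (mon k α P)) J =
        Ideal.Quotient.mk 𝔞 (part J (mon k α P))
      rw [part_mon, koszulProj_mon]
      by_cases hP : leftPart P = ∅
      · obtain ⟨J', rfl⟩ : ∃ J, P = rightMap l J := ⟨_, eq_rightMap hP⟩
        rw [if_pos hP, repr_koszulTerm, rightPart_rightMap]
        have : rightMap l J' = rightMap l J ↔ J' = J := Finset.map_inj
        simp only [this]
        split_ifs with hJ
        · subst hJ; simp
        · simp
      · rw [if_neg hP, if_neg, map_zero]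
        · simp
        · rintro rfl
          simp at hP
    have := LinearMap.congr_fun e x
    rw [LinearMap.comp_apply, h, map_zero] at this
    exact this.symm
  have hcoeff : ∀ J α, xExp J ≤ α → MvPolynomial.coeff (α - xExp J) (part J x) =
      (monBasis k n (l + n)).repr x (α, rightMap l J) := by
    intro J α hJ
    refine map_eq_of_mem_monSpan
      (f := MvPolynomial.lcoeff k (α - xExp J) ∘ₗ part J)
      (g := (monBasis k n (l + n)).coord (α, rightMap l J)) ?_ hx
    intro β Q hQ
    rw [LinearMap.comp_apply, part_mon, Module.Basis.coord_apply, ← monBasis_apply,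
      Module.Basis.repr_self, Finsupp.single_apply, MvPolynomial.lcoeff_apply]
    by_cases hQJ : Q = rightMap l J
    · subst hQJ
      have hβ : xExp J ≤ β := by simpa using le_add_self.trans hQ.1
      rw [if_pos rfl, MvPolynomial.coeff_monomial]
      simp [tsub_left_inj hβ hJ]
    · rw [if_neg hQJ, if_neg, MvPolynomial.coeff_zero]
      rw [Prod.mk.injEq]
      exact fun h => hQJ h.2
  apply (monBasis k n (l + n)).ext_elem
  rintro ⟨α, P⟩
  rw [map_zero, Finsupp.zero_apply]
  by_contra hne
  have hP : S α P := by
    by_contra hP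
    exact hne (hrepr α P hP)
  obtain ⟨J, rfl⟩ : ∃ J, P = rightMap l J := ⟨_, eq_rightMap (hS α P hP)⟩
  have hJ : xExp J ≤ α := by simpa using le_add_self.trans hP.1
  rw [← hcoeff J α hJ, ← ne_eq, ← MvPolynomial.mem_support_iff] at hne
  obtain ⟨i, hi⟩ := (hm.mem_iff _).1 (Ideal.Quotient.eq_zero_iff_mem.1 (hpart J)) _ hne
  refine hP.2 ⟨hP.1, i, ?_⟩
  rw [rightPart_rightMap]
  exact (add_le_add hi le_rfl).trans (tsub_add_cancel_of_le hJ).le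

theorem IsMinGen.mem_koszulCond_of_koszulProj_eq_zero (hm : IsMinGen 𝔞 m)
    {x : Cone k n (l + n)} (hx : x ∈ monSpan k (TotCond m)) (h : koszulProj 𝔞 l x = 0) :
    x ∈ monSpan k (KoszulCond m) := by
  have hle : monSpan k (TotCond m) ≤ monSpan k (KoszulCond m) ⊔
      monSpan k fun α P => TotCond m α P ∧ ¬ KoszulCond m α P := by
    refine Submodule.span_le.2 ?_
    rintro _ ⟨α, P, hP, rfl⟩
    by_cases hK : KoszulCond m α P
    · exact Submodule.mem_sup_left (mon_mem_monSpan hK)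
    · exact Submodule.mem_sup_right (mon_mem_monSpan ⟨hP, hK⟩)
  obtain ⟨y, hy, t, ht, rfl⟩ := Submodule.mem_sup.1 (hle hx)
  rw [map_add, hm.koszulProj_eq_zero hy, zero_add] at h
  rw [hm.eq_zero_of_koszulProj_eq_zero ht h, add_zero]
  exact hy

theorem IsMinGen.koszulProj_acyclic (hm : IsMinGen 𝔞 m) {z : Cone k n (l + n)}
    (hz : z ∈ monSpan k (TotCond m)) (hDz : coneD z = 0) (h : koszulProj 𝔞 l z = 0) :
    ∃ y ∈ monSpan k (KoszulCond m), coneD y = z :=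
  koszulCond_acyclic (hm.mem_koszulCond_of_koszulProj_eq_zero hz h) hDz

theorem koszulProj_one : koszulProj 𝔞 l 1 = 1 := by
  have := koszulProj_mon_rightMap (l := l) 𝔞 0 ∅
  simpa [rightMap, mon_zero_empty, koszulTerm_one_empty, xExp] using this

end KoszulProjection

end MonomialKoszul

end
noncomputable section

open scoped BigOperators

namespace MonomialKoszul

set_option linter.unusedSectionVars false

/-! ### Algebraic discrete Morse theory over a field: the projection onto the Morse complex and its
kernel. -/

section MorseTheory

variable {k X : Type*} [Field k] [Fintype X] [DecidableEq X]
  {C : BasedComplex k X} {M : Finset (X × X)}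

/-- The matrix of the differential. -/
def BasedComplex.matrix {R : Type*} (C : BasedComplex R X) : Matrix X X R := Matrix.of C.d

theorem BasedComplex.matrix_apply {R : Type*} (C : BasedComplex R X) (a b : X) :
    C.matrix a b = C.d a b := rfl

theorem row_mul_eq {X : Type*} {R : Type*} [NonUnitalNonAssocSemiring R] [Fintype X]
    (A B : Matrix X X R) (c : X) : (A * B).row c = Matrix.vecMul (A.row c) B := rfl

/-- A step in the graph of `C` in which the edges of `M` are reversed. -/
def MorseStep (C : BasedComplex k X) (M : Finset (X × X)) (a b : X) : Prop :=
  (C.Edge a b ∧ (a, b) ∉ M) ∨ (b, a) ∈ M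

/-- The critical cells. -/
def IsCritical (C : BasedComplex k X) (M : Finset (X × X)) (c : X) : Prop :=
  c ∈ C.cells ∧ ¬ Matched M c

/-- The cells from which a matched edge starts. -/
def IsUpper (M : Finset (X × X)) (u : X) : Prop := ∃ v, (u, v) ∈ M

theorem mem_morseComplex_cells {R : Type*} [CommRing R] {C : BasedComplex R X}
    {M : Finset (X × X)} {c : X} :
    c ∈ (morseComplex C M).cells ↔ c ∈ C.cells ∧ ¬ Matched M c := by
  simp [morseComplex]

theorem morseStep_of_morseWeight_ne_zero {a b : X} (h : morseWeight C M a b ≠ 0) :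
    MorseStep C M a b := by
  unfold morseWeight at h
  split_ifs at h with h₁ h₂
  · exact Or.inr h₁
  · exact Or.inl h₂.symm
  · exact absurd rfl h

theorem IsAcyclicMatching.wellFounded (hM : IsAcyclicMatching C M) :
    WellFounded (Relation.TransGen (MorseStep C M)) := by
  have : Std.Irrefl (Relation.TransGen (MorseStep C M)) := ⟨hM.acyclic⟩
  exact Finite.wellFounded_of_trans_of_irrefl _

theorem IsAcyclicMatching.wellFounded_swap (hM : IsAcyclicMatching C M) :
    WellFounded (Function.swap (Relation.TransGen (MorseStep C M))) := by
  have : Std.Irrefl (Function.swap (Relation.TransGen (MorseStep C M))) := ⟨hM.acyclic⟩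
  exact Finite.wellFounded_of_trans_of_irrefl _

/-- Each step strictly decreases the number of reachable cells, and a cell does not reach itself, so
a path has fewer edges than there are cells. -/
theorem IsAcyclicMatching.morseWeight_pow_card (hM : IsAcyclicMatching C M) :
    morseWeight C M ^ Fintype.card X = 0 := by
  classical
  let reach : X → Finset X := fun c => Finset.univ.filter (Relation.TransGen (MorseStep C M) c)
  have hlt : ∀ a b, MorseStep C M a b → (reach b).card < (reach a).card := by
    intro a b h
    refine Finset.card_lt_card (Finset.ssubset_iff_subset_ne.2 ⟨fun x hx => ?_, fun he => ?_⟩)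
    · simp only [reach, Finset.mem_filter, Finset.mem_univ, true_and] at hx ⊢
      exact Relation.TransGen.head h hx
    · have hb : b ∈ reach a := by simpa [reach] using Relation.TransGen.single h
      rw [← he] at hb
      exact hM.acyclic b (Finset.mem_filter.1 hb).2
  have hpow : ∀ r a b, (morseWeight C M ^ r) a b ≠ 0 → r ≤ (reach a).card := by
    intro r
    induction r with
    | zero => intro a b _; exact Nat.zero_le _
    | succ r ih =>
      intro a b h
      rw [pow_succ', Matrix.mul_apply] at h
      obtain ⟨c, -, hc⟩ := Finset.exists_ne_zero_of_sum_ne_zero h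
      exact (ih c b (right_ne_zero_of_mul hc)).trans_lt
        (hlt a c (morseStep_of_morseWeight_ne_zero (left_ne_zero_of_mul hc)))
  ext a b
  by_contra h
  refine (hpow _ a b h).not_gt (Finset.card_lt_univ_of_notMem (x := a) fun ha => ?_)
  exact hM.acyclic a (Finset.mem_filter.1 ha).2

/-- A path is empty or consists of a first step and a path. Formally, the weight matrix ω is
nilpotent and the finite geometric sum is the inverse of 1 - ω. -/
theorem IsAcyclicMatching.pathSum_eq (hM : IsAcyclicMatching C M) (a b : X) :
    pathSum C M a b = (if a = b then 1 else 0) + ∑ c, morseWeight C M a c * pathSum C M c b := by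
  have h := mul_neg_geom_sum (morseWeight C M) (Fintype.card X)
  rw [hM.morseWeight_pow_card, sub_zero, sub_mul, one_mul, sub_eq_iff_eq_add] at h
  have := congrFun (congrFun h a) b
  rw [Matrix.add_apply, Matrix.one_apply, Matrix.mul_apply] at this
  exact this

theorem IsAcyclicMatching.deg_eq (hM : IsAcyclicMatching C M) {u v : X} (h : (u, v) ∈ M) :
    C.deg u = C.deg v + 1 := (hM.edge _ h).2.2.1

theorem IsAcyclicMatching.d_ne_zero (hM : IsAcyclicMatching C M) {u v : X} (h : (u, v) ∈ M) :
    C.d u v ≠ 0 := (hM.edge _ h).2.2.2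

theorem IsAcyclicMatching.not_lower_upper (hM : IsAcyclicMatching C M) {u v w : X}
    (h : (u, v) ∈ M) : (v, w) ∉ M := fun h' => by
  have := hM.matching _ h _ h' (by simp)
  have h1 := hM.deg_eq h
  rw [Prod.mk.injEq] at this
  rw [this.1] at h1
  omega

theorem IsAcyclicMatching.lower_unique (hM : IsAcyclicMatching C M) {u u' v : X}
    (h : (u, v) ∈ M) (h' : (u', v) ∈ M) : u = u' := by
  have := hM.matching _ h _ h' (by simp)
  rw [Prod.mk.injEq] at this
  exact this.1

theorem IsAcyclicMatching.upper_unique (hM : IsAcyclicMatching C M) {u v v' : X}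
    (h : (u, v) ∈ M) (h' : (u, v') ∈ M) : v = v' := by
  have := hM.matching _ h _ h' (by simp)
  rw [Prod.mk.injEq] at this
  exact this.2

/-- The nonzero matrix entries of a based complex belong to edges. -/
def IsSupported {R : Type*} [CommRing R] (C : BasedComplex R X) : Prop :=
  ∀ a b, C.d a b ≠ 0 → C.Edge a b

theorem morseWeight_of_not_lower (hC : IsSupported C) {a : X} (ha : ∀ u, (u, a) ∉ M) (b : X) :
    morseWeight C M a b = if (a, b) ∈ M then 0 else C.d a b := by
  unfold morseWeight
  rw [if_neg (ha b)]
  by_cases h : (a, b) ∈ M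
  · simp [h]
  · by_cases h' : C.Edge a b
    · simp [h, h']
    · have : C.d a b = 0 := by
        by_contra h''
        exact h' (hC a b h'')
      simp [h, this]

theorem IsAcyclicMatching.morseWeight_of_lower (hM : IsAcyclicMatching C M) (hC : IsSupported C)
    {u v : X} (h : (u, v) ∈ M) (b : X) :
    morseWeight C M v b = C.d v b + if b = u then -(C.d u v)⁻¹ else 0 := by
  unfold morseWeight
  by_cases hb : b = u
  · subst hb
    have : C.d v b = 0 := by
      by_contra h'
      have h1 := (hC _ _ h').2.2.1
      have h2 := hM.deg_eq h
      omega
    rw [if_pos h, if_pos rfl, this, zero_add, Ring.inverse_eq_inv']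
  · rw [if_neg fun h' => hb (hM.lower_unique h' h), if_neg hb, add_zero]
    by_cases h' : C.Edge v b
    · simp [hM.not_lower_upper h, h']
    · have : C.d v b = 0 := by
        by_contra h''
        exact h' (hC v b h'')
      simp [this]

open Classical in
/-- The projection of a based complex onto its Morse complex. -/
def morseProj (C : BasedComplex k X) (M : Finset (X × X)) : Matrix X X k := fun c c' =>
  if IsCritical C M c' ∧ C.deg c = C.deg c' then pathSum C M c c' else 0

/-- A path can rise only from a lower to an upper cell, and must then descend. Starting below the
degree of c', it meets that degree at upper cells only, and the critical cell c' is not one of them.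
-/
theorem IsAcyclicMatching.pathSum_eq_zero (hM : IsAcyclicMatching C M) {c c' : X}
    (hc' : IsCritical C M c')
    (h : C.deg c < C.deg c' ∨ C.deg c = C.deg c' ∧ IsUpper M c) : pathSum C M c c' = 0 := by
  have key : ∀ r c, (C.deg c < C.deg c' ∨ C.deg c = C.deg c' ∧ IsUpper M c) →
      (morseWeight C M ^ r) c c' = 0 := by
    intro r
    induction r with
    | zero =>
      intro c h
      rw [pow_zero, Matrix.one_apply, if_neg]
      rintro rfl
      rcases h with h | ⟨-, v, hv⟩
      · exact lt_irrefl _ h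
      · exact hc'.2 ⟨_, hv, Or.inl rfl⟩
    | succ r ih =>
      intro c h
      rw [pow_succ', Matrix.mul_apply]
      refine Finset.sum_eq_zero fun b _ => ?_
      by_cases hw : morseWeight C M c b = 0
      · rw [hw, zero_mul]
      · rw [ih b, mul_zero]
        rcases morseStep_of_morseWeight_ne_zero hw with hs | hs
        · have := hs.1.2.2.1
          omega
        · have := hM.deg_eq hs
          rcases h with h | ⟨-, v, hv⟩
          · rcases (show C.deg b ≤ C.deg c' by omega).lt_or_eq with h' | h'
            · exact Or.inl h'
            · exact Or.inr ⟨h', c, hs⟩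
          · exact absurd hv (hM.not_lower_upper hs)
  rw [pathSum, Matrix.sum_apply]
  exact Finset.sum_eq_zero fun r _ => key r c h

theorem IsCritical.not_lower {c : X} (hc : IsCritical C M c) (u : X) : (u, c) ∉ M :=
  fun h => hc.2 ⟨_, h, Or.inr rfl⟩

theorem IsCritical.not_upper {c : X} (hc : IsCritical C M c) (v : X) : (c, v) ∉ M :=
  fun h => hc.2 ⟨_, h, Or.inl rfl⟩

theorem IsCritical.morseWeight (hC : IsSupported C) {c : X} (hc : IsCritical C M c) (b : X) :
    morseWeight C M c b = C.d c b := by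
  rw [morseWeight_of_not_lower hC hc.not_lower, if_neg (hc.not_upper b)]

theorem IsAcyclicMatching.morseProj_critical (hM : IsAcyclicMatching C M) (hC : IsSupported C)
    {c : X} (hc : IsCritical C M c) : (morseProj C M).row c = Pi.single c 1 := by
  ext c'
  rw [Matrix.row_apply]
  unfold morseProj
  by_cases h : IsCritical C M c' ∧ C.deg c = C.deg c'
  · rw [if_pos h, hM.pathSum_eq, Finset.sum_eq_zero, add_zero, Pi.single_apply]
    · simp only [eq_comm]
    · intro b _
      rw [hc.morseWeight hC]
      by_cases hd : C.d c b = 0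
      · rw [hd, zero_mul]
      · have := (hC _ _ hd).2.2.1
        rw [hM.pathSum_eq_zero h.1 (Or.inl (by omega)), mul_zero]
  · rw [if_neg h, Pi.single_apply, if_neg]
    rintro rfl
    exact h ⟨hc, rfl⟩

theorem IsAcyclicMatching.morseProj_upper (hM : IsAcyclicMatching C M) {u : X}
    (hu : IsUpper M u) : (morseProj C M).row u = 0 := by
  ext c'
  rw [Matrix.row_apply, Pi.zero_apply]
  unfold morseProj
  split_ifs with h
  · exact hM.pathSum_eq_zero h.1 (Or.inr ⟨h.2, hu⟩)
  · rfl

theorem IsAcyclicMatching.morseProj_not_mem (hM : IsAcyclicMatching C M) (hC : IsSupported C)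
    {c : X} (hc : c ∉ C.cells) : (morseProj C M).row c = 0 := by
  ext c'
  rw [Matrix.row_apply, Pi.zero_apply]
  unfold morseProj
  split_ifs with h
  · rw [hM.pathSum_eq, if_neg (fun he : c = c' => hc (he ▸ h.1.1)), Finset.sum_eq_zero, add_zero]
    · intro b _
      rw [morseWeight_of_not_lower hC fun u hu => hc (hM.edge _ hu).2.1]
      split_ifs
      · exact zero_mul _
      · by_cases hd : C.d c b = 0
        · rw [hd, zero_mul]
        · exact absurd (hC _ _ hd).1 hc
  · rfl

theorem morseProj_ne_zero {c c' : X} (h : morseProj C M c c' ≠ 0) :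
    IsCritical C M c' ∧ C.deg c = C.deg c' := by
  unfold morseProj at h
  split_ifs at h with h'
  · exact h'
  · exact absurd rfl h

theorem mul_morseProj_apply (hC : IsSupported C) {c c' : X} (hc' : IsCritical C M c')
    (hdeg : C.deg c = C.deg c' + 1) :
    (C.matrix * morseProj C M) c c' = ∑ b, C.d c b * pathSum C M b c' := by
  rw [Matrix.mul_apply]
  refine Finset.sum_congr rfl fun b _ => ?_
  rw [BasedComplex.matrix_apply]
  by_cases hd : C.d c b = 0
  · rw [hd, zero_mul, zero_mul]
  · have := (hC _ _ hd).2.2.1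
    rw [morseProj, if_pos ⟨hc', by omega⟩]

theorem mul_morseProj_apply_of_not (hC : IsSupported C) {c c' : X}
    (h : ¬ (IsCritical C M c' ∧ C.deg c = C.deg c' + 1)) :
    (C.matrix * morseProj C M) c c' = 0 := by
  rw [Matrix.mul_apply]
  refine Finset.sum_eq_zero fun b _ => ?_
  by_contra hne
  have h₁ := (hC _ _ (left_ne_zero_of_mul hne)).2.2.1
  have h₂ := morseProj_ne_zero (right_ne_zero_of_mul hne)
  exact h ⟨h₂.1, by omega⟩

/-- Let u → v be matched. From u every unmatched edge contributes, so Γ(u) is the sum of d(u,b) Γ(b)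
over b ≠ v. From v only the reversed edge matters, since the other edges descend too far: Γ(v) =
-Γ(u) / d(u,v). Together these say that the sum over all b vanishes. -/
theorem IsAcyclicMatching.mul_morseProj_upper (hM : IsAcyclicMatching C M) (hC : IsSupported C)
    {u : X} (hu : IsUpper M u) : (C.matrix * morseProj C M).row u = 0 := by
  obtain ⟨v, huv⟩ := hu
  ext c'
  by_cases h : IsCritical C M c' ∧ C.deg u = C.deg c' + 1
  · have huc : u ≠ c' := fun he => h.1.not_upper v (he ▸ huv)
    have hvc : v ≠ c' := fun he => h.1.not_lower u (he ▸ huv)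
    have hv : pathSum C M v c' = -(C.d u v)⁻¹ * pathSum C M u c' := by
      rw [hM.pathSum_eq v, if_neg hvc, zero_add]
      simp only [hM.morseWeight_of_lower hC huv, add_mul, Finset.sum_add_distrib, ite_mul,
        zero_mul, Finset.sum_ite_eq', Finset.mem_univ, if_true]
      rw [add_eq_right]
      refine Finset.sum_eq_zero fun b _ => ?_
      by_cases hd : C.d v b = 0
      · rw [hd, zero_mul]
      · have h₁ := (hC _ _ hd).2.2.1
        have h₂ := hM.deg_eq huv
        rw [hM.pathSum_eq_zero h.1 (Or.inl (by omega)), mul_zero]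
    have hu : pathSum C M u c' = (∑ b, C.d u b * pathSum C M b c') -
        C.d u v * pathSum C M v c' := by
      rw [hM.pathSum_eq u, if_neg huc, zero_add, ← Finset.add_sum_erase _ _ (Finset.mem_univ v),
        ← Finset.add_sum_erase _ (fun b => C.d u b * pathSum C M b c') (Finset.mem_univ v),
        add_sub_cancel_left]
      rw [morseWeight_of_not_lower hC fun w hw => hM.not_lower_upper hw huv, if_pos huv, zero_mul,
        zero_add]
      refine Finset.sum_congr rfl fun b hb => ?_
      rw [morseWeight_of_not_lower hC fun w hw => hM.not_lower_upper hw huv,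
        if_neg fun hub => (Finset.mem_erase.1 hb).1 (hM.upper_unique hub huv)]
    rw [Matrix.row_apply, mul_morseProj_apply hC h.1 h.2, Pi.zero_apply, ← add_eq_of_eq_sub hu, hv]
    have := hM.d_ne_zero huv
    field_simp
    ring
  · exact mul_morseProj_apply_of_not hC h

theorem morseComplex_isSupported {R : Type*} [CommRing R] {C : BasedComplex R X} :
    IsSupported (morseComplex C M) := by
  intro a b h
  have h' := h
  simp only [morseComplex] at h'
  split_ifs at h' with hh
  · exact ⟨mem_morseComplex_cells.2 hh.1, mem_morseComplex_cells.2 hh.2.1, hh.2.2, h⟩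
  · exact absurd rfl h'

theorem morseComplex_d_apply {c c' : X} (hc : IsCritical C M c) (hc' : IsCritical C M c')
    (hdeg : C.deg c = C.deg c' + 1) : (morseComplex C M).d c c' = pathSum C M c c' :=
  if_pos ⟨hc, hc', hdeg⟩

theorem morseComplex_d_of_not {c c' : X}
    (h : ¬ (IsCritical C M c ∧ IsCritical C M c' ∧ C.deg c = C.deg c' + 1)) :
    (morseComplex C M).d c c' = 0 := if_neg h

theorem IsAcyclicMatching.mul_morseProj_critical (hM : IsAcyclicMatching C M)
    (hC : IsSupported C) {c : X} (hc : IsCritical C M c) :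
    (C.matrix * morseProj C M).row c = (morseComplex C M).matrix.row c := by
  ext c'
  by_cases h : IsCritical C M c' ∧ C.deg c = C.deg c' + 1
  · rw [Matrix.row_apply, Matrix.row_apply, BasedComplex.matrix_apply,
      mul_morseProj_apply hC h.1 h.2, morseComplex_d_apply hc h.1 h.2, hM.pathSum_eq c,
      if_neg (fun he => by rw [he] at h; omega), zero_add]
    simp only [hc.morseWeight hC]
  · rw [Matrix.row_apply, Matrix.row_apply, BasedComplex.matrix_apply,
      mul_morseProj_apply_of_not hC h, morseComplex_d_of_not fun h' => h h'.2]

theorem matched_cases {c : X} (hc : c ∈ C.cells) (h₁ : ¬ IsUpper M c) (h₂ : ∀ u, (u, c) ∉ M) :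
    IsCritical C M c := by
  refine ⟨hc, ?_⟩
  rintro ⟨⟨u, v⟩, he, rfl | rfl⟩
  · exact h₁ ⟨v, he⟩
  · exact h₂ u he

/-- The projection onto the Morse complex commutes with the differentials. -/
theorem IsAcyclicMatching.mul_morseProj (hM : IsAcyclicMatching C M) (hC : IsSupported C)
    (hd : C.matrix * C.matrix = 0) :
    C.matrix * morseProj C M = morseProj C M * (morseComplex C M).matrix := by
  have single_mul : ∀ c, IsCritical C M c →
      (morseProj C M * (morseComplex C M).matrix).row c = (morseComplex C M).matrix.row c := by
    intro c hc
    rw [row_mul_eq, hM.morseProj_critical hC hc, Matrix.single_one_vecMul]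
  have zero_mul : ∀ c, (morseProj C M).row c = 0 →
      (morseProj C M * (morseComplex C M).matrix).row c = 0 := by
    intro c hc
    rw [row_mul_eq, hc, Matrix.zero_vecMul]
  set E : Matrix X X k := C.matrix * morseProj C M -
    morseProj C M * (morseComplex C M).matrix with hE
  -- Upper cells, critical cells and non-cells are settled by direct computation; only lower cells
  -- remain.
  have hE₁ : ∀ c, (∀ u, (u, c) ∉ M) → E.row c = 0 := by
    intro c hc
    change (C.matrix * morseProj C M).row c -
      (morseProj C M * (morseComplex C M).matrix).row c = 0
    by_cases hcell : c ∈ C.cells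
    · by_cases hu : IsUpper M c
      · rw [hM.mul_morseProj_upper hC hu, zero_mul c (hM.morseProj_upper hu), sub_zero]
      · have hcrit := matched_cases hcell hu hc
        rw [hM.mul_morseProj_critical hC hcrit, single_mul c hcrit, sub_self]
    · rw [zero_mul c (hM.morseProj_not_mem hC hcell), sub_zero,
        row_mul_eq]
      have : C.matrix.row c = 0 := by
        ext b
        by_contra hb
        exact hcell (hC _ _ hb).1
      rw [this, Matrix.zero_vecMul]
  -- As d² = 0, composing d with E leaves only -dπd', where π is the projection and d' the Morse
  -- differential; its row at an upper cell vanishes.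
  have hE₂ : ∀ u, IsUpper M u → ∀ c, ∑ b, C.d u b * E b c = 0 := by
    intro u hu c
    have h₁ : C.matrix * E =
        -(C.matrix * morseProj C M * (morseComplex C M).matrix) := by
      rw [hE, mul_sub, ← mul_assoc, hd, Matrix.zero_mul, zero_sub, mul_assoc]
    have h₂ := congrFun (congrFun h₁ u) c
    rw [Matrix.mul_apply] at h₂
    have h₃ := congrFun (hM.mul_morseProj_upper hC hu)
    simp only [Matrix.row_apply, Pi.zero_apply] at h₃
    simp only [BasedComplex.matrix_apply] at h₂
    rw [h₂, Matrix.neg_apply, Matrix.mul_apply]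
    simp [h₃]
  -- For a lower cell v with partner u, the relation at u expresses E(v) through the E(b) for the
  -- other faces b of u. These are reached from v by the path v → u → b, so induction along paths
  -- applies.
  have hE₃ : ∀ v, E.row v = 0 := by
    intro v
    refine hM.wellFounded_swap.induction (C := fun v => E.row v = 0) v fun v ih => ?_
    by_cases hv : ∃ u, (u, v) ∈ M
    · obtain ⟨u, huv⟩ := hv
      ext c
      have h := hE₂ u ⟨v, huv⟩ c
      rw [← Finset.add_sum_erase _ _ (Finset.mem_univ v), Finset.sum_eq_zero, add_zero] at h
      · exact (mul_eq_zero.1 h).resolve_left (hM.d_ne_zero huv)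
      · intro b hb
        by_cases hdb : C.d u b = 0
        · rw [hdb, MulZeroClass.zero_mul]
        · have hb0 : E b c = 0 := congrFun (ih b ?_) c
          · rw [hb0, mul_zero]
          refine Relation.TransGen.head (b := u) (Or.inr huv) (.single (Or.inl ⟨hC _ _ hdb, ?_⟩))
          exact fun hub => (Finset.mem_erase.1 hb).1 (hM.upper_unique hub huv)
    · push Not at hv
      exact hE₁ v hv
  exact sub_eq_zero.1 (Matrix.ext_row hE₃)

/-- The chain map property turns πd'd' into ddπ = 0, and π is the identity on critical cells. -/
theorem IsAcyclicMatching.morseComplex_d_mul_d (hM : IsAcyclicMatching C M) (hC : IsSupported C)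
    (hd : C.matrix * C.matrix = 0) :
    (morseComplex C M).matrix * (morseComplex C M).matrix = 0 := by
  set D' := (morseComplex C M).matrix with hD'
  have h : morseProj C M * (D' * D') = 0 := by
    rw [← mul_assoc, ← hM.mul_morseProj hC hd, mul_assoc, ← hM.mul_morseProj hC hd, ← mul_assoc,
      hd, Matrix.zero_mul]
  refine Matrix.ext_row fun c => ?_
  by_cases hc : IsCritical C M c
  · have h' : (morseProj C M * (D' * D')).row c = 0 := by rw [h]; rfl
    rwa [row_mul_eq, hM.morseProj_critical hC hc, Matrix.single_one_vecMul] at h'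
  · rw [row_mul_eq]
    have : D'.row c = 0 := by
      ext c'
      exact morseComplex_d_of_not fun h' => hc h'.1
    rw [this, Matrix.zero_vecMul]
    rfl

/-- The vectors supported on the set of elements with a property. -/
def suppOn (k : Type*) [Field k] {X : Type*} (s : X → Prop) : Submodule k (X → k) where
  carrier := {f | ∀ x, ¬ s x → f x = 0}
  zero_mem' := fun _ _ => rfl
  add_mem' := fun {f g} hf hg x hx => by rw [Pi.add_apply, hf x hx, hg x hx, add_zero]
  smul_mem' := fun c f hf x hx => by rw [Pi.smul_apply, hf x hx, smul_zero]

theorem single_mem_suppOn {s : X → Prop} {x : X} (hx : s x) (c : k) :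
    Pi.single x c ∈ suppOn k s := by
  intro y hy
  rw [Pi.single_apply, if_neg]
  rintro rfl
  exact hy hx

theorem vecMul_eq_zero_of_mem_suppOn {s : X → Prop} {f : X → k} (hf : f ∈ suppOn k s)
    {P : Matrix X X k} (hP : ∀ x, s x → P.row x = 0) : Matrix.vecMul f P = 0 := by
  ext c
  rw [Matrix.vecMul_eq_sum, Finset.sum_apply]
  refine Finset.sum_eq_zero fun x _ => ?_
  by_cases hx : s x
  · have : P x c = 0 := congrFun (hP x hx) c
    rw [Pi.smul_apply, this, smul_zero]
  · rw [hf x hx, zero_smul, Pi.zero_apply]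

theorem IsAcyclicMatching.vecMul_morseProj_of_critical (hM : IsAcyclicMatching C M)
    (hC : IsSupported C) {f : X → k} (hf : f ∈ suppOn k (IsCritical C M)) :
    Matrix.vecMul f (morseProj C M) = f := by
  have h := vecMul_eq_zero_of_mem_suppOn hf (P := morseProj C M - 1) fun x hx => by
    change (morseProj C M).row x - (1 : Matrix X X k).row x = 0
    rw [hM.morseProj_critical hC hx, sub_eq_zero]
    ext y
    simp [Matrix.row_apply, Matrix.one_apply, Pi.single_apply, eq_comm]
  rwa [Matrix.vecMul_sub, Matrix.vecMul_one, sub_eq_zero] at h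

/-- The kernel of the projection onto the Morse complex is generated by the upper cells. -/
theorem IsAcyclicMatching.exists_of_vecMul_morseProj_eq_zero (hM : IsAcyclicMatching C M)
    (hC : IsSupported C) {f : X → k}
    (hf : f ∈ suppOn k (· ∈ C.cells)) (hP : Matrix.vecMul f (morseProj C M) = 0) :
    ∃ a ∈ suppOn k (IsUpper M), ∃ b ∈ suppOn k (IsUpper M), f = a + Matrix.vecMul b C.matrix := by
  let U : Submodule k (X → k) := suppOn k (IsUpper M)
  let Q : Submodule k (X → k) :=
    (U ⊔ U.map (Matrix.vecMulLinear C.matrix)) ⊔ suppOn k (IsCritical C M)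
  -- A lower cell c with partner u is, up to the scalar d(u,c), the boundary of u minus its other
  -- faces, which come later along paths.
  have hsingle : ∀ c, c ∈ C.cells → Pi.single c 1 ∈ Q := by
    intro c
    refine hM.wellFounded_swap.induction (C := fun c => c ∈ C.cells → Pi.single c 1 ∈ Q) c
      fun c ih hc => ?_
    by_cases hu : IsUpper M c
    · exact Submodule.mem_sup_left (Submodule.mem_sup_left (single_mem_suppOn hu 1))
    by_cases hv : ∃ u, (u, c) ∈ M
    · obtain ⟨u, huc⟩ := hv
      have hrow : C.matrix.row u ∈ Q := by
        refine Submodule.mem_sup_left (Submodule.mem_sup_right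
          ⟨Pi.single u 1, single_mem_suppOn ⟨c, huc⟩ 1, ?_⟩)
        rw [Matrix.vecMulLinear_apply, Matrix.single_one_vecMul]
      have hsum : C.matrix.row u = C.d u c • Pi.single c 1 +
          ∑ b ∈ Finset.univ.erase c, C.d u b • Pi.single b 1 := by
        rw [Finset.add_sum_erase _ (fun b => C.d u b • (Pi.single b 1 : X → k))
          (Finset.mem_univ c)]
        ext b
        simp [Pi.single_apply, Matrix.row_apply, BasedComplex.matrix_apply]
      have hrest : ∑ b ∈ Finset.univ.erase c, C.d u b • Pi.single b (1 : k) ∈ Q := by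
        refine Submodule.sum_mem _ fun b hb => ?_
        by_cases hdb : C.d u b = 0
        · rw [hdb, zero_smul]
          exact Submodule.zero_mem _
        · refine Submodule.smul_mem _ _ (ih b ?_ (hC _ _ hdb).2.1)
          refine Relation.TransGen.head (b := u) (Or.inr huc) (.single (Or.inl ⟨hC _ _ hdb, ?_⟩))
          exact fun hub => (Finset.mem_erase.1 hb).1 (hM.upper_unique hub huc)
      have hmem : C.d u c • Pi.single c (1 : k) ∈ Q := by
        rw [eq_sub_of_add_eq hsum.symm]
        exact Submodule.sub_mem _ hrow hrest
      exact (Submodule.smul_mem_iff _ (hM.d_ne_zero huc)).1 hmem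
    · push Not at hv
      exact Submodule.mem_sup_right (single_mem_suppOn (matched_cases hc hu hv) 1)
  have hfQ : f ∈ Q := by
    have : f = ∑ c, f c • Pi.single c (1 : k) := by
      ext b
      simp [Pi.single_apply]
    rw [this]
    refine Submodule.sum_mem _ fun c _ => ?_
    by_cases hc : c ∈ C.cells
    · exact Submodule.smul_mem _ _ (hsingle c hc)
    · rw [hf c hc, zero_smul]
      exact Submodule.zero_mem _
  obtain ⟨_, hx, c, hc, rfl⟩ := Submodule.mem_sup.1 hfQ
  obtain ⟨a, ha, _, ⟨b, hb, rfl⟩, rfl⟩ := Submodule.mem_sup.1 hx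
  refine ⟨a, ha, b, hb, ?_⟩
  rw [Matrix.vecMulLinear_apply] at hP ⊢
  -- The projection kills upper cells and their boundaries and fixes critical cells, so the critical
  -- summand of an element of the kernel is zero.
  rw [Matrix.add_vecMul, Matrix.add_vecMul, Matrix.vecMul_vecMul,
    vecMul_eq_zero_of_mem_suppOn ha fun x hx => hM.morseProj_upper hx,
    vecMul_eq_zero_of_mem_suppOn hb fun x hx => hM.mul_morseProj_upper hC hx,
    hM.vecMul_morseProj_of_critical hC hc, zero_add, zero_add] at hP
  rw [hP, add_zero]

/-- From upper cells to their partners the differential is triangular for the order given by paths,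
with nonzero diagonal. -/
theorem IsAcyclicMatching.eq_zero_of_vecMul_eq_zero (hM : IsAcyclicMatching C M)
    (hC : IsSupported C) {a : X → k} (ha : a ∈ suppOn k (IsUpper M))
    (h : Matrix.vecMul a C.matrix = 0) : a = 0 := by
  ext u
  refine hM.wellFounded.induction (C := fun u => a u = 0) u fun u ih => ?_
  by_cases hu : IsUpper M u
  · obtain ⟨v, huv⟩ := hu
    have h' : ∑ b, a b * C.d b v = 0 := congrFun h v
    rw [ ← Finset.add_sum_erase _ _ (Finset.mem_univ u),
      Finset.sum_eq_zero, add_zero] at h'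
    · exact (mul_eq_zero.1 h').resolve_right (hM.d_ne_zero huv)
    · intro b hb
      by_cases hdb : C.d b v = 0
      · rw [hdb, mul_zero]
      · rw [ih b, zero_mul]
        refine Relation.TransGen.head (b := v) (Or.inl ⟨hC _ _ hdb, ?_⟩) (.single (Or.inr huv))
        exact fun hbv => (Finset.mem_erase.1 hb).1 (hM.lower_unique hbv huv)
  · exact ha u hu

/-- The kernel of the projection onto the Morse complex is acyclic. -/
theorem IsAcyclicMatching.exists_of_vecMul_d_eq_zero (hM : IsAcyclicMatching C M)
    (hC : IsSupported C) (hd : C.matrix * C.matrix = 0) {f : X → k}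
    (hf : f ∈ suppOn k (· ∈ C.cells)) (hP : Matrix.vecMul f (morseProj C M) = 0)
    (hD : Matrix.vecMul f C.matrix = 0) :
    ∃ b ∈ suppOn k (IsUpper M), f = Matrix.vecMul b C.matrix := by
  obtain ⟨a, ha, b, hb, rfl⟩ := hM.exists_of_vecMul_morseProj_eq_zero hC hf hP
  rw [Matrix.add_vecMul, Matrix.vecMul_vecMul, hd, Matrix.vecMul_zero, add_zero] at hD
  rw [hM.eq_zero_of_vecMul_eq_zero hC ha hD, zero_add]
  exact ⟨b, hb, rfl⟩

/-- A quantity constant along every edge is constant along paths. It is applied to the multidegree,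
which edges of T ⊗ k and of the matchings preserve. -/
theorem pathSum_ne_zero {G : Type*} (g : X → G) (hM : ∀ e ∈ M, g e.1 = g e.2)
    (hg : ∀ a b, C.d a b ≠ 0 → g a = g b) {a b : X} (h : pathSum C M a b ≠ 0) : g a = g b := by
  have hω : ∀ a b, morseWeight C M a b ≠ 0 → g a = g b := by
    intro a b h
    rcases morseStep_of_morseWeight_ne_zero h with h | h
    · exact hg a b h.1.2.2.2
    · exact (hM _ h).symm
  have hpow : ∀ r a b, (morseWeight C M ^ r) a b ≠ 0 → g a = g b := by
    intro r
    induction r with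
    | zero =>
      intro a b h
      rw [pow_zero, Matrix.one_apply, ne_eq, ite_eq_right_iff, Classical.not_imp] at h
      rw [h.1]
    | succ r ih =>
      intro a b h
      rw [pow_succ', Matrix.mul_apply] at h
      obtain ⟨c, -, hc⟩ := Finset.exists_ne_zero_of_sum_ne_zero h
      exact (hω a c (left_ne_zero_of_mul hc)).trans (ih c b (right_ne_zero_of_mul hc))
  rw [pathSum, Matrix.sum_apply] at h
  obtain ⟨r, -, hr⟩ := Finset.exists_ne_zero_of_sum_ne_zero h
  exact hpow r a b hr

end MorseTheory

end MonomialKoszul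

end
noncomputable section

open scoped BigOperators

namespace MonomialKoszul

/-! ### Signs of shuffles and of sorted concatenations. -/

section Signs

variable {k : Type*} [Field k] {l : ℕ}

theorem shuffleSign_eq (I J : Finset (Fin l)) :
    shuffleSign k I J = (-1) ^ inversions I J := rfl

theorem inversions_union_left {I J : Finset (Fin l)} (h : Disjoint I J) (K : Finset (Fin l)) :
    inversions (I ∪ J) K = inversions I K + inversions J K := by
  unfold inversions
  rw [Finset.union_product, Finset.filter_union, Finset.card_union_of_disjoint]
  exact Finset.disjoint_filter_filter (Finset.disjoint_product.2 (Or.inl h))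

theorem inversions_union_right {I J : Finset (Fin l)} (h : Disjoint I J) (K : Finset (Fin l)) :
    inversions K (I ∪ J) = inversions K I + inversions K J := by
  unfold inversions
  rw [Finset.product_union, Finset.filter_union, Finset.card_union_of_disjoint]
  exact Finset.disjoint_filter_filter (Finset.disjoint_product.2 (Or.inr h))

theorem inversions_add_swap {I J : Finset (Fin l)} (h : Disjoint I J) :
    inversions I J + inversions J I = I.card * J.card := by
  have e : inversions J I = ((I ×ˢ J).filter fun p => ¬ p.2 < p.1).card := by
    unfold inversions
    refine Finset.card_bij (fun p _ => p.swap) ?_ ?_ ?_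
    · rintro ⟨a, b⟩ hp
      simp only [Finset.mem_filter, Finset.mem_product, Prod.swap_prod_mk, not_lt] at hp ⊢
      exact ⟨hp.1.symm, hp.2.le⟩
    · rintro p _ q _ h
      exact Prod.swap_injective h
    · rintro ⟨a, b⟩ hp
      simp only [Finset.mem_filter, Finset.mem_product, not_lt] at hp
      refine ⟨(b, a), ?_, rfl⟩
      simp only [Finset.mem_filter, Finset.mem_product]
      exact ⟨hp.1.symm, lt_of_le_of_ne hp.2 fun he =>
        Finset.disjoint_left.1 h hp.1.1 (he ▸ hp.1.2)⟩
  rw [e, inversions, Finset.card_filter_add_card_filter_not, Finset.card_product]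

theorem shuffleSign_mul_self (I J : Finset (Fin l)) :
    shuffleSign k I J * shuffleSign k I J = 1 := by
  rw [shuffleSign_eq, ← pow_add, Even.neg_one_pow ⟨_, rfl⟩]

theorem shuffleSign_swap {I J : Finset (Fin l)} (h : Disjoint I J) :
    shuffleSign k J I = shuffleSign k I J * (-1) ^ (I.card * J.card) := by
  rw [← inversions_add_swap h, shuffleSign_eq, shuffleSign_eq, ← pow_add, ← add_assoc, pow_add,
    Even.neg_one_pow ⟨_, rfl⟩, one_mul]

theorem mem_unionOf {L : List (Finset (Fin l))} {x : Fin l} :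
    x ∈ unionOf L ↔ ∃ I ∈ L, x ∈ I := by
  induction L with
  | nil => simp [unionOf]
  | cons I t ih => simp [unionOf, ih]

theorem unionOf_append (L L' : List (Finset (Fin l))) :
    unionOf (L ++ L') = unionOf L ∪ unionOf L' := by
  ext x
  simp only [mem_unionOf, List.mem_append, Finset.mem_union]
  grind

theorem unionOf_perm {L L' : List (Finset (Fin l))} (h : L.Perm L') :
    unionOf L = unionOf L' := by
  ext x
  simp only [mem_unionOf, h.mem_iff]

theorem disjoint_unionOf {I : Finset (Fin l)} {L : List (Finset (Fin l))}
    (h : ∀ J ∈ L, Disjoint I J) : Disjoint I (unionOf L) := by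
  rw [Finset.disjoint_left]
  intro x hx hx'
  obtain ⟨J, hJ, hxJ⟩ := mem_unionOf.1 hx'
  exact Finset.disjoint_left.1 (h J hJ) hx hxJ

theorem listSign_mul_self (L : List (Finset (Fin l))) : listSign k L * listSign k L = 1 := by
  induction L with
  | nil => simp [listSign]
  | cons I t ih => rw [listSign, mul_mul_mul_comm, shuffleSign_mul_self, ih, one_mul]

theorem listSign_append {L L' : List (Finset (Fin l))} (h : (L ++ L').Pairwise Disjoint) :
    listSign k (L ++ L') =
      listSign k L * listSign k L' * shuffleSign k (unionOf L) (unionOf L') := by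
  induction L with
  | nil => simp [listSign, unionOf, shuffleSign]
  | cons I t ih =>
    rw [List.cons_append, List.pairwise_cons] at h
    have h₁ : Disjoint I (unionOf t) :=
      disjoint_unionOf fun J hJ => h.1 J (List.mem_append_left _ hJ)
    have h₂ : Disjoint (unionOf t) (unionOf L') := by
      refine disjoint_unionOf fun J hJ => (disjoint_unionOf fun K hK => ?_).symm
      exact ((List.pairwise_append.1 h.2).2.2 K hK J hJ).symm
    rw [List.cons_append, listSign, listSign, unionOf, unionOf_append, ih h.2, shuffleSign_eq,
      shuffleSign_eq, shuffleSign_eq, shuffleSign_eq, inversions_union_right h₂,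
      inversions_union_left h₁, pow_add, pow_add]
    ring

/-- The signed product of graded commuting elements does not depend on their order. -/
theorem listSign_smul_prod_perm {ι R : Type*} [Ring R] [Algebra k R] (g : ι → Finset (Fin l))
    (ψ : ι → R) (hψ : ∀ a b, ψ a * ψ b = (-1 : k) ^ ((g a).card * (g b).card) • (ψ b * ψ a))
    {L L' : List ι} (h : L.Perm L') (hd : (L.map g).Pairwise Disjoint) :
    listSign k (L.map g) • (L.map ψ).prod = listSign k (L'.map g) • (L'.map ψ).prod := by
  induction h with
  | nil => rfl
  | cons x p ih =>
    rw [List.map_cons, List.pairwise_cons] at hd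
    have := congrArg (ψ x * ·) (ih hd.2)
    simp only [mul_smul_comm] at this
    simp only [List.map_cons, List.prod_cons, listSign, mul_smul, this, unionOf_perm (p.map g)]
  | swap x y t =>
    simp only [List.map_cons, List.pairwise_cons, List.mem_cons, forall_eq_or_imp] at hd
    obtain ⟨⟨hyx, hy⟩, hx, -⟩ := hd
    have hx' : Disjoint (g x) (unionOf (t.map g)) := disjoint_unionOf hx
    have hy' : Disjoint (g y) (unionOf (t.map g)) := disjoint_unionOf hy
    -- Only the first factor depends on the order of a and b, so transposing two neighbours changes
    -- the sign by (-1)^(|a||b|), as does transposing the two elements.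
    have e : ∀ a b : Finset (Fin l), Disjoint a (unionOf (t.map g)) →
        Disjoint b (unionOf (t.map g)) → listSign k (a :: b :: t.map g) =
        shuffleSign k a b * (shuffleSign k a (unionOf (t.map g)) *
          shuffleSign k b (unionOf (t.map g)) * listSign k (t.map g)) := by
      intro a b _ hb
      rw [listSign, listSign, unionOf, shuffleSign_eq, inversions_union_right hb, pow_add,
        ← shuffleSign_eq, ← shuffleSign_eq]
      ring
    simp only [List.map_cons, List.prod_cons]
    rw [e _ _ hy' hx', e _ _ hx' hy', ← mul_assoc (ψ y), hψ y x, shuffleSign_swap hyx,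
      smul_mul_assoc, smul_smul, mul_assoc (ψ x)]
    congr 1
    ring
  | trans p q ih₁ ih₂ =>
    rw [ih₁ hd, ih₂]
    exact ((p.map g).pairwise_iff fun h => h.symm).1 hd

end Signs

/-! ### Coprime sets of generators and equivalence classes. -/

section Coprimality

variable {n l : ℕ} {m : Fin l → Fin n →₀ ℕ}

theorem coprime_iff_disjoint {I J : Finset (Fin l)} :
    Coprime m I J ↔ Disjoint (lcmExp m I) (lcmExp m J) := by
  rw [disjoint_iff]; rfl

theorem gcdOne_iff_disjoint {a b : Fin n →₀ ℕ} : GcdOne a b ↔ Disjoint a b := by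
  rw [disjoint_iff]; rfl

theorem Coprime.symm {I J : Finset (Fin l)} (h : Coprime m I J) : Coprime m J I := by
  rw [coprime_iff_disjoint] at *
  exact Disjoint.symm h

theorem Coprime.mono {I I' J J' : Finset (Fin l)} (h : Coprime m I J) (hI : I' ⊆ I)
    (hJ : J' ⊆ J) : Coprime m I' J' := by
  rw [coprime_iff_disjoint] at *
  exact Disjoint.mono (lcmExp_mono m hI) (lcmExp_mono m hJ) h

theorem coprime_iff {I J : Finset (Fin l)} :
    Coprime m I J ↔ ∀ i ∈ I, ∀ j ∈ J, GcdOne (m i) (m j) := by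
  -- Disjointness from a supremum is tested on its members by distributivity, which holds in each
  -- coordinate.
  let _ : DistribLattice (Fin n →₀ ℕ) := DistribLattice.ofInfSupLe fun a b c x => by
    simp only [Finsupp.inf_apply, Finsupp.sup_apply]
    exact inf_sup_left _ _ _ |>.le
  rw [coprime_iff_disjoint]
  refine Finset.disjoint_sup_left.trans (forall₂_congr fun i _ => ?_)
  exact Finset.disjoint_sup_right.trans (forall₂_congr fun j _ => gcdOne_iff_disjoint.symm)

theorem Coprime.union_right {I J K : Finset (Fin l)} (h : Coprime m I J) (h' : Coprime m I K) :
    Coprime m I (J ∪ K) := by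
  rw [coprime_iff] at *
  intro i hi j hj
  rcases Finset.mem_union.1 hj with hj | hj
  exacts [h i hi j hj, h' i hi j hj]

/-- A common index would give a generator coprime to itself, that is, the generator 1. -/
theorem Coprime.disjoint (hne : ∀ i, m i ≠ 0) {I J : Finset (Fin l)} (h : Coprime m I J) :
    Disjoint I J := by
  rw [Finset.disjoint_left]
  intro i hi hj
  have := coprime_iff.1 h i hi i hj
  rw [GcdOne, inf_idem] at this
  exact hne i this

theorem coprime_unionOf {I : Finset (Fin l)} {L : List (Finset (Fin l))}
    (h : ∀ J ∈ L, Coprime m I J) : Coprime m I (unionOf L) := by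
  rw [coprime_iff]
  intro i hi j hj
  obtain ⟨J, hJ, hjJ⟩ := mem_unionOf.1 hj
  exact coprime_iff.1 (h J hJ) i hi j hjJ

theorem mem_eqvClass {I : Finset (Fin l)} {i j : Fin l} : j ∈ eqvClass m I i ↔
    j ∈ I ∧ Relation.EqvGen (fun a b => a ∈ I ∧ b ∈ I ∧ ¬ GcdOne (m a) (m b)) i j := by
  classical
  simp [eqvClass]

theorem mem_eqvClass_self {I : Finset (Fin l)} {i : Fin l} (hi : i ∈ I) : i ∈ eqvClass m I i :=
  mem_eqvClass.2 ⟨hi, .refl i⟩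

theorem cl_empty : cl m (∅ : Finset (Fin l)) = 0 := by simp [cl]

theorem cl_pos {I : Finset (Fin l)} (h : I.Nonempty) : 0 < cl m I :=
  Finset.card_pos.2 (h.image _)

theorem eqvClass_eq_self_of_cl_eq_one {I : Finset (Fin l)} (h : cl m I = 1) {i : Fin l}
    (hi : i ∈ I) : eqvClass m I i = I := by
  obtain ⟨J, hJ⟩ := Finset.card_eq_one.1 h
  have hall : ∀ j ∈ I, eqvClass m I j = J := fun j hj => by
    have := Finset.mem_image_of_mem (eqvClass m I) hj
    rwa [hJ, Finset.mem_singleton] at this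
  ext x
  refine ⟨fun hx => (mem_eqvClass.1 hx).1, fun hx => ?_⟩
  rw [hall i hi, ← hall x hx]
  exact mem_eqvClass_self hx

theorem coprime_eqvClass_sdiff (I : Finset (Fin l)) (i : Fin l) :
    Coprime m (eqvClass m I i) (I \ eqvClass m I i) := by
  rw [coprime_iff]
  intro a ha b hb
  rw [Finset.mem_sdiff] at hb
  by_contra hab
  refine hb.2 (mem_eqvClass.2 ⟨hb.1, ?_⟩)
  have ha' := mem_eqvClass.1 ha
  exact .trans _ _ _ ha'.2 (.rel _ _ ⟨ha'.1, hb.1, hab⟩)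

theorem eqvClass_subset (I : Finset (Fin l)) (i : Fin l) : eqvClass m I i ⊆ I :=
  fun _ hx => (mem_eqvClass.1 hx).1

/-- No generating relation joins G to its coprime complement, so membership in G is constant on
classes of L; and G is already connected by the relations inside it. -/
theorem eqvClass_eq_of_cl_eq_one {G L : Finset (Fin l)} (hG : cl m G = 1) (hGL : G ⊆ L)
    (hco : Coprime m G (L \ G)) {i : Fin l} (hi : i ∈ G) : eqvClass m L i = G := by
  ext x
  constructor
  · intro hx
    have h := (mem_eqvClass.1 hx).2
    have key : ∀ a b, Relation.EqvGen (fun a b => a ∈ L ∧ b ∈ L ∧ ¬ GcdOne (m a) (m b)) a b →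
        (a ∈ G ↔ b ∈ G) := by
      intro a b hab
      induction hab with
      | rel a b hab =>
        constructor
        · intro ha
          by_contra hb
          exact hab.2.2 (coprime_iff.1 hco a ha b (Finset.mem_sdiff.2 ⟨hab.2.1, hb⟩))
        · intro hb
          by_contra ha
          have := coprime_iff.1 hco b hb a (Finset.mem_sdiff.2 ⟨hab.1, ha⟩)
          rw [gcdOne_iff_disjoint] at this
          exact hab.2.2 (gcdOne_iff_disjoint.2 (Disjoint.symm this))
      | refl a => exact Iff.rfl
      | symm a b _ ih => exact ih.symm
      | trans a b c _ _ ih₁ ih₂ => exact ih₁.trans ih₂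
    exact (key i x h).1 hi
  · intro hx
    rw [← eqvClass_eq_self_of_cl_eq_one hG hi] at hx
    refine mem_eqvClass.2 ⟨hGL (eqvClass_subset _ _ hx), ?_⟩
    have h := (mem_eqvClass.1 hx).2
    clear hx hi
    induction h with
    | rel a b h => exact .rel _ _ ⟨hGL h.1, hGL h.2.1, h.2.2⟩
    | refl a => exact .refl a
    | symm a b _ ih => exact .symm _ _ ih
    | trans a b c _ _ ih₁ ih₂ => exact .trans _ _ _ ih₁ ih₂

end Coprimality

/-! ### Coprime factors and factorizations of unmatched sets. -/

section StandardMatchings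

variable {k : Type*} [Field k] {n l : ℕ} {m : Fin l → Fin n →₀ ℕ}

theorem stageComplex_deg (N : ℕ → Finset (Finset (Fin l) × Finset (Fin l))) (s : ℕ) :
    (stageComplex k m N s).deg = Finset.card := by
  induction s with
  | zero => rfl
  | succ s ih => exact ih

theorem StandardMatching.coprime_iff_of_mem (M : StandardMatching k m) {s : ℕ} (hs : s < M.len)
    {e : Finset (Fin l) × Finset (Fin l)} (he : e ∈ M.stage s) (K : Finset (Fin l)) :
    Coprime m e.1 K ↔ Coprime m e.2 K := by
  unfold Coprime
  rw [M.graded s hs e he]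

/-- The basis of a stage is closed under coprime factors. -/
theorem StandardMatching.mem_cells_of_union (M : StandardMatching k m) {s : ℕ} (hs : s ≤ M.len)
    {I K : Finset (Fin l)} (hco : Coprime m I K)
    (h : I ∪ K ∈ (stageComplex k m M.stage s).cells) :
    K ∈ (stageComplex k m M.stage s).cells := by
  induction s generalizing I K with
  | zero => exact Finset.mem_univ _
  | succ s ih =>
    rw [stageComplex, mem_morseComplex_cells] at h ⊢
    have hs' : s < M.len := hs
    refine ⟨ih hs'.le hco h.1, ?_⟩
    have hI : I ∈ (stageComplex k m M.stage s).cells :=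
      ih hs'.le hco.symm (Finset.union_comm I K ▸ h.1)
    obtain ⟨B, hBN, hN, -⟩ := M.base s hs'
    -- If K were matched at this stage, joining I to both ends of its edge would, by condition 5,
    -- give an edge of the same stage that contains I ∪ K, which is unmatched.
    have matched : ∀ b ∈ B, ∀ K', Coprime m b.1 K' → I ∪ K' ∈ (stageComplex k m M.stage s).cells →
        Coprime m b.1 I → (I ∪ K = b.1 ∪ (I ∪ K') ∨ I ∪ K = b.2 ∪ (I ∪ K')) → False := by
      intro b hb K' hK' hIK' hbI heq
      refine h.2 ⟨(b.1 ∪ (I ∪ K'), b.2 ∪ (I ∪ K')), ?_, heq⟩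
      exact (hN _).2 (Or.inr ⟨b, hb, I ∪ K', hIK', hbI.union_right hK', rfl⟩)
    rintro ⟨e, he, hKe⟩
    rcases (hN e).1 he with heB | ⟨b, hb, K', hK', hcoK', rfl⟩
    · refine matched e heB ∅ ?_ (by rwa [Finset.union_empty]) ?_ ?_
      · rw [coprime_iff]; simp
      · rcases hKe with rfl | rfl
        · exact hco.symm
        · exact (M.coprime_iff_of_mem hs' he I).2 hco.symm
      · rw [Finset.union_empty]
        rcases hKe with rfl | rfl
        · exact Or.inl (Finset.union_comm _ _)
        · exact Or.inr (Finset.union_comm _ _)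
    · have hbN := hBN hb
      have hbI : Coprime m b.1 I := by
        rcases hKe with rfl | rfl
        · exact hco.symm.mono Finset.subset_union_left subset_rfl
        · exact (M.coprime_iff_of_mem hs' hbN I).2
            (hco.symm.mono Finset.subset_union_left subset_rfl)
      have heq : I ∪ K = b.1 ∪ (I ∪ K') ∨ I ∪ K = b.2 ∪ (I ∪ K') := by
        rcases hKe with rfl | rfl
        · exact Or.inl (Finset.union_left_comm _ _ _)
        · exact Or.inr (Finset.union_left_comm _ _ _)
      refine matched b hb K' hcoK' ?_ hbI heq
      -- I ∪ K' is a cell by induction, being a coprime factor of the cell I ∪ K.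
      rcases heq with heq | heq
      · exact ih hs'.le (hbI.union_right hcoK') (heq ▸ h.1)
      · exact ih hs'.le ((M.coprime_iff_of_mem hs' hbN _).1 (hbI.union_right hcoK')) (heq ▸ h.1)

theorem StandardMatching.mem_critical_of_union (M : StandardMatching k m) {I K : Finset (Fin l)}
    (hco : Coprime m I K) (h : I ∪ K ∈ M.critical) : K ∈ M.critical :=
  M.mem_cells_of_union le_rfl hco h

/-- No generator of a minimal system that has a standard matching is a unit. -/
theorem StandardMatching.exp_ne_zero (M : StandardMatching k m)
    (hmin : ∀ i j, m i ≤ m j → i = j) (i : Fin l) : m i ≠ 0 := by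
  intro hi
  have hall : ∀ j, i = j := fun j => hmin i j (by rw [hi]; exact bot_le)
  have hl : l = 1 := by
    have : Subsingleton (Fin l) := ⟨fun a b => (hall a).symm.trans (hall b)⟩
    have h₁ := Fintype.card_le_one_iff_subsingleton.2 this
    rw [Fintype.card_fin] at h₁
    have := i.2
    omega
  have hcard : ∀ I : Finset (Fin l), I.card ≤ 1 := fun I => by
    have := Finset.card_le_univ I
    rw [Fintype.card_fin] at this
    omega
  -- A generator 1 would be the only generator, so a matched edge could only end at the empty set.
  -- There cl drops, contrary to condition 4 with level at least 1.
  have hempty : ∀ s < M.len, M.stage s = ∅ := by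
    intro s hs
    rw [Finset.eq_empty_iff_forall_notMem]
    intro e he
    have h₁ := M.card_eq s hs e he
    have h₂ := M.cl_eq s hs e he
    have h₃ := M.one_le_level s hs
    have h₄ := hcard e.1
    have h₅ : e.2 = ∅ := Finset.card_eq_zero.1 (by omega)
    have h₆ : 0 < cl m e.1 := cl_pos (Finset.card_pos.1 (by omega))
    rw [h₅, cl_empty] at h₂
    omega
  -- With nothing matched, the coefficient 1 from {i} to ∅ persists to the end, where it joins equal
  -- multidegrees and contradicts condition 2.
  have hstage : ∀ s ≤ M.len, (stageComplex k m M.stage s).cells = Finset.univ ∧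
      (stageComplex k m M.stage s).d {i} ∅ = 1 := by
    intro s
    induction s with
    | zero =>
      intro _
      refine ⟨rfl, ?_⟩
      simp [stageComplex, taylor, lcmExp, hi, Finset.filter_singleton]
    | succ s ih =>
      intro hs
      obtain ⟨h₁, h₂⟩ := ih (Nat.le_of_succ_le hs)
      have hcells : (stageComplex k m M.stage (s + 1)).cells = Finset.univ := by
        ext c
        rw [stageComplex, mem_morseComplex_cells, h₁, hempty s hs]
        simp [Matched]
      refine ⟨hcells, ?_⟩
      have hmem : ∀ c, c ∈ (stageComplex k m M.stage s).cells ∧ ¬ Matched (M.stage s) c := by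
        intro c
        rw [← mem_morseComplex_cells]
        change c ∈ (stageComplex k m M.stage (s + 1)).cells
        rw [hcells]
        exact Finset.mem_univ _
      have hdeg : (stageComplex k m M.stage s).deg {i} =
          (stageComplex k m M.stage s).deg ∅ + 1 := by
        rw [stageComplex_deg]; simp
      -- The path sum therefore contains just the paths with no edge and with one edge.
      have hX : Fintype.card (Finset (Fin l)) = 2 := by
        rw [Fintype.card_finset, Fintype.card_fin, hl, pow_one]
      have hedge : (stageComplex k m M.stage s).Edge {i} ∅ :=
        ⟨(hmem _).1, (hmem _).1, hdeg, by rw [h₂]; exact one_ne_zero⟩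
      rw [stageComplex, morseComplex]
      simp only
      rw [if_pos ⟨hmem _, hmem _, hdeg⟩, pathSum, hX, Finset.sum_range_succ,
        Finset.sum_range_one, pow_zero, pow_one, Matrix.add_apply, Matrix.one_apply,
        if_neg (by simp), zero_add, morseWeight, hempty s hs, if_neg (by simp),
        if_pos ⟨by simp, hedge⟩, h₂]
  obtain ⟨h₁, h₂⟩ := hstage M.len le_rfl
  refine M.minimal {i} ∅ ⟨?_, ?_, ?_, ?_⟩ ?_
  · rw [h₁]; exact Finset.mem_univ _
  · rw [h₁]; exact Finset.mem_univ _
  · rw [stageComplex_deg]; simp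
  · rw [h₂]; exact one_ne_zero
  · simp only [lcmExp, Finset.sup_singleton, hi, Finset.sup_empty]
    rfl

/-- A class of L is coprime to its complement, so class and complement are both unmatched; split off
a proper class and induct. -/
theorem StandardMatching.exists_factorization (M : StandardMatching k m) {L : Finset (Fin l)}
    (hL : L ∈ M.critical) : ∃ Ls : List M.Gen, IsFactorization M L Ls := by
  induction L using Finset.strongInduction with
  | H L ih =>
    by_cases h₀ : L = ∅
    · exact ⟨[], by simp [h₀, unionOf], List.Pairwise.nil⟩
    by_cases h₁ : cl m L = 1
    · exact ⟨[⟨L, hL, h₁⟩], by simp [unionOf], List.pairwise_singleton _ _⟩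
    obtain ⟨i, hi, hiL⟩ : ∃ i ∈ L, eqvClass m L i ≠ L := by
      by_contra! hc
      refine h₁ (Finset.card_eq_one.2 ⟨L, ?_⟩)
      obtain ⟨j, hj⟩ := Finset.nonempty_iff_ne_empty.2 h₀
      ext I
      rw [Finset.mem_image, Finset.mem_singleton]
      constructor
      · rintro ⟨a, ha, rfl⟩
        exact hc a ha
      · rintro rfl
        exact ⟨j, hj, hc j hj⟩
    have hA := eqvClass_subset (m := m) L i
    have hunion : eqvClass m L i ∪ (L \ eqvClass m L i) = L := Finset.union_sdiff_of_subset hA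
    have hco := coprime_eqvClass_sdiff (m := m) L i
    have hAc : eqvClass m L i ∈ M.critical :=
      M.mem_critical_of_union hco.symm (by rwa [Finset.union_comm, hunion])
    have hBc : L \ eqvClass m L i ∈ M.critical :=
      M.mem_critical_of_union hco (by rwa [hunion])
    have hB : L \ eqvClass m L i ⊂ L :=
      Finset.sdiff_ssubset hA ⟨i, mem_eqvClass_self hi⟩
    obtain ⟨As, hAs, hAs'⟩ := ih _ (Finset.ssubset_iff_subset_ne.2 ⟨hA, hiL⟩) hAc
    obtain ⟨Bs, hBs, hBs'⟩ := ih _ hB hBc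
    refine ⟨As ++ Bs, ?_, List.pairwise_append.2 ⟨hAs', hBs', fun a ha b hb => ?_⟩⟩
    · rw [List.map_append, unionOf_append, hAs, hBs, hunion]
    · refine hco.mono ?_ ?_
      · rw [← hAs]
        exact fun x hx => mem_unionOf.2 ⟨a.1, List.mem_map_of_mem ha, hx⟩
      · rw [← hBs]
        exact fun x hx => mem_unionOf.2 ⟨b.1, List.mem_map_of_mem hb, hx⟩

variable {M : StandardMatching k m}

theorem StandardMatching.Gen.nonempty (G : M.Gen) : G.1.Nonempty := by
  rw [Finset.nonempty_iff_ne_empty]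
  intro h
  have := G.2.2
  rw [h, cl_empty] at this
  exact zero_ne_one this

theorem IsFactorization.pairwise_disjoint (hne : ∀ i, m i ≠ 0) {L : Finset (Fin l)}
    {Ls : List M.Gen} (h : IsFactorization M L Ls) :
    (Ls.map Subtype.val).Pairwise Disjoint :=
  List.pairwise_map.2 (h.2.imp fun h => h.disjoint hne)

theorem IsFactorization.nodup (hne : ∀ i, m i ≠ 0) {L : Finset (Fin l)}
    {Ls : List M.Gen} (h : IsFactorization M L Ls) : Ls.Nodup := by
  refine h.2.imp fun {a b} hab he => ?_
  subst he
  have := hab.disjoint hne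
  rw [disjoint_self, Finset.bot_eq_empty] at this
  exact a.nonempty.ne_empty this

theorem IsFactorization.subset {L : Finset (Fin l)} {Ls : List M.Gen}
    (h : IsFactorization M L Ls) {G : M.Gen} (hG : G ∈ Ls) : G.1 ⊆ L := by
  rw [← h.1]
  exact fun x hx => mem_unionOf.2 ⟨G.1, List.mem_map_of_mem hG, hx⟩

theorem IsFactorization.eqvClass_eq {L : Finset (Fin l)} {Ls : List M.Gen}
    (h : IsFactorization M L Ls) {G : M.Gen} (hG : G ∈ Ls) {i : Fin l} (hi : i ∈ G.1) :
    eqvClass m L i = G.1 := by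
  refine eqvClass_eq_of_cl_eq_one G.2.2 (h.subset hG) ?_ hi
  rw [coprime_iff]
  intro a ha b hb
  rw [Finset.mem_sdiff, ← h.1] at hb
  obtain ⟨_, hG', hbG'⟩ := mem_unionOf.1 hb.1
  obtain ⟨G', hG'', rfl⟩ := List.mem_map.1 hG'
  have hne : G ≠ G' := fun he => hb.2 (he ▸ hbG')
  have : Std.Symm fun I J : M.Gen => Coprime m I.1 J.1 := ⟨fun _ _ h => h.symm⟩
  exact coprime_iff.1 (h.2.forall hG hG'' hne) a ha b hbG'

theorem IsFactorization.mem_iff {L : Finset (Fin l)} {Ls : List M.Gen}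
    (h : IsFactorization M L Ls) {G : M.Gen} : G ∈ Ls ↔ ∃ i ∈ L, eqvClass m L i = G.1 := by
  constructor
  · intro hG
    obtain ⟨i, hi⟩ := G.nonempty
    exact ⟨i, h.subset hG hi, h.eqvClass_eq hG hi⟩
  · rintro ⟨i, hi, he⟩
    rw [← h.1] at hi
    obtain ⟨_, hG', hiG'⟩ := mem_unionOf.1 hi
    obtain ⟨G', hG'', rfl⟩ := List.mem_map.1 hG'
    have := h.eqvClass_eq hG'' hiG'
    rwa [← Subtype.ext (this.symm.trans he)]

/-- The members of a factorization are the equivalence classes of L, without repetition. -/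
theorem IsFactorization.perm (hne : ∀ i, m i ≠ 0) {L : Finset (Fin l)} {Ls Ls' : List M.Gen}
    (h : IsFactorization M L Ls) (h' : IsFactorization M L Ls') : Ls.Perm Ls' :=
  (List.perm_ext_iff_of_nodup (h.nodup hne) (h'.nodup hne)).2 fun G => by
    rw [h.mem_iff, h'.mem_iff]

theorem IsFactorization.append {I J : Finset (Fin l)} {Is Js : List M.Gen}
    (hI : IsFactorization M I Is) (hJ : IsFactorization M J Js) (hco : Coprime m I J) :
    IsFactorization M (I ∪ J) (Is ++ Js) := by
  refine ⟨by rw [List.map_append, unionOf_append, hI.1, hJ.1],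
    List.pairwise_append.2 ⟨hI.2, hJ.2, fun a ha b hb => ?_⟩⟩
  exact hco.mono (hI.subset ha) (hJ.subset hb)

theorem IsFactorization.of_cons {L : Finset (Fin l)} {G : M.Gen} {Ls : List M.Gen}
    (h : IsFactorization M L (G :: Ls)) :
    IsFactorization M (unionOf (Ls.map Subtype.val)) Ls ∧
      L = G.1 ∪ unionOf (Ls.map Subtype.val) ∧
      Coprime m G.1 (unionOf (Ls.map Subtype.val)) := by
  refine ⟨⟨rfl, (List.pairwise_cons.1 h.2).2⟩, h.1.symm, coprime_unionOf ?_⟩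
  intro J hJ
  obtain ⟨G', hG', rfl⟩ := List.mem_map.1 hJ
  exact (List.pairwise_cons.1 h.2).1 G' hG'

end StandardMatchings

end MonomialKoszul

end
noncomputable section

open scoped BigOperators

namespace MonomialKoszul

set_option linter.unusedSectionVars false

/-! ### Morse complexes under base change of coefficients. -/

section BaseChange

variable {R Q X : Type*} [CommRing R] [CommRing Q]

/-- The based complex obtained by base change along a ring homomorphism. -/
def BasedComplex.map (f : R →+* Q) (C : BasedComplex R X) : BasedComplex Q X where
  cells := C.cells
  deg := C.deg
  d := fun a b => f (C.d a b)

variable {f : R →+* Q} {C : BasedComplex R X} {M : Finset (X × X)}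

theorem BasedComplex.Edge.of_map {a b : X} (h : (C.map f).Edge a b) : C.Edge a b :=
  ⟨h.1, h.2.1, h.2.2.1, fun h' => h.2.2.2 (by
    change f (C.d a b) = 0
    rw [h', map_zero])⟩

variable [Fintype X] [DecidableEq X]

theorem IsSupported.map (h : IsSupported C) : IsSupported (C.map f) := fun a b hab => by
  have := h a b fun h' => hab (by
    change f (C.d a b) = 0
    rw [h', map_zero])
  exact ⟨this.1, this.2.1, this.2.2.1, hab⟩

theorem IsAcyclicMatching.map [Nontrivial Q] (h : IsAcyclicMatching C M) :
    IsAcyclicMatching (C.map f) M where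
  edge e he := ⟨(h.edge e he).1, (h.edge e he).2.1, (h.edge e he).2.2.1,
    ((h.isUnit e he).map f).ne_zero⟩
  matching := h.matching
  isUnit e he := (h.isUnit e he).map f
  acyclic c hc := h.acyclic c (Relation.TransGen.mono (fun _ _ hab => hab.imp_left fun h' => ⟨h'.1.of_map, h'.2⟩) _ _ hc)

theorem map_morseWeight (h : ∀ e ∈ M, IsUnit (C.d e.1 e.2)) (a b : X) :
    f (morseWeight C M a b) = morseWeight (C.map f) M a b := by
  unfold morseWeight
  split_ifs with h₁ h₂ h₃ h₃
  · obtain ⟨u, hu⟩ := h _ h₁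
    have hu' : (C.map f).d b a = Units.map (f : R →* Q) u := congrArg f hu.symm
    rw [map_neg, hu', ← hu, Ring.inverse_unit, Ring.inverse_unit]
    rfl
  · rfl
  · by_contra hne
    exact h₃ ⟨h₂.1, h₂.2.1, h₂.2.2.1, h₂.2.2.2.1, hne⟩
  · exact absurd ⟨h₃.1, h₃.2.of_map⟩ h₂
  · exact map_zero f

theorem map_pathSum (h : ∀ e ∈ M, IsUnit (C.d e.1 e.2)) (a b : X) :
    f (pathSum C M a b) = pathSum (C.map f) M a b := by
  have hω : f.mapMatrix (morseWeight C M) = morseWeight (C.map f) M := by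
    ext a b
    exact map_morseWeight h a b
  rw [pathSum, pathSum, ← hω]
  simp only [← map_pow, ← map_sum]
  rfl

/-- Only units are inverted in the path weights, and ring homomorphisms preserve their inverses.
Edges whose coefficient becomes zero contribute zero to either side. This allows reduction modulo
the variables before each Morse step. -/
theorem morseComplex_map (h : ∀ e ∈ M, IsUnit (C.d e.1 e.2)) :
    morseComplex (C.map f) M = (morseComplex C M).map f := by
  simp only [morseComplex, BasedComplex.map, BasedComplex.mk.injEq, true_and]
  ext a b
  rw [apply_ite f, map_zero]
  congr 1
  exact (map_pathSum h a b).symm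

end BaseChange

/-! ### The matched stages as quotients of the tensor product with acyclic ideals as kernels. -/

section Models

variable {k : Type*} [Field k] {n l : ℕ} {m : Fin l → Fin n →₀ ℕ}

/-- `q` maps the tensor product of the Taylor resolution and the Koszul complex onto the
complex `C`, with an acyclic ideal as kernel. -/
structure IsModel (m : Fin l → Fin n →₀ ℕ) (C : BasedComplex k (Finset (Fin l)))
    (q : Cone k n (l + n) →ₗ[k] (Finset (Fin l) → k)) : Prop where
  supported : IsSupported C
  deg_eq : C.deg = Finset.card
  d_mul_d : C.matrix * C.matrix = 0
  graded : ∀ a b, C.d a b ≠ 0 → lcmExp m a = lcmExp m b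
  map_d : ∀ w ∈ monSpan k (TotCond m), q (coneD w) = Matrix.vecMul (q w) C.matrix
  map_cell : ∀ I ∈ C.cells, q (taylorCell m k I) = Pi.single I 1
  map_mem : ∀ w, q w ∈ suppOn k (· ∈ C.cells)
  map_mul : ∀ w ∈ monSpan k (TotCond m), ∀ y ∈ monSpan k (TotCond m), q w = 0 →
    q (w * y) = 0 ∧ q (y * w) = 0
  acyclic : ∀ z ∈ monSpan k (TotCond m), coneD z = 0 → q z = 0 →
    ∃ y ∈ monSpan k (TotCond m), coneD y = z ∧ q y = 0
  of_taylorProj : ∀ w ∈ monSpan k (TotCond m), taylorProj m w = 0 → q w = 0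
  map_coneProj : ∀ w p a I, q (coneProj p a w) I =
    if I.card = p ∧ lcmExp m I = a then q w I else 0

theorem taylor_isSupported : IsSupported (taylor k m) := by
  intro I J h
  refine ⟨Finset.mem_univ _, Finset.mem_univ _, ?_, h⟩
  obtain ⟨i, hi, hJ⟩ := Finset.exists_ne_zero_of_sum_ne_zero h
  rw [ne_eq, ite_eq_right_iff, Classical.not_imp] at hJ
  change I.card = J.card + 1
  rw [hJ.1, Finset.card_erase_add_one hi]

/-- The quotient of a based complex by `x_1, …, x_n`. -/
abbrev residueComplex {X : Type*} (C : BasedComplex (MvPolynomial (Fin n) k) X) :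
    BasedComplex k X :=
  C.map MvPolynomial.constantCoeff

theorem mul_mem_totCond {x y : Cone k n (l + n)} (hx : x ∈ monSpan k (TotCond m))
    (hy : y ∈ monSpan k (TotCond m)) : x * y ∈ monSpan k (TotCond m) :=
  mul_mem_monSpan (fun _ _ _ _ h₁ h₂ hd => h₁.mul h₂ hd) hx hy

theorem coneD_mem_totCond {x : Cone k n (l + n)} (hx : x ∈ monSpan k (TotCond m)) :
    coneD x ∈ monSpan k (TotCond m) :=
  coneD_mem_monSpan (fun _ _ j _ h => h.erase j) hx

theorem taylorCell_empty : taylorCell m k ∅ = 1 := mon_zero_empty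

theorem isModel_taylor : IsModel m (residueComplex (taylor k m)) (taylorProj m) where
  supported := taylor_isSupported.map
  deg_eq := rfl
  d_mul_d := by
    refine Matrix.ext_row fun I => ?_
    -- The square of the matrix is read off from the square of the differential above it.
    have h : taylorProj m (coneD (coneD (taylorCell m k I))) = 0 := by rw [coneD_coneD, map_zero]
    rw [taylorProj_coneD (coneD_mem_totCond (taylorCell_mem I)),
      taylorProj_coneD (taylorCell_mem I), taylorProj_taylorCell,
      Matrix.single_one_vecMul] at h
    exact h
  graded I J h := by
    have h' : taylorMatrix k m I J ≠ 0 := h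
    rw [taylorMatrix_eq, Finset.sum_apply] at h'
    obtain ⟨i, -, hi⟩ := Finset.exists_ne_zero_of_sum_ne_zero h'
    split_ifs at hi with he
    · rw [Pi.smul_apply, Pi.single_apply] at hi
      split_ifs at hi with hJ
      · rw [he, hJ]
      · exact absurd (smul_zero _) hi
    · exact absurd rfl hi
  map_d w hw := taylorProj_coneD hw
  map_cell I _ := taylorProj_taylorCell I
  map_mem w I hI := absurd (Finset.mem_univ I) hI
  map_mul w hw y hy h := taylorProj_mul_eq_zero hw hy h
  acyclic z hz hD h := taylorProj_acyclic hz hD h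
  of_taylorProj w _ h := h
  map_coneProj w p a I := taylorProj_coneProj w p a I

/-- The linear combination of the Taylor basis with given coefficients. -/
def taylorSum (m : Fin l → Fin n →₀ ℕ) (f : Finset (Fin l) → k) : Cone k n (l + n) :=
  ∑ I, f I • taylorCell m k I

theorem taylorSum_mem (f : Finset (Fin l) → k) : taylorSum m f ∈ monSpan k (TotCond m) :=
  Submodule.sum_mem _ fun I _ => Submodule.smul_mem _ _ (taylorCell_mem I)

variable {C : BasedComplex k (Finset (Fin l))}
  {q : Cone k n (l + n) →ₗ[k] (Finset (Fin l) → k)} {N : Finset (Finset (Fin l) × Finset (Fin l))}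

theorem IsModel.map_taylorSum (hq : IsModel m C q) {f : Finset (Fin l) → k}
    (hf : f ∈ suppOn k (· ∈ C.cells)) : q (taylorSum m f) = f := by
  rw [taylorSum, map_sum]
  have : f = ∑ I, f I • Pi.single I (1 : k) := by
    ext J
    simp [Pi.single_apply]
  conv_rhs => rw [this]
  refine Finset.sum_congr rfl fun I _ => ?_
  rw [map_smul]
  by_cases hI : I ∈ C.cells
  · rw [hq.map_cell I hI]
  · rw [hf I hI, zero_smul, zero_smul]

theorem IsAcyclicMatching.upper_mem (hN : IsAcyclicMatching C N) {u : Finset (Fin l)}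
    (hu : IsUpper N u) : u ∈ C.cells := by
  obtain ⟨v, hv⟩ := hu
  exact (hN.edge _ hv).1

theorem suppOn_mono {X : Type*} {s t : X → Prop} (h : ∀ x, s x → t x) {f : X → k}
    (hf : f ∈ suppOn k s) : f ∈ suppOn k t := fun x hx => hf x fun hs => hx (h x hs)

/-- The projection onto the Morse complex of a model. -/
def modelStep (C : BasedComplex k (Finset (Fin l)))
    (N : Finset (Finset (Fin l) × Finset (Fin l)))
    (q : Cone k n (l + n) →ₗ[k] (Finset (Fin l) → k)) :
    Cone k n (l + n) →ₗ[k] (Finset (Fin l) → k) :=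
  (morseProj C N).vecMulLinear ∘ₗ q

theorem modelStep_apply (w : Cone k n (l + n)) :
    modelStep C N q w = Matrix.vecMul (q w) (morseProj C N) := rfl

theorem modelStep_eq_zero {w : Cone k n (l + n)} (h : q w = 0) : modelStep C N q w = 0 := by
  rw [modelStep_apply, h, Matrix.zero_vecMul]

theorem IsModel.map_d_modelStep (hq : IsModel m C q) (hN : IsAcyclicMatching C N)
    {w : Cone k n (l + n)} (hw : w ∈ monSpan k (TotCond m)) :
    modelStep C N q (coneD w) =
      Matrix.vecMul (modelStep C N q w) (morseComplex C N).matrix := by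
  rw [modelStep_apply, modelStep_apply, hq.map_d w hw, Matrix.vecMul_vecMul,
    hN.mul_morseProj hq.supported hq.d_mul_d, Matrix.vecMul_vecMul]

theorem IsModel.modelStep_upper (hq : IsModel m C q) (hN : IsAcyclicMatching C N)
    {u : Finset (Fin l)} (hu : IsUpper N u) : modelStep C N q (taylorCell m k u) = 0 := by
  rw [modelStep_apply, hq.map_cell u (hN.upper_mem hu), Matrix.single_one_vecMul,
    hN.morseProj_upper hu]

/-- A matching is generated by `B` if it consists of the edges `I ∪ K → J ∪ K` with `I → J` in
`B` and `K` coprime to `I`. -/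
def IsGeneratedBy (m : Fin l → Fin n →₀ ℕ) (C : BasedComplex k (Finset (Fin l)))
    (N B : Finset (Finset (Fin l) × Finset (Fin l))) : Prop :=
  ∀ e, e ∈ N ↔ e ∈ B ∨ ∃ b ∈ B, ∃ K ∈ C.cells, Coprime m b.1 K ∧ e = (b.1 ∪ K, b.2 ∪ K)

/-- Modulo the kernel of `q`, which is an ideal, y is a combination of cells I. If I is coprime to
`b.1`, condition 5 makes `b.1 ∪ I` an upper cell, which the projection kills; otherwise the product
is already zero in T ⊗ k. -/
theorem IsModel.modelStep_base_mul (hq : IsModel m C q) (hN : IsAcyclicMatching C N)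
    (hne : ∀ i, m i ≠ 0) {B : Finset (Finset (Fin l) × Finset (Fin l))}
    (hB : IsGeneratedBy m C N B) {b : Finset (Fin l) × Finset (Fin l)} (hb : b ∈ B)
    {y : Cone k n (l + n)} (hy : y ∈ monSpan k (TotCond m)) :
    modelStep C N q (taylorCell m k b.1 * y) = 0 ∧
      modelStep C N q (y * taylorCell m k b.1) = 0 := by
  have hcell : ∀ I ∈ C.cells, modelStep C N q (taylorCell m k b.1 * taylorCell m k I) = 0 ∧
      modelStep C N q (taylorCell m k I * taylorCell m k b.1) = 0 := by
    intro I hI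
    by_cases hco : Coprime m b.1 I
    · have hup : IsUpper N (b.1 ∪ I) := ⟨b.2 ∪ I, (hB _).2 (Or.inr ⟨b, hb, I, hI, hco, rfl⟩)⟩
      rw [taylorCell_mul_of_coprime (hco.disjoint hne) hco,
        taylorCell_mul_of_coprime (hco.symm.disjoint hne) hco.symm, Finset.union_comm I, map_smul,
        map_smul, hq.modelStep_upper hN hup, smul_zero, smul_zero]
      exact ⟨rfl, rfl⟩
    · exact ⟨modelStep_eq_zero (hq.of_taylorProj _
          (mul_mem_totCond (taylorCell_mem _) (taylorCell_mem _)) (taylorProj_taylorCell_mul hco)),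
        modelStep_eq_zero (hq.of_taylorProj _
          (mul_mem_totCond (taylorCell_mem _) (taylorCell_mem _))
          (taylorProj_taylorCell_mul fun h => hco h.symm))⟩
  have hy₀ : q (y - taylorSum m (q y)) = 0 := by
    rw [map_sub, hq.map_taylorSum (hq.map_mem y), sub_self]
  have hmem : y - taylorSum m (q y) ∈ monSpan k (TotCond m) :=
    Submodule.sub_mem _ hy (taylorSum_mem _)
  have h₁ := hq.map_mul _ hmem _ (taylorCell_mem b.1) hy₀
  have h₂ : modelStep C N q (taylorCell m k b.1 * taylorSum m (q y)) = 0 ∧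
      modelStep C N q (taylorSum m (q y) * taylorCell m k b.1) = 0 := by
    rw [taylorSum, Finset.mul_sum, Finset.sum_mul, map_sum, map_sum]
    constructor <;>
    · refine Finset.sum_eq_zero fun I _ => ?_
      simp only [mul_smul_comm, smul_mul_assoc, map_smul]
      by_cases hI : I ∈ C.cells
      · simp only [hcell I hI, smul_zero]
      · rw [hq.map_mem y I hI, zero_smul]
  have h₃ := modelStep_eq_zero (C := C) (N := N) h₁.1
  have h₄ := modelStep_eq_zero (C := C) (N := N) h₁.2
  rw [sub_mul, map_sub, h₂.2, sub_zero] at h₃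
  rw [mul_sub, map_sub, h₂.1, sub_zero] at h₄
  exact ⟨h₄, h₃⟩

/-- An upper cell is a base cell or, up to sign, the product of a base cell with a coprime one, so
the base case applies by associativity. -/
theorem IsModel.modelStep_upper_mul (hq : IsModel m C q) (hN : IsAcyclicMatching C N)
    (hne : ∀ i, m i ≠ 0) {B : Finset (Finset (Fin l) × Finset (Fin l))}
    (hB : IsGeneratedBy m C N B) {u : Finset (Fin l)} (hu : IsUpper N u)
    {y : Cone k n (l + n)} (hy : y ∈ monSpan k (TotCond m)) :
    modelStep C N q (taylorCell m k u * y) = 0 ∧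
      modelStep C N q (y * taylorCell m k u) = 0 := by
  obtain ⟨v, huv⟩ := hu
  rcases (hB _).1 huv with hb | ⟨b, hb, K, -, hco, he⟩
  · exact hq.modelStep_base_mul hN hne hB hb hy
  · rw [Prod.mk.injEq] at he
    have hsign : ∀ I J : Finset (Fin l), Coprime m I J → taylorCell m k (I ∪ J) =
        shuffleSign k I J • (taylorCell m k I * taylorCell m k J) := by
      intro I J h
      rw [taylorCell_mul_of_coprime (h.disjoint hne) h, smul_smul, shuffleSign_mul_self, one_smul]
    constructor
    · rw [he.1, hsign _ _ hco, smul_mul_assoc, mul_assoc, map_smul,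
        (hq.modelStep_base_mul hN hne hB hb (mul_mem_totCond (taylorCell_mem K) hy)).1, smul_zero]
    · rw [he.1, Finset.union_comm, hsign _ _ hco.symm, mul_smul_comm, ← mul_assoc, map_smul,
        (hq.modelStep_base_mul hN hne hB hb (mul_mem_totCond hy (taylorCell_mem K))).2, smul_zero]

theorem involute_taylorCell (I : Finset (Fin l)) :
    CliffordAlgebra.involute (taylorCell m k I) = (-1 : k) ^ I.card • taylorCell m k I := by
  rw [taylorCell, involute_mon, leftMap, Finset.card_map]

/-- The new kernel is the old one plus the upper cells and their boundaries, and each kind absorbs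
products. -/
theorem IsModel.modelStep_mul (hq : IsModel m C q) (hN : IsAcyclicMatching C N)
    (hne : ∀ i, m i ≠ 0) {B : Finset (Finset (Fin l) × Finset (Fin l))}
    (hB : IsGeneratedBy m C N B) {w y : Cone k n (l + n)} (hw : w ∈ monSpan k (TotCond m))
    (hy : y ∈ monSpan k (TotCond m)) (h : modelStep C N q w = 0) :
    modelStep C N q (w * y) = 0 ∧ modelStep C N q (y * w) = 0 := by
  have hD : ∀ x ∈ monSpan k (TotCond m), modelStep C N q x = 0 →
      modelStep C N q (coneD x) = 0 := fun x hx h => by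
    rw [hq.map_d_modelStep hN hx, h, Matrix.zero_vecMul]
  -- Leibniz: d(u)y is d(uy) up to a multiple of u dy. Both are killed, because the projection
  -- commutes with d. For products in the other order the involution absorbs the sign.
  have hDu : ∀ u, IsUpper N u → ∀ y ∈ monSpan k (TotCond m),
      modelStep C N q (coneD (taylorCell m k u) * y) = 0 ∧
        modelStep C N q (y * coneD (taylorCell m k u)) = 0 := by
    intro u hu y hy
    constructor
    · have h₁ := hD _ (mul_mem_totCond (taylorCell_mem u) hy)
        (hq.modelStep_upper_mul hN hne hB hu hy).1
      rw [coneD_mul, involute_taylorCell, smul_mul_assoc, map_add, map_smul,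
        (hq.modelStep_upper_mul hN hne hB hu (coneD_mem_totCond hy)).1, smul_zero, add_zero] at h₁
      exact h₁
    · have hy' := involute_mem_monSpan hy
      have h₁ := hD _ (mul_mem_totCond hy' (taylorCell_mem u))
        (hq.modelStep_upper_mul hN hne hB hu hy').2
      rw [coneD_mul, CliffordAlgebra.involute_involute, map_add,
        (hq.modelStep_upper_mul hN hne hB hu (coneD_mem_totCond hy')).2, zero_add] at h₁
      exact h₁
  obtain ⟨a, ha, b, hb, hab⟩ :=
    hN.exists_of_vecMul_morseProj_eq_zero hq.supported (hq.map_mem w) h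
  have hup : ∀ {f}, f ∈ suppOn k (IsUpper N) → f ∈ suppOn k (· ∈ C.cells) :=
    fun hf => suppOn_mono (fun _ hu => hN.upper_mem hu) hf
  -- The part of w in the old kernel, after removing lifts of the upper cells and of their
  -- boundaries.
  set w₀ := w - (taylorSum m a + coneD (taylorSum m b)) with hw₀
  have hmem₀ : w₀ ∈ monSpan k (TotCond m) := Submodule.sub_mem _ hw
    (Submodule.add_mem _ (taylorSum_mem _) (coneD_mem_totCond (taylorSum_mem _)))
  have hq₀ : q w₀ = 0 := by
    rw [hw₀, map_sub, map_add, hq.map_taylorSum (hup ha), hq.map_d _ (taylorSum_mem _),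
      hq.map_taylorSum (hup hb), hab, sub_self]
  have h₀ := hq.map_mul _ hmem₀ _ hy hq₀
  have hsum : ∀ (f : Finset (Fin l) → k), f ∈ suppOn k (IsUpper N) →
      ∀ (g : Cone k n (l + n) →ₗ[k] (Finset (Fin l) → k)),
      (∀ u, IsUpper N u → g (taylorCell m k u) = 0) → g (taylorSum m f) = 0 := by
    intro f hf g hg
    rw [taylorSum, map_sum]
    refine Finset.sum_eq_zero fun I _ => ?_
    by_cases hI : IsUpper N I
    · rw [map_smul, hg I hI, smul_zero]
    · rw [hf I hI, zero_smul, map_zero]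
  have hdecomp : w = w₀ + (taylorSum m a + coneD (taylorSum m b)) := by
    rw [hw₀, sub_add_cancel]
  rw [hdecomp, add_mul, add_mul, mul_add, mul_add, map_add, map_add, map_add, map_add,
    modelStep_eq_zero h₀.1, modelStep_eq_zero h₀.2]
  have a₁ := hsum a ha (modelStep C N q ∘ₗ LinearMap.mulRight k y)
    fun u hu => (hq.modelStep_upper_mul hN hne hB hu hy).1
  have a₂ := hsum a ha (modelStep C N q ∘ₗ LinearMap.mulLeft k y)
    fun u hu => (hq.modelStep_upper_mul hN hne hB hu hy).2
  have b₁ := hsum b hb (modelStep C N q ∘ₗ LinearMap.mulRight k y ∘ₗ coneD)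
    fun u hu => (hDu u hu y hy).1
  have b₂ := hsum b hb (modelStep C N q ∘ₗ LinearMap.mulLeft k y ∘ₗ coneD)
    fun u hu => (hDu u hu y hy).2
  simp only [LinearMap.comp_apply, LinearMap.mulRight_apply, LinearMap.mulLeft_apply] at a₁ a₂ b₁ b₂
  rw [a₁, a₂, b₁, b₂]
  simp

theorem IsModel.step (hq : IsModel m C q) (hN : IsAcyclicMatching C N)
    (hne : ∀ i, m i ≠ 0) {B : Finset (Finset (Fin l) × Finset (Fin l))}
    (hB : IsGeneratedBy m C N B) (hg : ∀ e ∈ N, lcmExp m e.1 = lcmExp m e.2) :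
    IsModel m (morseComplex C N) (modelStep C N q) where
  supported := morseComplex_isSupported
  deg_eq := hq.deg_eq
  d_mul_d := hN.morseComplex_d_mul_d hq.supported hq.d_mul_d
  graded a b h := by
    simp only [morseComplex] at h
    split_ifs at h
    · exact pathSum_ne_zero (lcmExp m) hg hq.graded h
    · exact absurd rfl h
  map_d w hw := hq.map_d_modelStep hN hw
  map_cell I hI := by
    rw [mem_morseComplex_cells] at hI
    rw [modelStep_apply, hq.map_cell I hI.1, Matrix.single_one_vecMul,
      hN.morseProj_critical hq.supported hI]
  map_mem w I hI := by
    change I ∉ _ at hI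
    rw [mem_morseComplex_cells] at hI
    rw [modelStep_apply, Matrix.vecMul_eq_sum, Finset.sum_apply]
    refine Finset.sum_eq_zero fun J _ => ?_
    by_contra h
    exact hI (morseProj_ne_zero (right_ne_zero_of_mul h)).1
  map_mul w hw y hy h := hq.modelStep_mul hN hne hB hw hy h
  -- The image of z in the old model is a cycle in the acyclic kernel of the Morse projection, hence
  -- the boundary of some b on upper cells. Subtracting the boundary of a lift of b puts z into the
  -- old kernel, which is acyclic, and the lift of b dies in the new model.
  acyclic z hz hD h := by
    have hcycle : Matrix.vecMul (q z) C.matrix = 0 := by rw [← hq.map_d z hz, hD, map_zero]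
    obtain ⟨b, hb, hbz⟩ :=
      hN.exists_of_vecMul_d_eq_zero hq.supported hq.d_mul_d (hq.map_mem z) h hcycle
    have hb' := hq.map_taylorSum (suppOn_mono (fun _ hu => hN.upper_mem hu) hb)
    obtain ⟨y, hy, hyz, hqy⟩ := hq.acyclic (z - coneD (taylorSum m b))
      (Submodule.sub_mem _ hz (coneD_mem_totCond (taylorSum_mem _)))
      (by rw [map_sub, hD, coneD_coneD, sub_zero])
      (by rw [map_sub, hq.map_d _ (taylorSum_mem _), hb', hbz, sub_self])
    refine ⟨taylorSum m b + y, Submodule.add_mem _ (taylorSum_mem _) hy, ?_, ?_⟩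
    · rw [map_add, hyz, add_sub_cancel]
    · rw [map_add, modelStep_eq_zero hqy, add_zero, modelStep_apply, hb',
        vecMul_eq_zero_of_mem_suppOn hb fun x hx => hN.morseProj_upper hx]
  of_taylorProj w hw h := modelStep_eq_zero (hq.of_taylorProj w hw h)
  map_coneProj w p a I := by
    simp only [modelStep_apply, Matrix.vecMul_eq_sum, Finset.sum_apply, Pi.smul_apply,
      hq.map_coneProj]
    -- The Morse projection preserves cardinality by its definition and multidegree because path
    -- steps do.
    have : ∀ J, morseProj C N J I ≠ 0 → J.card = I.card ∧ lcmExp m J = lcmExp m I := by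
      intro J hJ
      have h := (morseProj_ne_zero hJ).2
      rw [hq.deg_eq] at h
      unfold morseProj at hJ
      split_ifs at hJ
      · exact ⟨h, pathSum_ne_zero (lcmExp m) hg hq.graded hJ⟩
      · exact absurd rfl hJ
    split_ifs with h
    · refine Finset.sum_congr rfl fun J _ => ?_
      by_cases hJ : morseProj C N J I = 0
      · rw [hJ, smul_zero, smul_zero]
      · rw [(this J hJ).1, (this J hJ).2, if_pos h]
    · refine Finset.sum_eq_zero fun J _ => ?_
      by_cases hJ : morseProj C N J I = 0
      · rw [hJ, smul_zero]
      · rw [(this J hJ).1, (this J hJ).2, if_neg h, zero_smul]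

theorem StandardMatching.exists_isModel_stage (M : StandardMatching k m) (hne : ∀ i, m i ≠ 0)
    {s : ℕ} (hs : s ≤ M.len) :
    ∃ q : Cone k n (l + n) →ₗ[k] (Finset (Fin l) → k),
      IsModel m (residueComplex (stageComplex k m M.stage s)) q := by
  induction s with
  | zero => exact ⟨taylorProj m, isModel_taylor⟩
  | succ s ih =>
    obtain ⟨q, hq⟩ := ih (Nat.le_of_succ_le hs)
    have hN := M.acyclic s hs
    obtain ⟨B, -, hB, -⟩ := M.base s hs
    refine ⟨modelStep (residueComplex (stageComplex k m M.stage s)) (M.stage s) q, ?_⟩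
    have := hq.step hN.map hne (B := B) hB (M.graded s hs)
    rwa [residueComplex, morseComplex_map hN.isUnit] at this

/-- Modulo the variables an entry survives only between equal multidegrees, and condition 2 excludes
exactly such edges. -/
theorem StandardMatching.residue_d_eq_zero (M : StandardMatching k m)
    {q : Cone k n (l + n) →ₗ[k] (Finset (Fin l) → k)}
    (hq : IsModel m (residueComplex (stageComplex k m M.stage M.len)) q) :
    (residueComplex (stageComplex k m M.stage M.len)).matrix = 0 := by
  ext a b
  by_contra h
  exact M.minimal a b (hq.supported a b h).of_map (hq.graded a b h)

end Models

end MonomialKoszul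

end
noncomputable section

open scoped BigOperators

namespace MonomialKoszul

/-! ### Comparing Koszul cycles with elements of a model. -/

section Comparison

variable {k : Type*} [Field k] {n l : ℕ} {m : Fin l → Fin n →₀ ℕ}
  {𝔞 : Ideal (MvPolynomial (Fin n) k)} {C : BasedComplex k (Finset (Fin l))}
  {q : Cone k n (l + n) →ₗ[k] (Finset (Fin l) → k)}

/-- The correspondence between cycles of the Koszul complex and elements of a model that is
given by the cycles of the tensor product of the Taylor resolution and the Koszul complex. -/
def correspondence (𝔞 : Ideal (MvPolynomial (Fin n) k)) (m : Fin l → Fin n →₀ ℕ)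
    (q : Cone k n (l + n) →ₗ[k] (Finset (Fin l) → k)) :
    Submodule k (Koszul (MvPolynomial (Fin n) k ⧸ 𝔞) n × (Finset (Fin l) → k)) :=
  (monSpan k (TotCond m) ⊓ LinearMap.ker coneD).map ((koszulProj 𝔞 l).prod q)

theorem mem_correspondence {z : Koszul (MvPolynomial (Fin n) k ⧸ 𝔞) n}
    {f : Finset (Fin l) → k} : (z, f) ∈ correspondence 𝔞 m q ↔
      ∃ w ∈ monSpan k (TotCond m), coneD w = 0 ∧ koszulProj 𝔞 l w = z ∧ q w = f := by
  simp only [correspondence, Submodule.mem_map, Submodule.mem_inf, LinearMap.mem_ker,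
    LinearMap.prod_apply, Function.prod, Prod.mk.injEq, and_assoc]

/-- Lift z to w in T ⊗ K. The boundary of w lies in the acyclic kernel over K^A, so w can be
corrected there to a cycle with the same image z. -/
theorem IsMinGen.exists_correspondence (hm : IsMinGen 𝔞 m)
    {z : Koszul (MvPolynomial (Fin n) k ⧸ 𝔞) n} (hz : koszulD (vars 𝔞) z = 0) :
    ∃ f, (z, f) ∈ correspondence 𝔞 m q := by
  obtain ⟨w, hw, rfl⟩ := exists_koszulProj_eq m z
  rw [← hm.koszulProj_coneD hw] at hz
  obtain ⟨y, hy, hyw⟩ := hm.koszulProj_acyclic (coneD_mem_totCond hw) (coneD_coneD w) hz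
  refine ⟨q (w - y), mem_correspondence.2 ⟨w - y,
    Submodule.sub_mem _ hw (monSpan_mono (fun _ _ h => h.1) hy), ?_, ?_, rfl⟩⟩
  · rw [map_sub, hyw, sub_self]
  · rw [map_sub, hm.koszulProj_eq_zero hy, sub_zero]

theorem IsMinGen.koszulD_eq_zero (hm : IsMinGen 𝔞 m)
    {z : Koszul (MvPolynomial (Fin n) k ⧸ 𝔞) n} {f : Finset (Fin l) → k}
    (h : (z, f) ∈ correspondence 𝔞 m q) : koszulD (vars 𝔞) z = 0 := by
  obtain ⟨w, hw, hD, rfl, -⟩ := mem_correspondence.1 h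
  rw [← hm.koszulProj_coneD hw, hD, map_zero]

theorem IsModel.mem_suppOn (hq : IsModel m C q) {z : Koszul (MvPolynomial (Fin n) k ⧸ 𝔞) n}
    {f : Finset (Fin l) → k} (h : (z, f) ∈ correspondence 𝔞 m q) :
    f ∈ suppOn k (· ∈ C.cells) := by
  obtain ⟨w, -, -, -, rfl⟩ := mem_correspondence.1 h
  exact hq.map_mem w

/-- If z is a boundary, w differs from a boundary by a cycle in the acyclic kernel over K^A, so w is
a boundary and its image in the model, whose differential is zero, vanishes. Conversely a cycle over
0 lies in the acyclic kernel of `q`. -/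
theorem IsModel.exists_koszulD_eq_iff (hq : IsModel m C q) (hd : C.matrix = 0)
    (hm : IsMinGen 𝔞 m) {z : Koszul (MvPolynomial (Fin n) k ⧸ 𝔞) n} {f : Finset (Fin l) → k}
    (h : (z, f) ∈ correspondence 𝔞 m q) : (∃ c, koszulD (vars 𝔞) c = z) ↔ f = 0 := by
  obtain ⟨w, hw, hD, rfl, rfl⟩ := mem_correspondence.1 h
  constructor
  · rintro ⟨c, hc⟩
    obtain ⟨y, hy, rfl⟩ := exists_koszulProj_eq m c
    obtain ⟨y', hy', hyy⟩ := hm.koszulProj_acyclic (Submodule.sub_mem _ hw (coneD_mem_totCond hy))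
      (by rw [map_sub, hD, coneD_coneD, sub_zero])
      (by rw [map_sub, hm.koszulProj_coneD hy, hc, sub_self])
    have hw' : w = coneD (y + y') := by rw [map_add, hyy, add_sub_cancel]
    rw [hw', hq.map_d _ (Submodule.add_mem _ hy (monSpan_mono (fun _ _ h => h.1) hy')), hd,
      Matrix.vecMul_zero]
  · intro h₀
    obtain ⟨y, hy, hyw, -⟩ := hq.acyclic w hw hD h₀
    exact ⟨koszulProj 𝔞 l y, by rw [← hm.koszulProj_coneD hy, hyw]⟩

theorem IsModel.correspondence_unique (hq : IsModel m C q) (hd : C.matrix = 0)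
    (hm : IsMinGen 𝔞 m) {z : Koszul (MvPolynomial (Fin n) k ⧸ 𝔞) n} {f f' : Finset (Fin l) → k}
    (h : (z, f) ∈ correspondence 𝔞 m q) (h' : (z, f') ∈ correspondence 𝔞 m q) : f = f' := by
  have := Submodule.sub_mem _ h h'
  rw [Prod.mk_sub_mk] at this
  exact sub_eq_zero.1 ((hq.exists_koszulD_eq_iff hd hm this).1 ⟨0, by rw [map_zero, sub_self]⟩)

theorem IsModel.correspondence_mul (hq : IsModel m C q) (hm : IsMinGen 𝔞 m)
    {z z' : Koszul (MvPolynomial (Fin n) k ⧸ 𝔞) n} {f f' : Finset (Fin l) → k}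
    (h : (z, f) ∈ correspondence 𝔞 m q) (h' : (z', f') ∈ correspondence 𝔞 m q) :
    (z * z', q (taylorSum m f * taylorSum m f')) ∈ correspondence 𝔞 m q := by
  obtain ⟨w, hw, hD, rfl, rfl⟩ := mem_correspondence.1 h
  obtain ⟨w', hw', hD', rfl, rfl⟩ := mem_correspondence.1 h'
  refine mem_correspondence.2 ⟨w * w', mul_mem_totCond hw hw', ?_, hm.koszulProj_mul hw hw', ?_⟩
  · rw [coneD_mul, hD, hD', zero_mul, mul_zero, add_zero]
  -- As the kernel of `q` is an ideal, w and w' may be replaced one after the other by the standard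
  -- lifts of their images.
  · have h₁ := (hq.map_mul (w - taylorSum m (q w)) (Submodule.sub_mem _ hw (taylorSum_mem _))
      w' hw' (by rw [map_sub, hq.map_taylorSum (hq.map_mem w), sub_self])).1
    have h₂ := (hq.map_mul (w' - taylorSum m (q w')) (Submodule.sub_mem _ hw' (taylorSum_mem _))
      _ (taylorSum_mem (q w)) (by rw [map_sub, hq.map_taylorSum (hq.map_mem w'), sub_self])).2
    rw [sub_mul, map_sub, sub_eq_zero] at h₁
    rw [mul_sub, map_sub, sub_eq_zero] at h₂
    rw [h₁, h₂]

theorem taylorSum_single (I : Finset (Fin l)) (c : k) :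
    taylorSum m (Pi.single I c) = c • taylorCell m k I := by
  rw [taylorSum, Finset.sum_eq_single I, Pi.single_eq_same]
  · intro J _ hJ
    rw [Pi.single_eq_of_ne hJ, zero_smul]
  · intro h
    exact absurd (Finset.mem_univ I) h

theorem IsModel.correspondence_mul_single (hq : IsModel m C q) (hm : IsMinGen 𝔞 m)
    (hne : ∀ i, m i ≠ 0) {z z' : Koszul (MvPolynomial (Fin n) k ⧸ 𝔞) n}
    {I J : Finset (Fin l)} {c : k} (h : (z, Pi.single I 1) ∈ correspondence 𝔞 m q)
    (h' : (z', Pi.single J c) ∈ correspondence 𝔞 m q) (hco : Coprime m I J)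
    (hIJ : I ∪ J ∈ C.cells) :
    (z * z', Pi.single (I ∪ J) (shuffleSign k I J * c)) ∈ correspondence 𝔞 m q := by
  have := hq.correspondence_mul hm h h'
  rwa [taylorSum_single, taylorSum_single, one_smul, mul_smul_comm,
    taylorCell_mul_of_coprime (hco.disjoint hne) hco, map_smul, map_smul, hq.map_cell _ hIJ,
    smul_smul, ← Pi.single_smul, smul_eq_mul, mul_one, mul_comm] at this

/-- Every product of cells that occurs vanishes already in T ⊗ k. -/
theorem IsModel.correspondence_mul_of_not_coprime (hq : IsModel m C q) (hm : IsMinGen 𝔞 m)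
    {z z' : Koszul (MvPolynomial (Fin n) k ⧸ 𝔞) n} {f f' : Finset (Fin l) → k}
    (h : (z, f) ∈ correspondence 𝔞 m q) (h' : (z', f') ∈ correspondence 𝔞 m q)
    (hf : ∀ I J, f I ≠ 0 → f' J ≠ 0 → ¬ Coprime m I J) :
    (z * z', 0) ∈ correspondence 𝔞 m q := by
  have h₀ : q (taylorSum m f * taylorSum m f') = 0 := by
    rw [taylorSum, taylorSum, Finset.sum_mul_sum, map_sum]
    refine Finset.sum_eq_zero fun I _ => ?_
    rw [map_sum]
    refine Finset.sum_eq_zero fun J _ => ?_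
    rw [smul_mul_smul_comm, map_smul]
    by_cases hI : f I = 0
    · rw [hI, zero_mul, zero_smul]
    by_cases hJ : f' J = 0
    · rw [hJ, mul_zero, zero_smul]
    rw [hq.of_taylorProj _ (mul_mem_totCond (taylorCell_mem _) (taylorCell_mem _))
      (taylorProj_taylorCell_mul (hf I J hI hJ)), smul_zero]
  rw [← h₀]
  exact hq.correspondence_mul hm h h'

theorem coneD_coneProj_eq_zero {N : ℕ} {w : Cone k n N} (h : coneD w = 0) (p : ℕ)
    (a : Fin n →₀ ℕ) : coneD (coneProj p a w) = 0 := by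
  cases p with
  | succ p => rw [← coneProj_coneD, h, map_zero]
  -- In degree zero there are no letters left, so the differential vanishes.
  | zero =>
    refine LinearMap.congr_fun (cone_ext (f := coneD ∘ₗ coneProj 0 a) (g := 0) fun α P => ?_) w
    rw [LinearMap.comp_apply, coneProj_mon, LinearMap.zero_apply]
    split_ifs with hP
    · rw [Finset.card_eq_zero.1 hP.1, coneD_mon, Finset.sum_empty]
    · exact map_zero _

/-- The difference of w and a homogeneous lift of z lies in the kernel over K^A, which is spanned by
monomials and so stable under projection to a degree. Hence the homogeneous part of w is again a
cycle over z, and uniqueness identifies f with its homogeneous part. -/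
theorem IsModel.correspondence_homogeneous (hq : IsModel m C q) (hd : C.matrix = 0)
    (hm : IsMinGen 𝔞 m) {z : Koszul (MvPolynomial (Fin n) k ⧸ 𝔞) n} {f : Finset (Fin l) → k}
    (h : (z, f) ∈ correspondence 𝔞 m q) {p : ℕ} {a : Fin n →₀ ℕ} (hz : z ∈ koszulPiece 𝔞 p a)
    {I : Finset (Fin l)} (hI : f I ≠ 0) : I.card = p ∧ lcmExp m I = a := by
  obtain ⟨w, hw, hD, hwz, hwf⟩ := mem_correspondence.1 h
  obtain ⟨w₀, hw₀, hwz₀⟩ := exists_koszulProj_eq_of_mem_piece (m := m) hz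
  have h₁ := hm.mem_koszulCond_of_koszulProj_eq_zero
    (Submodule.sub_mem _ hw (monSpan_mono (fun _ _ h => h.1) hw₀))
    (by rw [map_sub, hwz, hwz₀, sub_self])
  have h₂ := hm.koszulProj_eq_zero
    (monSpan_mono (fun _ _ h => h.1) (coneProj_mem_monSpan p a h₁))
  rw [map_sub, coneProj_of_mem_monSpan hw₀, map_sub, hwz₀, sub_eq_zero] at h₂
  have h₃ : (z, q (coneProj p a w)) ∈ correspondence 𝔞 m q :=
    mem_correspondence.2 ⟨_, monSpan_mono (fun _ _ h => h.1) (coneProj_mem_monSpan p a hw),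
      coneD_coneProj_eq_zero hD p a, h₂, rfl⟩
  rw [hq.correspondence_unique hd hm h h₃, hq.map_coneProj] at hI
  by_contra hne
  exact hI (if_neg hne)

/-- As the model has zero differential, the boundary of the Taylor cell lies in the acyclic kernel
of `q`. So the cell can be corrected to a cycle with the same image, of which the homogeneous part
is taken. -/
theorem IsModel.exists_homogeneous_cycle (hq : IsModel m C q) (hd : C.matrix = 0)
    {I : Finset (Fin l)} (hI : I ∈ C.cells) :
    ∃ z ∈ koszulPiece 𝔞 I.card (lcmExp m I), (z, Pi.single I 1) ∈ correspondence 𝔞 m q := by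
  obtain ⟨y, hy, hyI, hqy⟩ := hq.acyclic (coneD (taylorCell m k I))
    (coneD_mem_totCond (taylorCell_mem I)) (coneD_coneD _)
    (by rw [hq.map_d _ (taylorCell_mem I), hd, Matrix.vecMul_zero])
  have hw : taylorCell m k I - y ∈ monSpan k (TotCond m) :=
    Submodule.sub_mem _ (taylorCell_mem I) hy
  have hw' := coneProj_mem_monSpan I.card (lcmExp m I) hw
  refine ⟨_, koszulProj_mem_piece hw', mem_correspondence.2
    ⟨_, monSpan_mono (fun _ _ h => h.1) hw',
      coneD_coneProj_eq_zero (by rw [map_sub, hyI, sub_self]) _ _, rfl, ?_⟩⟩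
  ext J
  rw [hq.map_coneProj, map_sub, hqy, sub_zero, hq.map_cell I hI]
  by_cases hJ : J = I
  · rw [if_pos ⟨by rw [hJ], by rw [hJ]⟩]
  · rw [Pi.single_eq_of_ne hJ, ite_self]

end Comparison

/-! ### Graded commutativity and multigrading of the Koszul complex. -/

section Pieces

variable {k : Type*} [Field k] {n : ℕ} {𝔞 : Ideal (MvPolynomial (Fin n) k)}

theorem koszulTerm_mul_comm {A : Type*} [CommRing A] [Algebra k A] (a b : A)
    (I J : Finset (Fin n)) : koszulTerm a I * koszulTerm b J =
      (-1 : k) ^ (I.card * J.card) • (koszulTerm b J * koszulTerm a I) := by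
  by_cases h : Disjoint I J
  · rw [koszulTerm_mul_of_disjoint _ _ h, koszulTerm_mul_of_disjoint _ _ h.symm, smul_koszulTerm,
      Finset.union_comm, ← inversions_add_swap h, map_pow, map_neg, map_one, pow_add, mul_comm b]
    congr 1
    have : ((-1 : A) ^ inversions J I) * (-1) ^ inversions J I = 1 := by
      rw [← pow_add, Even.neg_one_pow ⟨_, rfl⟩]
    linear_combination -(-1 : A) ^ inversions I J * (a * b) * this
  · rw [koszulTerm_mul_of_not_disjoint _ _ h,
      koszulTerm_mul_of_not_disjoint _ _ fun h' => h h'.symm, smul_zero]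

theorem koszulPiece_mul_comm {p p' : ℕ} {a a' : Fin n →₀ ℕ}
    {x y : Koszul (MvPolynomial (Fin n) k ⧸ 𝔞) n} (hx : x ∈ koszulPiece 𝔞 p a)
    (hy : y ∈ koszulPiece 𝔞 p' a') : x * y = (-1 : k) ^ (p * p') • (y * x) := by
  refine Submodule.span_induction₂ (p := fun x y _ _ => x * y = (-1 : k) ^ (p * p') • (y * x))
    ?_ ?_ ?_ ?_ ?_ ?_ ?_ hx hy
  · rintro _ _ ⟨J, β, rfl, -, rfl⟩ ⟨J', β', rfl, -, rfl⟩
    exact koszulTerm_mul_comm _ _ _ _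
  · intro y _; simp
  · intro x _; simp
  · intro x y z _ _ _ h₁ h₂; rw [add_mul, mul_add, h₁, h₂, smul_add]
  · intro x y z _ _ _ h₁ h₂; rw [add_mul, mul_add, h₁, h₂, smul_add]
  · intro r x y _ _ h; rw [smul_mul_assoc, mul_smul_comm, h, smul_comm]
  · intro r x y _ _ h; rw [smul_mul_assoc, mul_smul_comm, h, smul_comm]

theorem one_mem_koszulPiece : (1 : Koszul (MvPolynomial (Fin n) k ⧸ 𝔞) n) ∈ koszulPiece 𝔞 0 0 := by
  refine Submodule.subset_span ⟨∅, 0, rfl, by simp, ?_⟩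
  have h : Ideal.Quotient.mk 𝔞 (MvPolynomial.monomial 0 (1 : k)) = 1 := map_one _
  rw [h]
  exact koszulTerm_one_empty.symm

theorem mul_mem_koszulPiece {p p' : ℕ} {a a' : Fin n →₀ ℕ}
    {x y : Koszul (MvPolynomial (Fin n) k ⧸ 𝔞) n} (hx : x ∈ koszulPiece 𝔞 p a)
    (hy : y ∈ koszulPiece 𝔞 p' a') : x * y ∈ koszulPiece 𝔞 (p + p') (a + a') := by
  refine Submodule.span_induction₂
    (p := fun x y _ _ => x * y ∈ koszulPiece 𝔞 (p + p') (a + a')) ?_ ?_ ?_ ?_ ?_ ?_ ?_ hx hy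
  · rintro _ _ ⟨J, β, rfl, rfl, rfl⟩ ⟨J', β', rfl, rfl, rfl⟩
    change koszulTerm _ J * koszulTerm _ J' ∈ _
    by_cases h : Disjoint J J'
    · rw [koszulTerm_mul_of_disjoint _ _ h, ← map_mul, MvPolynomial.monomial_mul, mul_one]
      have hs : koszulTerm ((-1) ^ inversions J J' *
          Ideal.Quotient.mk 𝔞 (MvPolynomial.monomial (β + β') (1 : k))) (J ∪ J') =
          (-1 : k) ^ inversions J J' • koszulTerm
            (Ideal.Quotient.mk 𝔞 (MvPolynomial.monomial (β + β') (1 : k))) (J ∪ J') := by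
        rw [smul_koszulTerm, map_pow, map_neg, RingHom.map_one]
      rw [hs]
      refine Submodule.smul_mem _ _ (Submodule.subset_span ⟨J ∪ J', β + β',
        Finset.card_union_of_disjoint h, ?_, rfl⟩)
      rw [Finset.sum_union h, add_add_add_comm]
    · rw [koszulTerm_mul_of_not_disjoint _ _ h]
      exact Submodule.zero_mem _
  · intro y _; rw [zero_mul]; exact Submodule.zero_mem _
  · intro x _; rw [mul_zero]; exact Submodule.zero_mem _
  · intro x y z _ _ _ h₁ h₂; rw [add_mul]; exact Submodule.add_mem _ h₁ h₂
  · intro x y z _ _ _ h₁ h₂; rw [mul_add]; exact Submodule.add_mem _ h₁ h₂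
  · intro r x y _ _ h; rw [smul_mul_assoc]; exact Submodule.smul_mem _ _ h
  · intro r x y _ _ h; rw [mul_smul_comm]; exact Submodule.smul_mem _ _ h

theorem list_prod_mem_koszulPiece {ι : Type*} (ψ : ι → Koszul (MvPolynomial (Fin n) k ⧸ 𝔞) n)
    (p : ι → ℕ) (a : ι → Fin n →₀ ℕ) (h : ∀ i, ψ i ∈ koszulPiece 𝔞 (p i) (a i)) (L : List ι) :
    (L.map ψ).prod ∈ koszulPiece 𝔞 (L.map p).sum (L.map a).sum := by
  induction L with
  | nil => exact one_mem_koszulPiece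
  | cons i t ih =>
    simp only [List.map_cons, List.prod_cons, List.sum_cons]
    exact mul_mem_koszulPiece (h i) ih

/-- In degree zero and multidegree zero the only generator is 1; this forces φ(∅) to be a scalar. -/
theorem koszulPiece_zero_le :
    koszulPiece 𝔞 0 0 ≤ Submodule.span k {(1 : Koszul (MvPolynomial (Fin n) k ⧸ 𝔞) n)} := by
  refine Submodule.span_le.2 ?_
  rintro _ ⟨J, β, hJ, hβ, rfl⟩
  rw [Finset.card_eq_zero] at hJ
  subst hJ
  rw [Finset.sum_empty, add_zero] at hβ
  subst hβ
  have h : Ideal.Quotient.mk 𝔞 (MvPolynomial.monomial 0 (1 : k)) = 1 := map_one _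
  rw [h]
  exact Submodule.subset_span koszulTerm_one_empty

end Pieces

end MonomialKoszul

end
noncomputable section

open scoped BigOperators

namespace MonomialKoszul

/-! ### A basis of the Koszul homology, and the existence of φ. -/

section Homology

variable {k : Type*} [Field k] {n l : ℕ} {m : Fin l → Fin n →₀ ℕ}
  {𝔞 : Ideal (MvPolynomial (Fin n) k)} {M : StandardMatching k m}

/-- The homology class as a homomorphism of algebras. -/
def homologyClassHom (𝔞 : Ideal (MvPolynomial (Fin n) k)) :
    cycles (vars 𝔞) →ₐ[k] KoszulHomology (vars 𝔞) :=
  { (boundaries (vars 𝔞)).ringCon.mk' with commutes' := fun _ => rfl }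

theorem homologyClassHom_apply (z : cycles (vars 𝔞)) :
    homologyClassHom 𝔞 z = homologyClass z := rfl

theorem homologyClass_surjective (h : KoszulHomology (vars 𝔞)) :
    ∃ z : cycles (vars 𝔞), homologyClassHom 𝔞 z = h :=
  (boundaries (vars 𝔞)).ringCon.mk'_surjective h

theorem homologyClassHom_eq_zero_iff {z : cycles (vars 𝔞)} :
    homologyClassHom 𝔞 z = 0 ↔ z ∈ boundaries (vars 𝔞) := by
  rw [TwoSidedIdeal.mem_iff]
  exact RingCon.eq _

theorem IsFactorization.sum_eq (hne : ∀ i, m i ≠ 0) {L : Finset (Fin l)} {Ls : List M.Gen}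
    (h : IsFactorization M L Ls) :
    (Ls.map fun G => G.1.card).sum = L.card ∧ (Ls.map fun G => lcmExp m G.1).sum = lcmExp m L := by
  induction Ls generalizing L with
  | nil =>
    obtain rfl : ∅ = L := h.1
    exact ⟨rfl, rfl⟩
  | cons G t ih =>
    obtain ⟨h₁, rfl, hco⟩ := h.of_cons
    simp only [List.map_cons, List.sum_cons, (ih h₁).1, (ih h₁).2]
    exact ⟨(Finset.card_union_of_disjoint (hco.disjoint hne)).symm,
      (lcmExp_union_eq_add_iff.2 hco).symm⟩

section Model

variable {C : BasedComplex k (Finset (Fin l))}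
  {q : Cone k n (l + n) →ₗ[k] (Finset (Fin l) → k)}

theorem IsMinGen.exists_correspondence_cycle (hm : IsMinGen 𝔞 m) (z : cycles (vars 𝔞)) :
    ∃ f, ((z : Koszul (MvPolynomial (Fin n) k ⧸ 𝔞) n), f) ∈ correspondence 𝔞 m q :=
  hm.exists_correspondence z.2

theorem IsModel.homologyClassHom_eq_zero_iff (hq : IsModel m C q) (hd : C.matrix = 0)
    (hm : IsMinGen 𝔞 m) {z : cycles (vars 𝔞)} {f : Finset (Fin l) → k}
    (h : ((z : Koszul (MvPolynomial (Fin n) k ⧸ 𝔞) n), f) ∈ correspondence 𝔞 m q) :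
    homologyClassHom 𝔞 z = 0 ↔ f = 0 := by
  rw [MonomialKoszul.homologyClassHom_eq_zero_iff, mem_boundaries]
  exact hq.exists_koszulD_eq_iff hd hm h

theorem sum_mem_correspondence {ι : Type*} [Fintype ι] {φ : ι → cycles (vars 𝔞)}
    {f : ι → Finset (Fin l) → k}
    (h : ∀ i, ((φ i : Koszul (MvPolynomial (Fin n) k ⧸ 𝔞) n), f i) ∈ correspondence 𝔞 m q)
    (c : ι → k) : (((∑ i, c i • φ i : cycles (vars 𝔞)) :
      Koszul (MvPolynomial (Fin n) k ⧸ 𝔞) n), ∑ i, c i • f i) ∈ correspondence 𝔞 m q := by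
  have h₁ := Submodule.sum_mem _ fun i (_ : i ∈ Finset.univ) =>
    Submodule.smul_mem (correspondence 𝔞 m q) (c i) (h i)
  have h₂ : ∑ i, c i • ((φ i : Koszul (MvPolynomial (Fin n) k ⧸ 𝔞) n), f i) =
      (((∑ i, c i • φ i : cycles (vars 𝔞)) : Koszul (MvPolynomial (Fin n) k ⧸ 𝔞) n),
        ∑ i, c i • f i) := by
    ext1
    · rw [Prod.fst_sum]
      simp only [Prod.smul_fst]
      rw [AddSubmonoidClass.coe_finsetSum]
      rfl
    · rw [Prod.snd_sum]
      simp only [Prod.smul_snd]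
  rwa [h₂] at h₁

/-- The cycle that corresponds to the product of the parts of a factorization. -/
theorem IsModel.prod_mem_correspondence (hq : IsModel m C q) (hm : IsMinGen 𝔞 m)
    (hne : ∀ i, m i ≠ 0) (hC : C.cells = M.critical)
    {ψ : M.Gen → cycles (vars 𝔞)}
    (hψ : ∀ G, ((ψ G : Koszul (MvPolynomial (Fin n) k ⧸ 𝔞) n), Pi.single G.1 1) ∈
      correspondence 𝔞 m q) {L : Finset (Fin l)} (hL : L ∈ M.critical) {Ls : List M.Gen}
    (h : IsFactorization M L Ls) :
    (((Ls.map ψ).prod : Koszul (MvPolynomial (Fin n) k ⧸ 𝔞) n),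
      Pi.single L (listSign k (Ls.map Subtype.val))) ∈ correspondence 𝔞 m q := by
  induction Ls generalizing L with
  | nil =>
    obtain rfl : ∅ = L := h.1
    refine mem_correspondence.2 ⟨1, ?_, ?_, koszulProj_one, ?_⟩
    · rw [← taylorCell_empty (m := m)]
      exact taylorCell_mem ∅
    · rw [← mon_zero_empty, coneD_mon, Finset.sum_empty]
    · rw [← taylorCell_empty (m := m), hq.map_cell _ (by rw [hC]; exact hL)]
      rfl
  | cons G t ih =>
    obtain ⟨h₁, rfl, hco⟩ := h.of_cons
    have := hq.correspondence_mul_single hm hne (hψ G)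
      (ih (M.mem_critical_of_union hco hL) h₁) hco (by rw [hC]; exact hL)
    rw [List.map_cons, List.prod_cons]
    exact this

theorem IsModel.linearIndependent (hq : IsModel m C q) (hd : C.matrix = 0) (hm : IsMinGen 𝔞 m)
    {φ : M.Crit → cycles (vars 𝔞)}
    (hφ : ∀ L, ((φ L : Koszul (MvPolynomial (Fin n) k ⧸ 𝔞) n), Pi.single L.1 1) ∈
      correspondence 𝔞 m q) : LinearIndependent k fun L => homologyClassHom 𝔞 (φ L) := by
  rw [Fintype.linearIndependent_iff]
  intro c hc L
  simp only [← map_smul, ← map_sum] at hc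
  have h := (hq.homologyClassHom_eq_zero_iff hd hm (sum_mem_correspondence hφ c)).1 hc
  have h' := congrFun h L.1
  rw [Finset.sum_apply, Finset.sum_eq_single L] at h'
  · simpa using h'
  · intro J _ hJ
    rw [Pi.smul_apply, Pi.single_eq_of_ne fun he => hJ (Subtype.ext he.symm), smul_zero]
  · intro h
    exact absurd (Finset.mem_univ L) h

/-- A cycle with image f differs from the combination of the φ(L) with coefficients f(L) by a cycle
with image zero, which is a boundary. -/
theorem IsModel.span_eq_top (hq : IsModel m C q) (hd : C.matrix = 0) (hm : IsMinGen 𝔞 m)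
    (hC : C.cells = M.critical) {φ : M.Crit → cycles (vars 𝔞)}
    (hφ : ∀ L, ((φ L : Koszul (MvPolynomial (Fin n) k ⧸ 𝔞) n), Pi.single L.1 1) ∈
      correspondence 𝔞 m q) :
    Submodule.span k (Set.range fun L => homologyClassHom 𝔞 (φ L)) = ⊤ := by
  rw [eq_top_iff]
  rintro h -
  obtain ⟨z, rfl⟩ := homologyClass_surjective h
  obtain ⟨f, hf⟩ := hm.exists_correspondence_cycle (q := q) z
  have hsum : ∑ L : M.Crit, f L.1 • (Pi.single L.1 (1 : k) : Finset (Fin l) → k) = f := by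
    ext J
    rw [Finset.sum_apply]
    by_cases hJ : J ∈ M.critical
    · rw [Finset.sum_eq_single ⟨J, hJ⟩]
      · simp
      · intro L _ hL
        rw [Pi.smul_apply, Pi.single_eq_of_ne fun he => hL (Subtype.ext he.symm), smul_zero]
      · intro h
        exact absurd (Finset.mem_univ _) h
    · rw [hq.mem_suppOn hf J (hC ▸ hJ)]
      refine Finset.sum_eq_zero fun L _ => ?_
      rw [Pi.smul_apply, Pi.single_eq_of_ne fun he => hJ (by rw [he]; exact L.2), smul_zero]
  have h₁ := Submodule.sub_mem _ hf (sum_mem_correspondence hφ fun L => f L.1)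
  rw [hsum, Prod.mk_sub_mk, sub_self] at h₁
  have h₂ := (hq.homologyClassHom_eq_zero_iff hd hm
    (z := z - ∑ L : M.Crit, f L.1 • φ L) h₁).2 rfl
  rw [map_sub, sub_eq_zero] at h₂
  rw [h₂, map_sum]
  refine Submodule.sum_mem _ fun L _ => ?_
  rw [map_smul]
  exact Submodule.smul_mem _ _ (Submodule.subset_span ⟨L, rfl⟩)

end Model

theorem cycles_mul_comm {ι : Type*} {φ : ι → cycles (vars 𝔞)} {p : ι → ℕ} {a : ι → Fin n →₀ ℕ}
    (h : ∀ i, (φ i : Koszul (MvPolynomial (Fin n) k ⧸ 𝔞) n) ∈ koszulPiece 𝔞 (p i) (a i))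
    (i j : ι) : φ i * φ j = (-1 : k) ^ (p i * p j) • (φ j * φ i) :=
  Subtype.ext (koszulPiece_mul_comm (h i) (h j))

theorem list_prod_coe_mem {ι : Type*} {φ : ι → cycles (vars 𝔞)} {p : ι → ℕ} {a : ι → Fin n →₀ ℕ}
    (h : ∀ i, (φ i : Koszul (MvPolynomial (Fin n) k ⧸ 𝔞) n) ∈ koszulPiece 𝔞 (p i) (a i))
    (L : List ι) : ((L.map φ).prod : Koszul (MvPolynomial (Fin n) k ⧸ 𝔞) n) ∈
      koszulPiece 𝔞 (L.map p).sum (L.map a).sum := by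
  have := list_prod_mem_koszulPiece (fun i => (φ i : Koszul (MvPolynomial (Fin n) k ⧸ 𝔞) n)) p a h L
  have e : ((L.map φ).prod : Koszul (MvPolynomial (Fin n) k ⧸ 𝔞) n) =
      (L.map fun i => (φ i : Koszul (MvPolynomial (Fin n) k ⧸ 𝔞) n)).prod := by
    have h₁ := map_list_prod (cycles (vars 𝔞)).val (L.map φ)
    rw [List.map_map] at h₁
    exact h₁
  rwa [e]

theorem StandardMatching.exists_isModel (M : StandardMatching k m) (hne : ∀ i, m i ≠ 0) :
    ∃ (C : BasedComplex k (Finset (Fin l))) (q : Cone k n (l + n) →ₗ[k] (Finset (Fin l) → k)),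
      IsModel m C q ∧ C.matrix = 0 ∧ C.cells = M.critical := by
  obtain ⟨q, hq⟩ := M.exists_isModel_stage hne le_rfl
  exact ⟨_, q, hq, M.residue_d_eq_zero hq, rfl⟩

/-- Choosing cycles for all unmatched sets independently would give multiplicativity only up to
boundaries. They are chosen for the connected sets only, and signed products define φ on the rest.
-/
theorem exists_isRepresentation (hm : IsMinGen 𝔞 m) (M : StandardMatching k m) :
    ∃ φ : M.Crit → cycles (vars 𝔞), IsRepresentation 𝔞 M φ := by
  have hne := M.exp_ne_zero hm.minimal
  obtain ⟨C, q, hq, hd, hC⟩ := M.exists_isModel hne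
  have hψ : ∀ G : M.Gen, ∃ z : cycles (vars 𝔞), (z : Koszul (MvPolynomial (Fin n) k ⧸ 𝔞) n) ∈
      koszulPiece 𝔞 G.1.card (lcmExp m G.1) ∧
      ((z : Koszul (MvPolynomial (Fin n) k ⧸ 𝔞) n), Pi.single G.1 1) ∈ correspondence 𝔞 m q := by
    intro G
    obtain ⟨z, hz, hzG⟩ := hq.exists_homogeneous_cycle (𝔞 := 𝔞) hd (I := G.1) (by rw [hC]; exact G.2.1)
    exact ⟨⟨z, hm.koszulD_eq_zero hzG⟩, hz, hzG⟩
  choose ψ hψ₁ hψ₂ using hψ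
  choose fac hfac using fun L : M.Crit => M.exists_factorization L.2
  let φ : M.Crit → cycles (vars 𝔞) := fun L =>
    listSign k ((fac L).map Subtype.val) • ((fac L).map ψ).prod
  have hφ : ∀ L, ((φ L : Koszul (MvPolynomial (Fin n) k ⧸ 𝔞) n), Pi.single L.1 1) ∈
      correspondence 𝔞 m q := by
    intro L
    have := Submodule.smul_mem _ (listSign k ((fac L).map Subtype.val))
      (hq.prod_mem_correspondence hm hne hC hψ₂ L.2 (hfac L))
    rw [Prod.smul_mk, ← Pi.single_smul, smul_eq_mul, listSign_mul_self] at this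
    exact this
  refine ⟨φ, ?_, hq.linearIndependent hd hm hφ, hq.span_eq_top hd hm hC hφ, ?_⟩
  · intro L
    have := list_prod_coe_mem hψ₁ (fac L)
    rw [((hfac L).sum_eq hne).1, ((hfac L).sum_eq hne).2] at this
    exact Submodule.smul_mem _ _ this
  · intro I J L hco hL
    -- Concatenated factorizations of I and J factor I ∪ J. They are a permutation of the chosen
    -- one, and graded commutativity compares the signed products.
    have happ := (hfac I).append (hfac J) hco
    rw [← hL] at happ
    have hdis := happ.pairwise_disjoint hne
    have h₁ := listSign_smul_prod_perm (k := k) (fun G : M.Gen => G.1) ψ (cycles_mul_comm hψ₁)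
      (happ.perm hne (hfac L)) hdis
    rw [List.map_append] at hdis
    rw [List.map_append, List.map_append, listSign_append hdis, List.prod_append] at h₁
    have hI : unionOf ((fac I).map fun G => G.1) = I.1 := (hfac I).1
    have hJ : unionOf ((fac J).map fun G => G.1) = J.1 := (hfac J).1
    rw [hI, hJ] at h₁
    change _ = shuffleSign k I.1 J.1 • (listSign k ((fac L).map fun G => G.1) • _)
    rw [← h₁, smul_smul, mul_left_comm, shuffleSign_mul_self, mul_one]
    exact smul_mul_smul_comm _ _ _ _

end Homology

end MonomialKoszul

end
noncomputable section

open scoped BigOperators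

namespace MonomialKoszul

/-! ### The presentation of the Koszul homology by R'. -/

section Presentation

variable {k : Type*} [Field k] {n l : ℕ} {m : Fin l → Fin n →₀ ℕ}
  {𝔞 : Ideal (MvPolynomial (Fin n) k)} {M : StandardMatching k m}
  {φ : M.Crit → cycles (vars 𝔞)}

/-- The unmatched empty set corresponds to the unit of the algebra. -/
theorem IsRepresentation.map_empty (h : IsRepresentation 𝔞 M φ) {L : M.Crit} (hL : L.1 = ∅) :
    φ L = 1 := by
  have h₁ : (φ L : Koszul (MvPolynomial (Fin n) k ⧸ 𝔞) n) ∈ koszulPiece 𝔞 0 0 := by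
    have := h.homogeneous L
    rw [hL] at this
    exact this
  obtain ⟨c, hc⟩ := Submodule.mem_span_singleton.1 (koszulPiece_zero_le h₁)
  have hc' : φ L = c • (1 : cycles (vars 𝔞)) := Subtype.ext hc.symm
  have hco : Coprime m L.1 L.1 := by
    rw [hL, coprime_iff]
    exact fun i hi => absurd hi (Finset.notMem_empty i)
  -- The empty set is coprime to itself, so φ(∅) is an idempotent multiple of 1. Its class is
  -- nonzero by linear independence, which leaves 1.
  have h₂ := h.mul_eq L L L hco (by rw [Finset.union_self])
  have hsign : shuffleSign k L.1 L.1 = 1 := by rw [hL, shuffleSign_eq, inversions_empty_left,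
    pow_zero]
  rw [hsign, one_smul] at h₂
  have h₃ : c • φ L = φ L := by
    conv_rhs => rw [← h₂]
    conv_rhs => enter [1]; rw [hc']
    rw [smul_mul_assoc, one_mul]
  have h₄ : (c - 1) • homologyClassHom 𝔞 (φ L) = 0 := by
    rw [sub_smul, one_smul, ← map_smul, h₃, sub_self]
  have h₅ : c = 1 := sub_eq_zero.1
    ((smul_eq_zero.1 h₄).resolve_right (h.linearIndependent.ne_zero L))
  rw [hc', h₅, one_smul]

/-- All partial unions of a factorization of an unmatched set are unmatched, so multiplicativity of
φ applies to one factor at a time. Thus the sign in Y_L is forced for any φ. -/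
theorem IsRepresentation.map_eq_prod (h : IsRepresentation 𝔞 M φ) (L : M.Crit) {Ls : List M.Gen}
    (hLs : IsFactorization M L.1 Ls) :
    φ L = listSign k (Ls.map Subtype.val) • (Ls.map fun G => φ G.toCrit).prod := by
  induction Ls generalizing L with
  | nil =>
    rw [h.map_empty hLs.1.symm]
    exact (one_smul k _).symm
  | cons G t ih =>
    obtain ⟨h₁, hL, hco⟩ := hLs.of_cons
    have hmem : unionOf (t.map Subtype.val) ∈ M.critical :=
      M.mem_critical_of_union hco (hL ▸ L.2)
    have h₂ := h.mul_eq G.toCrit ⟨_, hmem⟩ L hco hL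
    rw [ih ⟨_, hmem⟩ h₁] at h₂
    have h₃ := congrArg (shuffleSign k G.1 (unionOf (t.map Subtype.val)) • ·) h₂
    simp only [smul_smul] at h₃
    change _ = (shuffleSign k G.1 (unionOf (t.map Subtype.val)) *
      shuffleSign k G.1 (unionOf (t.map Subtype.val))) • φ L at h₃
    rw [shuffleSign_mul_self, one_smul] at h₃
    rw [← h₃, List.map_cons, List.map_cons, List.prod_cons, listSign, mul_smul, mul_smul_comm]

theorem IsRepresentation.mul_comm (h : IsRepresentation 𝔞 M φ) (I J : M.Crit) :
    φ I * φ J = (-1 : k) ^ (I.1.card * J.1.card) • (φ J * φ I) :=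
  cycles_mul_comm h.homogeneous I J

theorem IsRepresentation.list_prod_mem (h : IsRepresentation 𝔞 M φ) (Is : List M.Gen) :
    ((Is.map fun G => φ G.toCrit).prod : Koszul (MvPolynomial (Fin n) k ⧸ 𝔞) n) ∈
      koszulPiece 𝔞 (Is.map fun G => G.1.card).sum (Is.map fun G => lcmExp m G.1).sum :=
  list_prod_coe_mem (φ := fun G : M.Gen => φ G.toCrit) (fun G => h.homogeneous G.toCrit) Is

/-- The homomorphism from the graded commutative polynomial ring to the Koszul homology. -/
def gradedCommPolyHom (h : IsRepresentation 𝔞 M φ) :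
    GradedCommPoly M →ₐ[k] KoszulHomology (vars 𝔞) :=
  RingQuot.liftAlgHom k
    ⟨FreeAlgebra.lift k fun G : M.Gen => homologyClassHom 𝔞 (φ G.toCrit), by
      rintro _ _ ⟨I, J⟩
      simp only [map_mul, map_smul, FreeAlgebra.lift_ι_apply]
      rw [← map_mul, ← map_mul, ← map_smul]
      exact congrArg _ (h.mul_comm I.toCrit J.toCrit)⟩

theorem gradedCommPolyHom_monomialY (h : IsRepresentation 𝔞 M φ) (Is : List M.Gen) :
    gradedCommPolyHom h (monomialY M Is) =
      homologyClassHom 𝔞 (Is.map fun G => φ G.toCrit).prod := by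
  rw [monomialY, map_list_prod, map_list_prod, List.map_map, List.map_map]
  congr 1
  refine List.map_congr_left fun G _ => ?_
  rw [Function.comp_apply, Function.comp_apply, gradedCommPolyHom,
    RingQuot.liftAlgHom_mkAlgHom_apply, FreeAlgebra.lift_ι_apply]

/-- A homogeneous φ(I) corresponds to a combination of cells of multidegree m_I. Coprimality depends
on the multidegrees only, so none of the cells for I is coprime to any for J. -/
theorem IsRepresentation.homologyClass_mul_eq_zero (h : IsRepresentation 𝔞 M φ)
    (hm : IsMinGen 𝔞 m) {I J : M.Crit} (hIJ : ¬ Coprime m I.1 J.1) :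
    homologyClassHom 𝔞 (φ I * φ J) = 0 := by
  obtain ⟨C, q, hq, hd, -⟩ := M.exists_isModel (M.exp_ne_zero hm.minimal)
  obtain ⟨f, hf⟩ := hm.exists_correspondence_cycle (q := q) (φ I)
  obtain ⟨f', hf'⟩ := hm.exists_correspondence_cycle (q := q) (φ J)
  refine (hq.homologyClassHom_eq_zero_iff hd hm (f := 0) ?_).2 rfl
  refine hq.correspondence_mul_of_not_coprime hm hf hf' fun I' J' hI' hJ' hco => hIJ ?_
  have h₁ := (hq.correspondence_homogeneous hd hm hf (h.homogeneous I) hI').2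
  have h₂ := (hq.correspondence_homogeneous hd hm hf' (h.homogeneous J) hJ').2
  unfold Coprime at hco ⊢
  rwa [h₁, h₂] at hco

/-- The homomorphism from the presented algebra to the Koszul homology. -/
def presentationHom (hm : IsMinGen 𝔞 m) (h : IsRepresentation 𝔞 M φ) :
    RPrime 𝔞 M φ →ₐ[k] KoszulHomology (vars 𝔞) :=
  RingQuot.liftAlgHom k ⟨gradedCommPolyHom h, by
    intro x y hxy
    cases hxy with
    | not_coprime I J hIJ =>
      rw [gradedCommPolyHom_monomialY, map_zero]
      simp only [List.map_cons, List.map_nil, List.prod_cons, List.prod_nil, mul_one]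
      exact h.homologyClass_mul_eq_zero hm hIJ
    | sum Is a fac hfac hb =>
      rw [gradedCommPolyHom_monomialY, map_sum]
      rw [← homologyClassHom_eq_zero_iff, map_sub, sub_eq_zero] at hb
      rw [hb, map_sum]
      refine Finset.sum_congr rfl fun L _ => ?_
      rw [map_smul, map_smul, gradedCommPolyHom_monomialY, h.map_eq_prod L (hfac L), map_smul,
        smul_smul]
    | boundary Is hb =>
      rw [gradedCommPolyHom_monomialY, map_zero]
      exact homologyClassHom_eq_zero_iff.2 hb⟩

theorem presentationHom_mon (hm : IsMinGen 𝔞 m) (h : IsRepresentation 𝔞 M φ) (Is : List M.Gen) :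
    presentationHom hm h (RPrime.mon 𝔞 M φ Is) =
      homologyClassHom 𝔞 (Is.map fun G => φ G.toCrit).prod := by
  rw [presentationHom, RPrime.mon, RingQuot.liftAlgHom_mkAlgHom_apply, gradedCommPolyHom_monomialY]

theorem mon_append (Is Js : List M.Gen) :
    RPrime.mon 𝔞 M φ (Is ++ Js) = RPrime.mon 𝔞 M φ Is * RPrime.mon 𝔞 M φ Js := by
  simp only [RPrime.mon, monomialY, List.map_append, List.prod_append, map_mul]

theorem span_range_mon : Submodule.span k (Set.range (RPrime.mon 𝔞 M φ)) = ⊤ := by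
  rw [eq_top_iff]
  rintro x -
  obtain ⟨y, rfl⟩ := RingQuot.mkAlgHom_surjective k (HomologyRel 𝔞 M φ) x
  obtain ⟨z, rfl⟩ := RingQuot.mkAlgHom_surjective k (GradedCommRel M) y
  have hnil : RPrime.mon 𝔞 M φ [] = 1 := map_one _
  induction z using FreeAlgebra.induction with
  | grade0 r =>
    rw [AlgHom.commutes, AlgHom.commutes, Algebra.algebraMap_eq_smul_one, ← hnil]
    exact Submodule.smul_mem _ _ (Submodule.subset_span ⟨_, rfl⟩)
  | grade1 G =>
    refine Submodule.subset_span ⟨[G], ?_⟩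
    simp only [RPrime.mon, monomialY, List.map_cons, List.map_nil, List.prod_cons, List.prod_nil,
      mul_one]
  | mul a b ha hb =>
    rw [map_mul, map_mul]
    have := Submodule.mul_mem_mul ha hb
    rw [Submodule.span_mul_span] at this
    refine Submodule.span_mono ?_ this
    rintro _ ⟨_, ⟨Is, rfl⟩, _, ⟨Js, rfl⟩, rfl⟩
    exact ⟨Is ++ Js, mon_append Is Js⟩
  | add a b ha hb =>
    rw [map_add, map_add]
    exact Submodule.add_mem _ ha hb

theorem IsRepresentation.exists_homologyClass_eq_sum (h : IsRepresentation 𝔞 M φ)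
    (z : cycles (vars 𝔞)) :
    ∃ c : M.Crit → k, homologyClassHom 𝔞 z = homologyClassHom 𝔞 (∑ L, c L • φ L) := by
  have : homologyClassHom 𝔞 z ∈ Submodule.span k (Set.range fun L => homologyClass (φ L)) := by
    rw [h.span_eq_top]
    exact Submodule.mem_top
  obtain ⟨c, hc⟩ := (Submodule.mem_span_range_iff_exists_fun k).1 this
  refine ⟨c, ?_⟩
  rw [← hc, map_sum]
  exact Finset.sum_congr rfl fun L _ => (map_smul (homologyClassHom 𝔞) (c L) (φ L)).symm

/-- The classes [φ(L)] span homology, so every monomial is the left-hand side of some `sum` relation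
and equals a combination of the Y_L. -/
theorem IsRepresentation.span_mon_factorization (h : IsRepresentation 𝔞 M φ)
    {fac : M.Crit → List M.Gen} (hfac : ∀ L : M.Crit, IsFactorization M L.1 (fac L)) :
    Submodule.span k (Set.range fun L => RPrime.mon 𝔞 M φ (fac L)) = ⊤ := by
  rw [eq_top_iff, ← span_range_mon, Submodule.span_le]
  rintro _ ⟨Is, rfl⟩
  obtain ⟨a, ha⟩ := h.exists_homologyClass_eq_sum (Is.map fun G => φ G.toCrit).prod
  rw [← sub_eq_zero, ← map_sub, homologyClassHom_eq_zero_iff] at ha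
  have := RingQuot.mkAlgHom_rel k (HomologyRel.sum Is a fac hfac ha)
  rw [map_sum] at this
  change RPrime.mon 𝔞 M φ Is = _ at this
  rw [SetLike.mem_coe, this]
  refine Submodule.sum_mem _ fun L _ => ?_
  rw [map_smul]
  exact Submodule.smul_mem _ _ (Submodule.subset_span ⟨L, rfl⟩)

theorem presentationHom_mon_factorization (hm : IsMinGen 𝔞 m) (h : IsRepresentation 𝔞 M φ)
    {L : M.Crit} {Ls : List M.Gen} (hLs : IsFactorization M L.1 Ls) :
    presentationHom hm h (listSign k (Ls.map Subtype.val) • RPrime.mon 𝔞 M φ Ls) =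
      homologyClassHom 𝔞 (φ L) := by
  rw [map_smul, presentationHom_mon, h.map_eq_prod L hLs, map_smul]

theorem presentationHom_smul_mon_factorization (hm : IsMinGen 𝔞 m) (h : IsRepresentation 𝔞 M φ)
    {L : M.Crit} {Ls : List M.Gen} (hLs : IsFactorization M L.1 Ls) (c : k) :
    presentationHom hm h (c • (listSign k (Ls.map Subtype.val) • RPrime.mon 𝔞 M φ Ls)) =
      homologyClassHom 𝔞 (c • φ L) := by
  have h₁ := presentationHom_mon_factorization hm h hLs
  generalize listSign k (Ls.map Subtype.val) • RPrime.mon 𝔞 M φ Ls = x at *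
  rw [map_smul, map_smul, h₁]

/-- The spanning family of the ±Y_L maps to the basis [φ(L)], which proves injectivity and
surjectivity at once. -/
theorem presentationHom_bijective (hm : IsMinGen 𝔞 m) (h : IsRepresentation 𝔞 M φ) :
    Function.Bijective (presentationHom hm h) := by
  choose fac hfac using fun L : M.Crit => M.exists_factorization L.2
  constructor
  · rw [injective_iff_map_eq_zero]
    intro x hx
    have hx' : x ∈ Submodule.span k (Set.range fun L => RPrime.mon 𝔞 M φ (fac L)) := by
      rw [h.span_mon_factorization hfac]
      exact Submodule.mem_top
    obtain ⟨c, rfl⟩ := (Submodule.mem_span_range_iff_exists_fun k).1 hx'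
    have hmon : ∀ L, RPrime.mon 𝔞 M φ (fac L) = listSign k ((fac L).map Subtype.val) •
        (listSign k ((fac L).map Subtype.val) • RPrime.mon 𝔞 M φ (fac L)) := fun L => by
      rw [smul_smul, listSign_mul_self, one_smul]
    have h₁ : ∑ L, (c L * listSign k ((fac L).map Subtype.val)) • homologyClassHom 𝔞 (φ L) = 0 := by
      rw [← hx, map_sum]
      refine Finset.sum_congr rfl fun L _ => ?_
      rw [hmon L, map_smul, map_smul, presentationHom_mon_factorization hm h (hfac L), smul_smul]
    have h₂ := Fintype.linearIndependent_iff.1 h.linearIndependent _ h₁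
    refine Finset.sum_eq_zero fun L _ => ?_
    have h₃ : c L = 0 := by
      have := congrArg (· * listSign k ((fac L).map Subtype.val)) (h₂ L)
      simpa only [mul_assoc, listSign_mul_self, mul_one, zero_mul] using this
    rw [h₃, zero_smul]
  · intro y
    obtain ⟨z, rfl⟩ := homologyClass_surjective y
    obtain ⟨c, hc⟩ := h.exists_homologyClass_eq_sum z
    refine ⟨∑ L, c L • (listSign k ((fac L).map Subtype.val) • RPrime.mon 𝔞 M φ (fac L)), ?_⟩
    rw [hc, map_sum, map_sum]
    refine Finset.sum_congr rfl fun L _ => ?_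
    exact presentationHom_smul_mon_factorization hm h (hfac L) (c L)

/-- The class of a homogeneous cycle is a combination of the `φ(L)` of the same degree. -/
theorem IsRepresentation.exists_homogeneous_sum (hm : IsMinGen 𝔞 m)
    (h : IsRepresentation 𝔞 M φ) {p : ℕ} {α : Fin n →₀ ℕ} {z : cycles (vars 𝔞)}
    (hz : (z : Koszul (MvPolynomial (Fin n) k ⧸ 𝔞) n) ∈ koszulPiece 𝔞 p α) :
    ∃ c : M.Crit → k, (∀ L, c L ≠ 0 → L.1.card = p ∧ lcmExp m L.1 = α) ∧
      homologyClassHom 𝔞 z = homologyClassHom 𝔞 (∑ L, c L • φ L) := by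
  classical
  obtain ⟨C, q, hq, hd, -⟩ := M.exists_isModel (M.exp_ne_zero hm.minimal)
  obtain ⟨c, hc⟩ := h.exists_homologyClass_eq_sum z
  obtain ⟨f, hf⟩ := hm.exists_correspondence_cycle (q := q) z
  choose g hg using fun L => hm.exists_correspondence_cycle (q := q) (φ L)
  have hfg : f = ∑ L, c L • g L := by
    rw [← sub_eq_zero, ← map_sub] at hc
    exact sub_eq_zero.1 ((hq.homologyClassHom_eq_zero_iff hd hm
      (Submodule.sub_mem _ hf (sum_mem_correspondence hg c))).1 hc)
  -- Discarding the coefficients in other degrees changes nothing in the model, where each φ(L) is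
  -- supported in its own degree and z in degree (p, α).
  let c' : M.Crit → k := fun L => if L.1.card = p ∧ lcmExp m L.1 = α then c L else 0
  have hfg' : f = ∑ L, c' L • g L := by
    ext I
    by_cases hI : I.card = p ∧ lcmExp m I = α
    · rw [hfg, Finset.sum_apply, Finset.sum_apply]
      refine Finset.sum_congr rfl fun L _ => ?_
      rw [Pi.smul_apply, Pi.smul_apply]
      by_cases hgL : g L I = 0
      · rw [hgL, smul_zero, smul_zero]
      · have hL := hq.correspondence_homogeneous hd hm (hg L) (h.homogeneous L) hgL
        rw [hL.1, hL.2] at hI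
        rw [show c' L = c L from if_pos hI]
    · have hfI : f I = 0 := by
        by_contra hne
        exact hI (hq.correspondence_homogeneous hd hm hf hz hne)
      rw [hfI, Finset.sum_apply, eq_comm]
      refine Finset.sum_eq_zero fun L _ => ?_
      rw [Pi.smul_apply]
      by_cases hgL : g L I = 0
      · rw [hgL, smul_zero]
      · have hL := hq.correspondence_homogeneous hd hm (hg L) (h.homogeneous L) hgL
        rw [hL.1, hL.2] at hI
        rw [show c' L = 0 from if_neg hI, zero_smul]
  refine ⟨c', fun L hL => ?_, ?_⟩
  · by_contra hne
    exact hL (if_neg hne)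
  · rw [← sub_eq_zero, ← map_sub]
    refine (hq.homologyClassHom_eq_zero_iff hd hm
      (Submodule.sub_mem _ hf (sum_mem_correspondence hg c'))).2 ?_
    exact sub_eq_zero.2 hfg'

/-- Monomials map to homogeneous products. Conversely a homogeneous class is a combination of [φ(L)]
in its own degree, and the monomial Y_L has the degree of L, because lcm's of coprime sets multiply.
-/
theorem map_piece_presentationHom (hm : IsMinGen 𝔞 m) (h : IsRepresentation 𝔞 M φ) (p : ℕ)
    (α : Fin n →₀ ℕ) :
    (RPrime.piece 𝔞 M φ p α).map (presentationHom hm h).toLinearMap = homologyPiece 𝔞 p α := by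
  choose fac hfac using fun L : M.Crit => M.exists_factorization L.2
  refine le_antisymm (Submodule.map_le_iff_le_comap.2 (Submodule.span_le.2 ?_))
    (Submodule.span_le.2 ?_)
  · rintro _ ⟨Is, rfl, rfl, rfl⟩
    exact Submodule.subset_span ⟨_, h.list_prod_mem Is, (presentationHom_mon hm h Is).symm⟩
  · rintro _ ⟨z, hz, rfl⟩
    obtain ⟨c, hc, hzc⟩ := h.exists_homogeneous_sum hm hz
    rw [SetLike.mem_coe, ← homologyClassHom_apply, hzc, map_sum]
    refine Submodule.sum_mem _ fun L _ => ?_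
    by_cases hL : c L = 0
    · rw [hL, zero_smul, map_zero]
      exact Submodule.zero_mem _
    refine ⟨_, Submodule.smul_mem _ (c L) (Submodule.smul_mem _ _
      (Submodule.subset_span ⟨fac L, ?_, ?_, rfl⟩)),
      presentationHom_smul_mon_factorization hm h (hfac L) (c L)⟩
    · rw [((hfac L).sum_eq (M.exp_ne_zero hm.minimal)).1, (hc L hL).1]
    · rw [((hfac L).sum_eq (M.exp_ne_zero hm.minimal)).2, (hc L hL).2]

end Presentation

end MonomialKoszul

end
open MonomialKoszul in
theorem mainTheorem1 {k : Type*} [Field k] {n l : ℕ}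
    (𝔞 : Ideal (MvPolynomial (Fin n) k)) (m : Fin l → Fin n →₀ ℕ) (hm : IsMinGen 𝔞 m)
    (M : StandardMatching k m) :
    (∃ φ : M.Crit → cycles (vars 𝔞), IsRepresentation 𝔞 M φ) ∧
    ∀ φ : M.Crit → cycles (vars 𝔞), IsRepresentation 𝔞 M φ →
      ∃ e : RPrime 𝔞 M φ ≃ₐ[k] KoszulHomology (vars 𝔞),
        (∀ I : M.Gen, e (RPrime.mon 𝔞 M φ [I]) = homologyClass (φ I.toCrit)) ∧
        ∀ (p : ℕ) (α : Fin n →₀ ℕ),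
          (RPrime.piece 𝔞 M φ p α).map e.toLinearMap = homologyPiece 𝔞 p α := by
  refine ⟨exists_isRepresentation hm M, fun φ h =>
    ⟨AlgEquiv.ofBijective (presentationHom hm h) (presentationHom_bijective hm h), fun I => ?_,
      fun p α => map_piece_presentationHom hm h p α⟩⟩
  refine (presentationHom_mon hm h [I]).trans ?_
  simp only [List.map_cons, List.map_nil, List.prod_cons, List.prod_nil, mul_one]
  rfl
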